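/- Let $A$ be a discrete valuation ring containing a field of characteristic $0$, with maximal ideal $\mathfrak m$, residue field $\kappa=A/\mathfrak m$ and uniformizing parameter $x\in\mathfrak m$, and let $S=\mathrm{Spec}(A)$. Let $n>0$ be an integer, let $q(y)\in A[y]$ be a polynomial whose residue class in $\kappa[y]$ is not constant, let $p(y,z)\in A[y,z]$, and let $$\partial=x^{n}\partial_{y}+q(y)\partial_{z}+p(y,z)\partial_{u},$$ a (locally nilpotent) $A$-derivation of $A[y,z,u]$. Let $\sigma:\mathbb{G}_{a,S}\times_{S}\mathbb{A}^{3}_{S}\to\mathbb{A}^{3}_{S}=\mathrm{Spec}(A[y,z,u])$ be the action of the additive group $\mathbb{G}_{a,S}=\mathrm{Spec}(A[t])$ generated by $\partial$, that is, the action with comorphism $f\mapsto\sum_{i\ge 0}\frac{t^{i}}{i!}\,\partial^{i}f$. If $\sigma$ is proper, i.e. if the morphism $(\mathrm{pr}_2,\sigma):\mathbb{G}_{a,S}\times_{S}\mathbb{A}^{3}_{S}\to\mathbb{A}^{3}_{S}\times_{S}\mathbb{A}^{3}_{S}$ is proper, then $\partial$ is twin-triangulable: there are polynomials $p_{+}(y),p_{-}(y)\in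 A[y]$ and an isomorphism of $A[y]$-algebras $\tau:A[y,z,u]\to A[y,z_{+},z_{-}]$ such that $$\tau\circ\partial\circ\tau^{-1}=x^{n}\partial_{y}+p_{+}(y)\partial_{z_{+}}+p_{-}(y)\partial_{z_{-}}.$$ -/

import Mathlib

open CategoryTheory CategoryTheory.Limits AlgebraicGeometry TensorProduct

universe u

/-! Locally nilpotent derivations and their exponentials -/

section LocallyNilpotent

variable {A B : Type*} [CommRing A] [CommRing B] [Algebra A B]

/-- A derivation is locally nilpotent if every element is killed by one of its powers. -/
def IsLocallyNilpotentDerivation (D : Derivation A B B) : Prop :=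
  ∀ b : B, ∃ m : ℕ, (⇑D)^[m] b = 0

theorem derivation_iterate_add (D : Derivation A B B) (i : ℕ) (a b : B) :
    (⇑D)^[i] (a + b) = (⇑D)^[i] a + (⇑D)^[i] b :=
  iterate_map_add D i a b

theorem derivation_iterate_eq_zero_of_le (D : Derivation A B B) {b : B} {m i : ℕ}
    (h : (⇑D)^[m] b = 0) (hi : m ≤ i) : (⇑D)^[i] b = 0 := by
  obtain ⟨j, rfl⟩ := Nat.exists_eq_add_of_le hi
  rw [add_comm, Function.iterate_add_apply, h, iterate_map_zero]

theorem derivation_iterate_algebraMap (D : Derivation A B B) (a : A) {i : ℕ} (hi : 0 < i) :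
    (⇑D)^[i] (algebraMap A B a) = 0 :=
  derivation_iterate_eq_zero_of_le D (m := 1) (by simp) hi

theorem derivation_iterate_mul (D : Derivation A B B) (m : ℕ) (a b : B) :
    (⇑D)^[m] (a * b) =
      ∑ i ∈ Finset.range (m + 1), (m.choose i : B) * ((⇑D)^[i] a * (⇑D)^[m - i] b) := by
  induction m generalizing a b with
  | zero => simp
  | succ m ih =>
    rw [Function.iterate_succ_apply, D.leibniz, derivation_iterate_add, smul_eq_mul,
      smul_eq_mul, mul_comm b, ih, ih, Finset.sum_range_succ' _ (m + 1)]
    simp only [← Function.iterate_succ_apply, Nat.choose_succ_succ, Nat.cast_add, add_mul,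
      Finset.sum_add_distrib]
    rw [Finset.sum_range_succ' _ m,
      Finset.sum_range_succ (fun i => ((m.choose (i + 1) : ℕ) : B) * _) m]
    have : ∀ i ∈ Finset.range m, (((m.choose (i + 1) : ℕ) : B)) *
        ((⇑D)^[i + 1] a * (⇑D)^[(m - (i + 1)).succ] b) =
        ((m.choose (i + 1) : ℕ) : B) * ((⇑D)^[i + 1] a * (⇑D)^[m + 1 - (i + 1)] b) := by
      intro i hi
      rw [Finset.mem_range] at hi
      rw [show (m - (i + 1)).succ = m + 1 - (i + 1) by omega]
    rw [Finset.sum_congr rfl this]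
    simp only [Nat.add_sub_add_right, Nat.choose_succ_self, Nat.cast_zero, zero_mul,
      Nat.choose_zero_right, Nat.cast_one, one_mul, Function.iterate_zero, id_eq, Nat.sub_zero,
      Nat.succ_eq_add_one]
    ring

/-- The elements killed by some power of a derivation form a subalgebra. -/
def nilSubalgebra (D : Derivation A B B) : Subalgebra A B where
  carrier := {b | ∃ m : ℕ, (⇑D)^[m] b = 0}
  mul_mem' := by
    rintro a b ⟨m, hm⟩ ⟨k, hk⟩
    refine ⟨m + k, ?_⟩
    rw [derivation_iterate_mul]
    refine Finset.sum_eq_zero fun i _ => ?_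
    rcases le_or_gt m i with h | h
    · rw [derivation_iterate_eq_zero_of_le D hm h, zero_mul, mul_zero]
    · rw [derivation_iterate_eq_zero_of_le D hk (by omega), mul_zero, mul_zero]
  add_mem' := by
    rintro a b ⟨m, hm⟩ ⟨k, hk⟩
    refine ⟨m + k, ?_⟩
    rw [derivation_iterate_add, derivation_iterate_eq_zero_of_le D hm (by omega),
      derivation_iterate_eq_zero_of_le D hk (by omega), add_zero]
  algebraMap_mem' a := ⟨1, by simp⟩

theorem mem_nilSubalgebra (D : Derivation A B B) (b : B) :
    b ∈ nilSubalgebra D ↔ ∃ m : ℕ, (⇑D)^[m] b = 0 := Iff.rfl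

theorem mem_nilSubalgebra_of_apply (D : Derivation A B B) {b : B}
    (h : D b ∈ nilSubalgebra D) : b ∈ nilSubalgebra D := by
  obtain ⟨m, hm⟩ := h
  exact ⟨m + 1, by rwa [Function.iterate_succ_apply]⟩

variable (k : Type*) [Field k] [Algebra k A]

/-- The polynomial `∑ i, (D ^ i b / i!) t ^ i` in `B[t]`. -/
noncomputable def expPoly (D : Derivation A B B) (hD : IsLocallyNilpotentDerivation D) (b : B) :
    Polynomial B :=
  open Classical in
  ∑ i ∈ Finset.range (Nat.find (hD b)),
    Polynomial.monomial i (algebraMap k A ((i.factorial : k)⁻¹) • (⇑D)^[i] b)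

theorem expPoly_coeff (D : Derivation A B B) (hD : IsLocallyNilpotentDerivation D) (b : B)
    (i : ℕ) : (expPoly k D hD b).coeff i =
      algebraMap k A ((i.factorial : k)⁻¹) • (⇑D)^[i] b := by
  classical
  simp only [expPoly, Polynomial.finsetSum_coeff, Polynomial.coeff_monomial,
    Finset.sum_ite_eq', Finset.mem_range]
  split_ifs with h
  · rfl
  · have := Nat.find_spec (hD b)
    rw [derivation_iterate_eq_zero_of_le D this (by convert not_lt.mp h), smul_zero]

variable [CharZero k]

/-- The exponential `exp (t D) : B → B[t]` of a locally nilpotent `A`-derivation `D` of `B`,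
sending `b` to `∑ i, (D ^ i b / i!) t ^ i`. It is a homomorphism of `A`-algebras. -/
noncomputable def expAlgHom (D : Derivation A B B) (hD : IsLocallyNilpotentDerivation D) :
    B →ₐ[A] Polynomial B where
  toFun := expPoly k D hD
  map_one' := by
    ext i
    rw [expPoly_coeff]
    rcases Nat.eq_zero_or_pos i with rfl | hi
    · simp
    · have := derivation_iterate_algebraMap D 1 hi
      rw [map_one] at this
      rw [this, smul_zero, Polynomial.coeff_one, if_neg hi.ne']
  map_mul' a b := by
    ext m
    rw [expPoly_coeff, Polynomial.coeff_mul, derivation_iterate_mul, Finset.smul_sum,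
      Finset.Nat.sum_antidiagonal_eq_sum_range_succ
        (fun i j => (expPoly k D hD a).coeff i * (expPoly k D hD b).coeff j)]
    refine Finset.sum_congr rfl fun i hi => ?_
    have him : i ≤ m := Nat.lt_succ_iff.mp (Finset.mem_range.mp hi)
    have hc : ((m.factorial : k)⁻¹) * (m.choose i : k) =
        (i.factorial : k)⁻¹ * ((m - i).factorial : k)⁻¹ := by
      rw [Nat.cast_choose k him]
      have := Nat.cast_ne_zero (R := k).mpr m.factorial_ne_zero
      field_simp
    rw [expPoly_coeff, expPoly_coeff, smul_mul_smul_comm, ← map_mul, ← hc, map_mul, mul_smul,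
      map_natCast, Nat.cast_smul_eq_nsmul, nsmul_eq_mul]
  map_zero' := by
    ext i
    rw [expPoly_coeff, iterate_map_zero, smul_zero, Polynomial.coeff_zero]
  map_add' a b := by
    ext i
    rw [Polynomial.coeff_add, expPoly_coeff, expPoly_coeff, expPoly_coeff,
      derivation_iterate_add, smul_add]
  commutes' a := by
    ext i
    rw [expPoly_coeff, Polynomial.algebraMap_apply, Polynomial.coeff_C]
    rcases Nat.eq_zero_or_pos i with rfl | hi
    · simp
    · rw [derivation_iterate_algebraMap D a hi, smul_zero, if_neg hi.ne']

/-- The coaction `B → A[t] ⊗ B`, `b ↦ ∑ i, t ^ i ⊗ (D ^ i b / i!)`, of the additive group on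
`Spec B` generated by a locally nilpotent `A`-derivation `D` of `B`. -/
noncomputable def coaction (D : Derivation A B B) (hD : IsLocallyNilpotentDerivation D) :
    B →ₐ[A] Polynomial A ⊗[A] B :=
  ((Algebra.TensorProduct.comm A B (Polynomial A)).toAlgHom.comp
    (polyEquivTensor A B).toAlgHom).comp (expAlgHom k D hD)

end LocallyNilpotent

/-! The action of the additive group scheme generated by a locally nilpotent derivation -/

section Action

variable (A : Type u) [CommRing A]

/-- The structure morphism `Spec B → S = Spec A` of an `A`-algebra `B`. -/
noncomputable abbrev specOver (B : Type u) [CommRing B] [Algebra A B] :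
    Spec (CommRingCat.of B) ⟶ Spec (CommRingCat.of A) :=
  Spec.map (CommRingCat.ofHom (algebraMap A B))

/-- The scheme `𝔾ₐ ×_S E`, where `S = Spec A`, `𝔾ₐ = Spec A[t]` is the additive group over `S`
and `E = Spec B`. -/
noncomputable abbrev GaProd (B : Type u) [CommRing B] [Algebra A B] : Scheme.{u} :=
  pullback (specOver A (Polynomial A)) (specOver A B)

variable {A} {B : Type u} [CommRing B] [Algebra A B]
variable (k : Type*) [Field k] [CharZero k] [Algebra k A]

/-- The action `σ : 𝔾ₐ ×_S E → E` on `E = Spec B` generated by the locally nilpotent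
`A`-derivation `D` of `B`. -/
noncomputable def gaAction (D : Derivation A B B) (hD : IsLocallyNilpotentDerivation D) :
    GaProd A B ⟶ Spec (CommRingCat.of B) :=
  (pullbackSpecIso A (Polynomial A) B).hom ≫
    Spec.map (CommRingCat.ofHom (coaction k D hD).toRingHom)

theorem gaAction_over (D : Derivation A B B) (hD : IsLocallyNilpotentDerivation D) :
    pullback.snd (specOver A (Polynomial A)) (specOver A B) ≫ specOver A B =
      gaAction k D hD ≫ specOver A B := by
  rw [gaAction, ← pullbackSpecIso_hom_snd, Category.assoc, Category.assoc,
    ← Spec.map_comp, ← Spec.map_comp, ← CommRingCat.ofHom_comp, ← CommRingCat.ofHom_comp]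
  congr 3
  ext a
  exact ((Algebra.TensorProduct.includeRight (R := A) (A := Polynomial A) (B := B)).commutes
    a).trans ((coaction k D hD).commutes a).symm

/-- The morphism `Φ = (pr₂, σ) : 𝔾ₐ ×_S E → E ×_S E` of the action generated by `D`. -/
noncomputable def gaGraph (D : Derivation A B B) (hD : IsLocallyNilpotentDerivation D) :
    GaProd A B ⟶ pullback (specOver A B) (specOver A B) :=
  pullback.lift (pullback.snd _ _) (gaAction k D hD) (gaAction_over k D hD)

/-- The action generated by `D` is proper if `Φ = (pr₂, σ)` is a proper morphism. -/
def GeneratesProperAction (D : Derivation A B B) (hD : IsLocallyNilpotentDerivation D) : Prop :=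
  IsProper (gaGraph k D hD)

end Action

/-! Triangular and twin-triangular derivations of `A[y, z, u]` -/

section Triangular

variable {A : Type*} [CommRing A]

/-- The polynomial ring in three variables over `A`; the variables `0`, `1`, `2` are `y`, `z`,
`u` (or `y`, `z₊`, `z₋`). -/
abbrev Poly3 (A : Type*) [CommRing A] := MvPolynomial (Fin 3) A

/-- The inclusion of `A[y]` in `A[y, z, u]`. -/
noncomputable def inclY : Polynomial A →ₐ[A] Poly3 A :=
  Polynomial.aeval (MvPolynomial.X 0)

/-- The inclusion of `A[y, z]` in `A[y, z, u]`. -/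
noncomputable def inclYZ : MvPolynomial (Fin 2) A →ₐ[A] Poly3 A :=
  MvPolynomial.aeval ![MvPolynomial.X 0, MvPolynomial.X 1]

/-- The `A`-derivation `a ∂_y + q(y) ∂_z + p(y, z) ∂_u` of `A[y, z, u]`. -/
noncomputable def triangularDerivation (a : A) (q : Polynomial A) (p : MvPolynomial (Fin 2) A) :
    Derivation A (Poly3 A) (Poly3 A) :=
  a • MvPolynomial.pderiv 0 + inclY q • MvPolynomial.pderiv 1 +
    inclYZ p • MvPolynomial.pderiv 2

/-- The `A`-derivation `a ∂_y + p₊(y) ∂_{z₊} + p₋(y) ∂_{z₋}` of `A[y, z₊, z₋]`. -/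
noncomputable def twinTriangularDerivation (a : A) (pPlus pMinus : Polynomial A) :
    Derivation A (Poly3 A) (Poly3 A) :=
  a • MvPolynomial.pderiv 0 + inclY pPlus • MvPolynomial.pderiv 1 +
    inclY pMinus • MvPolynomial.pderiv 2

/-- `D` is twin-triangulable (with coefficient `a` at `∂_y`): there is an automorphism `τ` of the
`A[y]`-algebra `A[y, z, u]` (an `A`-algebra automorphism fixing `y`), that is, a coordinate
system `(y, z₊, z₋)` over `A[y]` with `z₊ = τ⁻¹ z` and `z₋ = τ⁻¹ u`, such that `τ ∘ D ∘ τ⁻¹` is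
twin-triangular. -/
def IsTwinTriangulable (a : A) (D : Derivation A (Poly3 A) (Poly3 A)) : Prop :=
  ∃ τ : Poly3 A ≃ₐ[A] Poly3 A, τ (MvPolynomial.X 0) = MvPolynomial.X 0 ∧
    ∃ pPlus pMinus : Polynomial A,
      ∀ f : Poly3 A, τ (D (τ.symm f)) = twinTriangularDerivation a pPlus pMinus f

theorem triangularDerivation_isLocallyNilpotent (a : A) (q : Polynomial A)
    (p : MvPolynomial (Fin 2) A) :
    IsLocallyNilpotentDerivation (triangularDerivation a q p) := by
  set D := triangularDerivation a q p with hD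
  have h0 : D (MvPolynomial.X 0) = algebraMap A _ a := by
    simp [hD, triangularDerivation, MvPolynomial.pderiv_X, MvPolynomial.algebraMap_eq,
      MvPolynomial.smul_eq_C_mul]
  have h1 : D (MvPolynomial.X 1) = inclY q := by
    simp [hD, triangularDerivation, MvPolynomial.pderiv_X]
  have h2 : D (MvPolynomial.X 2) = inclYZ p := by
    simp [hD, triangularDerivation, MvPolynomial.pderiv_X]
  have m0 : MvPolynomial.X 0 ∈ nilSubalgebra D :=
    mem_nilSubalgebra_of_apply D (h0 ▸ (nilSubalgebra D).algebraMap_mem a)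
  have m1 : MvPolynomial.X 1 ∈ nilSubalgebra D := by
    refine mem_nilSubalgebra_of_apply D (h1 ▸ ?_)
    have := (Polynomial.aeval (⟨MvPolynomial.X 0, m0⟩ : nilSubalgebra D) q).2
    rwa [← Subalgebra.coe_val, ← Polynomial.aeval_algHom_apply] at this
  have m2 : MvPolynomial.X 2 ∈ nilSubalgebra D := by
    refine mem_nilSubalgebra_of_apply D (h2 ▸ ?_)
    have := (MvPolynomial.aeval (![⟨MvPolynomial.X 0, m0⟩, ⟨MvPolynomial.X 1, m1⟩] :
      Fin 2 → nilSubalgebra D) p).2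
    rw [← Subalgebra.coe_val, ← AlgHom.comp_apply, MvPolynomial.comp_aeval] at this
    have e : (MvPolynomial.aeval fun i => (nilSubalgebra D).val
        ((![⟨MvPolynomial.X 0, m0⟩, ⟨MvPolynomial.X 1, m1⟩] : Fin 2 → nilSubalgebra D) i)) =
        inclYZ (A := A) := by
      refine MvPolynomial.algHom_ext fun i => ?_
      fin_cases i <;> simp [inclYZ]
    exact e ▸ this
  intro b
  rw [← mem_nilSubalgebra]
  have htop : nilSubalgebra D = ⊤ := by
    rw [eq_top_iff, ← MvPolynomial.adjoin_range_X, Algebra.adjoin_le_iff]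
    rintro _ ⟨i, rfl⟩
    fin_cases i
    · exact m0
    · exact m1
    · exact m2
  rw [htop]
  trivial

end Triangular

/-! Put D = x^n ∂_y + q ∂_z on A[y, z], Q' = q and V = x^n z - Q(y), so that D V = 0. A shear in u
by h(y, z) replaces p by p - D h, so it suffices that p be a polynomial in y plus an element of the
image of D (`isTwinTriangulable_of_sub_eq_inclPlane`).

This is a double induction, on the degree d of p in z and on the power x^e dividing its leading
coefficient x^e p' (`exists_sub_planeDerivation_eq_inclPlane`). If e = n, then D(s z^d) with s' = p'
removes the leading term. If e < n, all q h(Q) z^d lie in the image of D, so the crux is that p' is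
congruent to some q h(Q) modulo the maximal ideal (`exists_leadingCoeff_eq_mul_comp`).

Properness is used over a valuation ring of an algebraic closure of the fraction field that
dominates A: the time between two integral points of one orbit is integral, and the special fibre
has no fixed point. Choose J with D J = x^M p; modulo x it is ∫ p'(s) (Q(s) - Q(y))^d ds. Choose a
curve y = φ(Y), z = e(Y), with φ congruent to Y modulo x, along which V = -l P with l a unit and P
monic of degree N, the degree of Q modulo the maximal ideal. Let T = J(φ, e). Two parameters with
equal P and equal T give points of one orbit with the same u. Integrality of the time makes them
close, hence q small there, and then u moves by the time multiplied by a unit, so the two parameters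
agree; a tangent version excludes double solutions. Thus the norm of (T(Z) - T(Y)) / (Z - Y) along
P(Z) = P(Y) has no integral root, and is a constant up to multiples of that constant by non-units
(`aeval_relativeNorm_ne_zero`, `coeff_succ_mem_of_no_integral_root`).

This is then read at Y = ∞. The N solutions Y_i of P(Z) = P(Y) are permuted cyclically by s ↦ ζ s,
where P(Y) = s^(-N). With t_i = T(Y_i), the product of the t_i - t_0, i ≠ 0, has degree N - 1, that
of P'. If N T were not, modulo the maximal ideal, a polynomial in P up to terms of degree less than
N, the largest difference would have degree at least N. Approximate roots in the style of Abhyankar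
and Moh take values that are polynomials in Y, hence of degree at least 0, and this forces the whole
product to have degree at least N (`IsHomogeneousConfiguration.le_deg_prod`), a contradiction. So ∫
p'(s) (Q(s) - Q(y))^d ds is modulo the maximal ideal a polynomial in Q up to low degree;
divisibility of derivatives by q makes the rest constant, and repeated differentiation gives p' = q
h(Q). -/

/-! Gauss bounds of polynomials on balls of a valued field -/

section BallBound

open Polynomial

variable {L Γ₀ : Type*} [Field L] [LinearOrderedCommGroupWithZero Γ₀]

/-- The Gauss norm of `h` on the ball of radius `γ` around `τ` is at most `μ`. -/
def BallBound (v : Valuation L Γ₀) (τ : L) (γ μ : Γ₀) (h : L[X]) : Prop :=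
  ∀ k, v ((taylor τ h).coeff k) * γ ^ k ≤ μ

variable {v : Valuation L Γ₀} {τ : L} {γ μ μ' : Γ₀} {h h' : L[X]}

theorem BallBound.mono (hb : BallBound v τ γ μ h) (hμ : μ ≤ μ') : BallBound v τ γ μ' h :=
  fun k => (hb k).trans hμ

theorem BallBound.zero : BallBound v τ γ μ 0 := fun k => by simp

theorem BallBound.one : BallBound v τ γ 1 1 := fun k => by
  rcases Nat.eq_zero_or_pos k with rfl | hk
  · simp
  · rw [taylor_one, coeff_C, if_neg hk.ne']
    simp

theorem BallBound.add (hb : BallBound v τ γ μ h) (hb' : BallBound v τ γ μ h') :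
    BallBound v τ γ μ (h + h') := fun k => by
  rw [map_add, coeff_add]
  refine (mul_le_mul_left (v.map_add _ _) _).trans ?_
  rcases max_choice (v ((taylor τ h).coeff k)) (v ((taylor τ h').coeff k)) with e | e <;> rw [e]
  · exact hb k
  · exact hb' k

theorem BallBound.neg (hb : BallBound v τ γ μ h) : BallBound v τ γ μ (-h) := fun k => by
  rw [map_neg, coeff_neg, Valuation.map_neg]
  exact hb k

theorem BallBound.sub (hb : BallBound v τ γ μ h) (hb' : BallBound v τ γ μ h') :
    BallBound v τ γ μ (h - h') := by
  rw [sub_eq_add_neg]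
  exact hb.add hb'.neg

theorem BallBound.C_mul (hb : BallBound v τ γ μ h) {c : L} (hc : v c ≤ μ') :
    BallBound v τ γ (μ' * μ) (C c * h) := fun k => by
  rw [taylor_mul, taylor_C, coeff_C_mul, map_mul, mul_assoc]
  exact mul_le_mul' hc (hb k)

theorem BallBound.sum {ι : Type*} (s : Finset ι) {f : ι → L[X]}
    (hb : ∀ i ∈ s, BallBound v τ γ μ (f i)) : BallBound v τ γ μ (∑ i ∈ s, f i) := by
  classical
  induction s using Finset.induction_on with
  | empty => exact BallBound.zero
  | insert a s ha ih =>
    rw [Finset.sum_insert ha]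
    exact (hb a (Finset.mem_insert_self a s)).add
      (ih fun i hi => hb i (Finset.mem_insert_of_mem hi))

/-- The Gauss norm is submultiplicative: in coefficient k, indexed by i + j = k, the factor γ^k
splits as γ^i γ^j. -/
theorem BallBound.mul (hγ : γ ≠ 0) (hb : BallBound v τ γ μ h) (hb' : BallBound v τ γ μ' h') :
    BallBound v τ γ (μ * μ') (h * h') := fun k => by
  rw [taylor_mul, coeff_mul]
  have hk : 0 < γ ^ k := zero_lt_iff.mpr (pow_ne_zero k hγ)
  rw [← le_div_iff₀ hk]
  refine v.map_sum_le fun i hi => ?_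
  have hi := Finset.HasAntidiagonal.mem_antidiagonal.mp hi
  rw [le_div_iff₀ hk, ← hi, pow_add, map_mul, mul_mul_mul_comm]
  exact mul_le_mul' (hb i.1) (hb' i.2)

theorem BallBound.pow (hγ : γ ≠ 0) (hb : BallBound v τ γ μ h) (m : ℕ) :
    BallBound v τ γ (μ ^ m) (h ^ m) := by
  induction m with
  | zero => simpa using BallBound.one
  | succ m ih =>
    rw [pow_succ, pow_succ]
    exact ih.mul hγ hb

theorem BallBound.prod {ι : Type*} (hγ : γ ≠ 0) (s : Finset ι) {f : ι → L[X]} {β : ι → Γ₀}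
    (hb : ∀ i ∈ s, BallBound v τ γ (β i) (f i)) :
    BallBound v τ γ (∏ i ∈ s, β i) (∏ i ∈ s, f i) := by
  classical
  induction s using Finset.induction_on with
  | empty => simpa using BallBound.one
  | insert a s ha ih =>
    rw [Finset.prod_insert ha, Finset.prod_insert ha]
    exact (hb a (Finset.mem_insert_self a s)).mul hγ
      (ih fun i hi => hb i (Finset.mem_insert_of_mem hi))

theorem taylor_X_sub_C (σ : L) : taylor τ (X - C σ) = X + C (τ - σ) := by
  rw [map_sub, taylor_X, taylor_C, C_sub]
  ring

theorem BallBound.X_sub_C {σ : L} (hγ : γ ≤ μ) (hσ : v (τ - σ) ≤ μ) :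
    BallBound v τ γ μ (X - C σ) := fun k => by
  rw [taylor_X_sub_C]
  match k with
  | 0 => simpa using hσ
  | 1 => simpa [coeff_X, coeff_C] using hγ
  | k + 2 => simp [coeff_X]

theorem BallBound.eval_le (hb : BallBound v τ γ μ h) {x : L} (hx : v (x - τ) ≤ γ) :
    v (h.eval x) ≤ μ := by
  have : h.eval x = (taylor τ h).eval (x - τ) := by rw [taylor_eval_sub]
  rw [this, eval_eq_sum_range]
  refine v.map_sum_le fun i _ => ?_
  rw [map_mul, map_pow]
  exact (mul_le_mul_right (pow_le_pow_left' hx i) _).trans (hb i)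

/-- A linear factor of norm β can be cancelled. If its root is the centre, coefficients are merely
shifted. If the root is outside the ball, the constant term of the factor dominates, and the
coefficients of `h` are bounded successively from the lowest. -/
theorem BallBound.of_mul_X_sub_C {β : Γ₀} {σ : L} (hγ : γ ≠ 0)
    (hβ : σ = τ ∧ β = γ ∨ β = v (τ - σ) ∧ γ < β)
    (hb : BallBound v τ γ (μ * β) (h * (X - C σ))) : BallBound v τ γ μ h := by
  have hβ0 : 0 < β := by
    rcases hβ with ⟨-, e⟩ | ⟨-, e⟩
    · exact e ▸ zero_lt_iff.mpr hγ
    · exact lt_of_le_of_lt zero_le e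
  unfold BallBound at hb
  rw [taylor_mul, taylor_X_sub_C] at hb
  rcases hβ with ⟨rfl, rfl⟩ | ⟨e, hlt⟩
  · intro k
    have := hb (k + 1)
    rw [sub_self, map_zero, add_zero, coeff_mul_X, pow_succ, ← mul_assoc] at this
    exact le_of_mul_le_mul_right this hβ0
  · intro k
    induction k with
    | zero =>
      have := hb 0
      rw [mul_coeff_zero, coeff_add, coeff_X_zero, coeff_C_zero, zero_add, map_mul, ← e, pow_zero,
        mul_one] at this
      rw [pow_zero, mul_one]
      exact le_of_mul_le_mul_right this hβ0
    | succ k ih =>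
      have h1 := hb (k + 1)
      rw [mul_add, coeff_add, coeff_mul_X, coeff_mul_C] at h1
      refine le_of_mul_le_mul_right ?_ hβ0
      have e2 : (taylor τ h).coeff (k + 1) * (τ - σ) =
          ((taylor τ h).coeff k + (taylor τ h).coeff (k + 1) * (τ - σ)) -
            (taylor τ h).coeff k := by ring
      have e3 : v ((taylor τ h).coeff (k + 1)) * γ ^ (k + 1) * β =
          v ((taylor τ h).coeff (k + 1) * (τ - σ)) * γ ^ (k + 1) := by
        rw [map_mul, ← e]
        ac_rfl
      rw [e3, e2]
      refine (mul_le_mul_left (v.map_sub _ _) _).trans ?_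
      rcases max_choice (v ((taylor τ h).coeff k + (taylor τ h).coeff (k + 1) * (τ - σ)))
        (v ((taylor τ h).coeff k)) with e' | e' <;> rw [e']
      · exact h1
      · rw [pow_succ, ← mul_assoc]
        exact mul_le_mul' ih hlt.le

theorem BallBound.of_mul_prod {ι : Type*} (hγ : γ ≠ 0) (s : Finset ι) {σ : ι → L} {β : ι → Γ₀}
    (hβ : ∀ i ∈ s, σ i = τ ∧ β i = γ ∨ β i = v (τ - σ i) ∧ γ < β i)
    (hb : BallBound v τ γ (μ * ∏ i ∈ s, β i) (h * ∏ i ∈ s, (X - C (σ i)))) :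
    BallBound v τ γ μ h := by
  classical
  induction s using Finset.induction_on generalizing h μ with
  | empty => simpa using hb
  | insert a s ha ih =>
    rw [Finset.prod_insert ha, Finset.prod_insert ha, ← mul_assoc, ← mul_assoc] at hb
    exact (ih (fun i hi => hβ i (Finset.mem_insert_of_mem hi)) hb).of_mul_X_sub_C hγ
      (hβ a (Finset.mem_insert_self a s))

end BallBound

/-! Approximate roots of polynomials -/

section ApproximateRoot

open Polynomial

/-- The error beyond first order is quadratic in `b`, so a gain of j in degree becomes 2 j. Writing
bounds as degree plus j covers the zero polynomial and avoids truncated subtraction. -/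
theorem degree_add_pow_sub_le {S : Type*} [CommRing S] {G b : S[X]} {g j : ℕ}
    (hG : G.degree ≤ g) (hb : b.degree + (j : ℕ) ≤ g) (k : ℕ) :
    ((G + b) ^ (k + 1) - G ^ (k + 1) - (k + 1 : ℕ) * (G ^ k * b)).degree + (2 * j : ℕ) ≤
      ((k + 1) * g : ℕ) := by
  induction k with
  | zero => simp
  | succ k ih =>
    have e : (G + b) ^ (k + 1 + 1) - G ^ (k + 1 + 1) - (k + 1 + 1 : ℕ) * (G ^ (k + 1) * b) =
        (G + b) * ((G + b) ^ (k + 1) - G ^ (k + 1) - (k + 1 : ℕ) * (G ^ k * b)) +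
          C ((k + 1 : ℕ) : S) * (G ^ k * b ^ 2) := by
      rw [map_natCast]
      push_cast
      ring
    have hb' : b.degree ≤ g := by
      refine le_trans ?_ hb
      calc b.degree = b.degree + 0 := (add_zero _).symm
        _ ≤ b.degree + ((j : ℕ) : WithBot ℕ) :=
          add_le_add_right (by exact_mod_cast Nat.zero_le j) _
    rw [e]
    refine (add_le_add_left (degree_add_le _ _) _).trans ?_
    rw [← max_add_add_right]
    refine max_le ?_ ?_
    · refine (add_le_add_left (degree_mul_le _ _) _).trans ?_
      rw [add_assoc]
      refine (add_le_add ((degree_add_le _ _).trans (max_le hG hb')) ih).trans ?_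
      exact_mod_cast (by ring_nf; rfl : g + (k + 1) * g ≤ (k + 1 + 1) * g)
    · have h1 : (C ((k + 1 : ℕ) : S) * (G ^ k * b ^ 2)).degree ≤
          ((k * g : ℕ) : WithBot ℕ) + (b.degree + b.degree) := by
        rw [← smul_eq_C_mul]
        refine (degree_smul_le _ _).trans ((degree_mul_le _ _).trans ?_)
        refine add_le_add ((degree_pow_le _ _).trans ?_) ?_
        · refine (nsmul_le_nsmul_right hG k).trans ?_
          rw [nsmul_eq_mul]
          exact_mod_cast le_rfl
        · rw [sq]
          exact degree_mul_le _ _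
      refine (add_le_add_left h1 _).trans ?_
      rw [show ((2 * j : ℕ) : WithBot ℕ) = (j : ℕ) + (j : ℕ) by rw [two_mul, Nat.cast_add],
        add_assoc, add_add_add_comm]
      refine (add_le_add_right (add_le_add hb hb) _).trans ?_
      exact_mod_cast (by ring_nf; rfl : k * g + (g + g) ≤ (k + 1 + 1) * g)

theorem degree_lt_sub_of_degree_add_le {S : Type*} [CommRing S] {p : S[X]} {j k l : ℕ}
    (h : p.degree + (j : ℕ) ≤ (k : ℕ)) (hl : l < j) : p.degree < ((k - l : ℕ) : WithBot ℕ) := by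
  rcases eq_or_ne p 0 with rfl | hp
  · rw [degree_zero]
    exact WithBot.bot_lt_coe _
  · rw [degree_eq_natDegree hp] at h ⊢
    have : p.natDegree + j ≤ k := by exact_mod_cast h
    exact_mod_cast (by omega : p.natDegree < k - l)

theorem degree_add_le_of_degree_lt_sub {S : Type*} [CommRing S] {p : S[X]} {j g : ℕ}
    (h : p.degree < ((g - j : ℕ) : WithBot ℕ)) : p.degree + ((j + 1 : ℕ)) ≤ (g : ℕ) := by
  rcases eq_or_ne p 0 with rfl | hp
  · simp
  · rw [degree_eq_natDegree hp] at h ⊢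
    have : p.natDegree < g - j := by exact_mod_cast h
    exact_mod_cast (by omega : p.natDegree + (j + 1) ≤ g)

/-- An approximate `d`-th root of `F`, obtained from `f` by corrections satisfying `P`. -/
theorem exists_approximateRoot {S : Type*} [CommRing S] [Nontrivial S] [Algebra ℚ S]
    {F f : S[X]} (hF : F.Monic) (hf : f.Monic) {d g : ℕ} (hd : 0 < d)
    (hFd : F.natDegree = d * g) (hfd : f.natDegree = g)
    (P : S[X] → Prop) (h0 : P 0)
    (hadd : ∀ r a, P r → P a → P (r + C (algebraMap ℚ S (d : ℚ)⁻¹) * a))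
    (hstep : ∀ r, P r → r.degree < g → ∃ a, P a ∧
      (F - (f + r) ^ d - a * f ^ (d - 1)).degree < ((d - 1) * g : ℕ)) :
    ∃ r, P r ∧ r.degree < g ∧ (F - (f + r) ^ d).degree < ((d - 1) * g : ℕ) := by
  obtain ⟨m, rfl⟩ : ∃ m, d = m + 1 := ⟨d - 1, by omega⟩
  simp only [Nat.add_sub_cancel] at hstep ⊢
  -- Newton iteration: j counts by how much the degree of the error has been pushed below its
  -- initial bound, and each correction gains one.
  have key : ∀ j ≤ g, ∃ r, P r ∧ r.degree < g ∧
      (F - (f + r) ^ (m + 1)).degree < (((m + 1) * g - j : ℕ) : WithBot ℕ) := by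
    intro j
    induction j with
    | zero =>
      intro _
      refine ⟨0, h0, by rw [degree_zero]; exact WithBot.bot_lt_coe _, ?_⟩
      rw [add_zero, Nat.sub_zero, ← hFd, ← degree_eq_natDegree hF.ne_zero]
      refine degree_sub_lt_left ?_ hF.ne_zero ?_
      · rw [degree_eq_natDegree hF.ne_zero, degree_eq_natDegree (hf.pow _).ne_zero,
          hf.natDegree_pow, hFd, hfd]
      · rw [hF.leadingCoeff, (hf.pow _).leadingCoeff]
    | succ j ih =>
      intro hj
      obtain ⟨r, hr, hrd, hD⟩ := ih (by omega)
      obtain ⟨a, ha, haD⟩ := hstep r hr hrd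
      have hmg : (m + 1) * g = m * g + g := by ring
      have hfm : (f ^ m).Monic := hf.pow m
      have hfmd : (f ^ m).degree = (m * g : ℕ) := by
        rw [degree_eq_natDegree hfm.ne_zero, hf.natDegree_pow, hfd]
      have had : a.degree < ((g - j : ℕ) : WithBot ℕ) := by
        have h1 : (a * f ^ m).degree < (((m + 1) * g - j : ℕ) : WithBot ℕ) := by
          have e : a * f ^ m = (F - (f + r) ^ (m + 1)) -
            (F - (f + r) ^ (m + 1) - a * f ^ m) := by ring
          rw [e]
          refine (degree_sub_le _ _).trans_lt (max_lt hD (haD.trans_le ?_))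
          exact_mod_cast (by omega : m * g ≤ (m + 1) * g - j)
        rw [hfm.degree_mul, hfmd] at h1
        by_contra hcon
        rw [not_lt] at hcon
        refine absurd h1 (not_lt.mpr ?_)
        refine le_trans ?_ (add_le_add_left hcon _)
        exact_mod_cast (by omega : (m + 1) * g - j ≤ (g - j) + m * g)
      -- Adding a / d to the root changes its d-th power by a (f + r)^(d-1) to first order, which
      -- agrees with a f^(d-1) up to smaller degree.
      set c : S := algebraMap ℚ S ((m + 1 : ℕ) : ℚ)⁻¹ with hc
      have hc1 : ((m + 1 : ℕ) : S) * c = 1 := by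
        rw [hc, ← map_natCast (algebraMap ℚ S), ← map_mul, mul_inv_cancel₀, map_one]
        exact_mod_cast Nat.succ_ne_zero m
      have hcd : (C c * a).degree < ((g - j : ℕ) : WithBot ℕ) := by
        refine lt_of_le_of_lt ?_ had
        rw [← smul_eq_C_mul]
        exact degree_smul_le c a
      refine ⟨r + C c * a, hadd r a hr ha, ?_, ?_⟩
      · refine (degree_add_le _ _).trans_lt (max_lt hrd (hcd.trans_le ?_))
        exact_mod_cast Nat.sub_le g j
      · set G := f + r with hG
        have hrf : r.degree < f.degree := by
          rwa [degree_eq_natDegree hf.ne_zero, hfd]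
        have hGm : G.Monic := hf.add_of_left hrf
        have hGd : G.degree = g := by
          rw [hG, degree_add_eq_left_of_degree_lt hrf, degree_eq_natDegree hf.ne_zero, hfd]
        have hX := degree_lt_sub_of_degree_add_le (degree_add_pow_sub_le hGd.le
          (degree_add_le_of_degree_lt_sub hcd) m) (by omega : j + 1 < 2 * (j + 1))
        have hGm' : (f ^ m - G ^ m).degree < (m * g : ℕ) := by
          rw [← hfmd]
          refine degree_sub_lt_left ?_ hfm.ne_zero ?_
          · rw [hfmd, degree_eq_natDegree (hGm.pow m).ne_zero, hGm.natDegree_pow,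
              natDegree_eq_of_degree_eq_some hGd]
          · rw [hfm.leadingCoeff, (hGm.pow m).leadingCoeff]
        have haG : (a * (f ^ m - G ^ m)).degree < (((m + 1) * g - (j + 1) : ℕ) : WithBot ℕ) := by
          rcases eq_or_ne (a * (f ^ m - G ^ m)) 0 with h | h
          · rw [h, degree_zero]
            exact WithBot.bot_lt_coe _
          · have ha0 : a ≠ 0 := left_ne_zero_of_mul h
            have hg0 : f ^ m - G ^ m ≠ 0 := right_ne_zero_of_mul h
            rw [degree_eq_natDegree ha0] at had
            rw [degree_eq_natDegree hg0] at hGm'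
            have h1 : a.natDegree < g - j := by exact_mod_cast had
            have h2 : (f ^ m - G ^ m).natDegree < m * g := by exact_mod_cast hGm'
            refine (degree_mul_le _ _).trans_lt ?_
            rw [degree_eq_natDegree ha0, degree_eq_natDegree hg0]
            exact_mod_cast (by omega :
              a.natDegree + (f ^ m - G ^ m).natDegree < (m + 1) * g - (j + 1))
        have e : F - (f + (r + C c * a)) ^ (m + 1) =
            (F - G ^ (m + 1) - a * f ^ m) + a * (f ^ m - G ^ m) -
            ((G + C c * a) ^ (m + 1) - G ^ (m + 1) - (m + 1 : ℕ) * (G ^ m * (C c * a))) := by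
          have hc2 : ((m + 1 : ℕ) : S[X]) * C c = 1 := by
            rw [← map_natCast C, ← map_mul, hc1, map_one]
          have e3 : ((m + 1 : ℕ) : S[X]) * (G ^ m * (C c * a)) = G ^ m * a := by
            rw [show ((m + 1 : ℕ) : S[X]) * (G ^ m * (C c * a)) =
              ((m + 1 : ℕ) : S[X]) * C c * (G ^ m * a) by ring, hc2, one_mul]
          rw [e3, ← add_assoc f]
          ring
        rw [e]
        refine (degree_sub_le _ _).trans_lt (max_lt ?_ hX)
        refine (degree_add_le _ _).trans_lt (max_lt (haD.trans_le ?_) haG)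
        exact_mod_cast (by omega : m * g ≤ (m + 1) * g - (j + 1))
  obtain ⟨r, h1, h2, h3⟩ := key g le_rfl
  refine ⟨r, h1, h2, ?_⟩
  rwa [show (m + 1) * g - g = m * g by rw [add_mul, one_mul, Nat.add_sub_cancel]] at h3

/-- The cofactor (G^d - G'^d) / (G - G') has coefficient d ≠ 0 in degree (d-1) g, so G ≠ G' would
give G^d - G'^d degree at least (d-1) g. -/
theorem approximateRoot_unique {S : Type*} [CommRing S] [IsDomain S] [CharZero S]
    {F G G' : S[X]} (hG : G.Monic) (hG' : G'.Monic) {d g : ℕ} (hd : 0 < d)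
    (hGd : G.natDegree = g) (hGd' : G'.natDegree = g)
    (h : (F - G ^ d).degree < ((d - 1) * g : ℕ))
    (h' : (F - G' ^ d).degree < ((d - 1) * g : ℕ)) : G = G' := by
  by_contra hne
  have hne' : G - G' ≠ 0 := sub_ne_zero.mpr hne
  set E := ∑ i ∈ Finset.range d, G ^ i * G' ^ (d - 1 - i) with hE
  have hmon : ∀ i ∈ Finset.range d, (G ^ i * G' ^ (d - 1 - i)).coeff ((d - 1) * g) = 1 ∧
      (G ^ i * G' ^ (d - 1 - i)).natDegree = (d - 1) * g := by
    intro i hi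
    have hm := (hG.pow i).mul (hG'.pow (d - 1 - i))
    have hnd : (G ^ i * G' ^ (d - 1 - i)).natDegree = (d - 1) * g := by
      rw [(hG.pow i).natDegree_mul (hG'.pow _), hG.natDegree_pow, hG'.natDegree_pow, hGd, hGd',
        ← add_mul]
      have := Finset.mem_range.mp hi
      congr 1
      omega
    exact ⟨by rw [← hnd]; exact hm, hnd⟩
  have hcoeff : E.coeff ((d - 1) * g) = d := by
    rw [hE, finsetSum_coeff, Finset.sum_congr rfl fun i hi => (hmon i hi).1]
    simp
  have hdeg : ((d - 1) * g : ℕ) ≤ E.natDegree := by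
    refine le_natDegree_of_ne_zero ?_
    rw [hcoeff]
    exact_mod_cast hd.ne'
  have hE0 : E ≠ 0 := by
    intro h0
    rw [h0, coeff_zero] at hcoeff
    exact hd.ne' (by exact_mod_cast hcoeff.symm)
  have e : (G - G') * E = (F - G' ^ d) - (F - G ^ d) := by
    rw [mul_comm, hE, Commute.geom_sum₂_mul (Commute.all _ _)]
    ring
  have h1 : ((G - G') * E).degree < ((d - 1) * g : ℕ) := by
    rw [e]
    exact (degree_sub_le _ _).trans_lt (max_lt h' h)
  rw [degree_eq_natDegree (mul_ne_zero hne' hE0), natDegree_mul hne' hE0] at h1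
  have : (G - G').natDegree + E.natDegree < (d - 1) * g := by exact_mod_cast h1
  omega

end ApproximateRoot

/-! Configurations of points in a valued field that are homogeneous under a finite group -/

section Homogeneous

open Polynomial

variable {L Γ₀ : Type*} [Field L] [LinearOrderedCommGroupWithZero Γ₀] (v : Valuation L Γ₀)
variable {ι : Type*} [AddCommGroup ι] (T : ι → L)

/-- The distances between the points `T i` are invariant under translation of the indices. -/
def IsHomogeneousConfiguration : Prop :=
  ∀ i j k, v (T (i + k) - T (j + k)) = v (T i - T j)

variable {v T}

theorem IsHomogeneousConfiguration.dist_eq (hT : IsHomogeneousConfiguration v T) (i j : ι) :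
    v (T i - T j) = v (T (i - j) - T 0) := by
  rw [← hT (i - j) 0 j, sub_add_cancel, zero_add]

/-- The indices of the points at distance at most `γ` from `T 0`. -/
def IsHomogeneousConfiguration.ball (hT : IsHomogeneousConfiguration v T) (γ : Γ₀) :
    AddSubgroup ι where
  carrier := {i | v (T i - T 0) ≤ γ}
  zero_mem' := by simp
  neg_mem' := by
    intro i hi
    have := hT.dist_eq 0 i
    rw [zero_sub, Valuation.map_sub_swap] at this
    exact (this ▸ hi : v (T (-i) - T 0) ≤ γ)
  add_mem' := by
    intro i j hi hj
    have e : T (i + j) - T 0 = (T (i + j) - T (0 + j)) + (T j - T 0) := by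
      rw [zero_add]
      ring
    change v (T (i + j) - T 0) ≤ γ
    rw [e]
    exact v.map_add_le ((hT i 0 j).trans_le hi) hj

theorem IsHomogeneousConfiguration.mem_ball (hT : IsHomogeneousConfiguration v T) {γ : Γ₀}
    {i : ι} : i ∈ hT.ball γ ↔ v (T i - T 0) ≤ γ := Iff.rfl

/-- By the ultrametric inequality the distance to `T 0` is constant on each coset other than the
ball itself. -/
theorem IsHomogeneousConfiguration.dist_congr (hT : IsHomogeneousConfiguration v T) {γ : Γ₀}
    {i j : ι} (hi : i ∉ hT.ball γ) (hij : j - i ∈ hT.ball γ) :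
    v (T j - T 0) = v (T i - T 0) := by
  rw [hT.mem_ball, not_le] at hi
  have h1 : v (T j - T i) < v (T i - T 0) := by
    rw [hT.dist_eq j i]
    exact lt_of_le_of_lt hij hi
  rw [show T j - T 0 = (T i - T 0) + (T j - T i) by ring]
  exact v.map_add_eq_of_lt_left h1

/-- The distance between two cosets of a ball, and `γ` for equal cosets. -/
noncomputable def IsHomogeneousConfiguration.cosetDist (hT : IsHomogeneousConfiguration v T)
    (γ : Γ₀) (q : ι ⧸ hT.ball γ) : Γ₀ :=
  open Classical in if q = 0 then γ else v (T q.out - T 0)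

theorem IsHomogeneousConfiguration.out_sub_mem (hT : IsHomogeneousConfiguration v T) {γ : Γ₀}
    (i : ι) : i - (i : ι ⧸ hT.ball γ).out ∈ hT.ball γ := by
  rw [← QuotientAddGroup.eq_zero_iff, QuotientAddGroup.mk_sub, QuotientAddGroup.out_eq', sub_self]

theorem IsHomogeneousConfiguration.cosetDist_mk (hT : IsHomogeneousConfiguration v T) {γ : Γ₀}
    {i : ι} (hi : i ∉ hT.ball γ) :
    hT.cosetDist γ (i : ι ⧸ hT.ball γ) = v (T i - T 0) := by
  have h0 : (i : ι ⧸ hT.ball γ) ≠ 0 := by rwa [Ne, QuotientAddGroup.eq_zero_iff]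
  rw [cosetDist, if_neg h0]
  refine (hT.dist_congr (γ := γ) (i := (i : ι ⧸ hT.ball γ).out) ?_ (hT.out_sub_mem i)).symm
  rwa [← QuotientAddGroup.eq_zero_iff, QuotientAddGroup.out_eq']

theorem IsHomogeneousConfiguration.cosetDist_zero (hT : IsHomogeneousConfiguration v T) (γ : Γ₀) :
    hT.cosetDist γ 0 = γ := if_pos rfl

theorem IsHomogeneousConfiguration.lt_cosetDist (hT : IsHomogeneousConfiguration v T) {γ : Γ₀}
    {q : ι ⧸ hT.ball γ} (hq : q ≠ 0) : γ < hT.cosetDist γ q := by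
  rw [cosetDist, if_neg hq, ← not_le, ← hT.mem_ball, ← QuotientAddGroup.eq_zero_iff,
    QuotientAddGroup.out_eq']
  exact hq

theorem IsHomogeneousConfiguration.le_cosetDist (hT : IsHomogeneousConfiguration v T) {γ : Γ₀}
    (q : ι ⧸ hT.ball γ) : γ ≤ hT.cosetDist γ q := by
  rcases eq_or_ne q 0 with rfl | hq
  · exact (hT.cosetDist_zero γ).ge
  · exact (hT.lt_cosetDist hq).le

theorem IsHomogeneousConfiguration.dist_eq_cosetDist (hT : IsHomogeneousConfiguration v T)
    {γ : Γ₀} {i j : ι} (hij : (i : ι ⧸ hT.ball γ) ≠ j) :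
    v (T i - T j) = hT.cosetDist γ ((i : ι ⧸ hT.ball γ) - j) := by
  rw [hT.dist_eq, ← QuotientAddGroup.mk_sub, hT.cosetDist_mk]
  rwa [← QuotientAddGroup.eq_zero_iff, QuotientAddGroup.mk_sub, sub_eq_zero]

theorem IsHomogeneousConfiguration.dist_le_cosetDist (hT : IsHomogeneousConfiguration v T)
    {γ : Γ₀} (i j : ι) : v (T i - T j) ≤ hT.cosetDist γ ((i : ι ⧸ hT.ball γ) - j) := by
  rcases eq_or_ne (i : ι ⧸ hT.ball γ) j with h | h
  · rw [h, sub_self, hT.cosetDist_zero, hT.dist_eq, ← hT.mem_ball, ← QuotientAddGroup.eq_zero_iff,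
      QuotientAddGroup.mk_sub, h, sub_self]
  · exact (hT.dist_eq_cosetDist h).le

theorem IsHomogeneousConfiguration.out_injective (hT : IsHomogeneousConfiguration v T)
    (hinj : Function.Injective T) (γ : Γ₀) :
    Function.Injective fun q : ι ⧸ hT.ball γ => T q.out := fun q q' h => by
  rw [← QuotientAddGroup.out_eq' q, ← QuotientAddGroup.out_eq' q', hinj h]

variable [Fintype ι]

/-- The norm on a ball of the product of the linear forms vanishing at one point of each coset. -/
noncomputable def IsHomogeneousConfiguration.cosetNorm (hT : IsHomogeneousConfiguration v T)
    (γ : Γ₀) : Γ₀ :=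
  open Classical in ∏ q : ι ⧸ hT.ball γ, hT.cosetDist γ q

section

open Classical

/-- By translation the nodal product has the same norm on the balls around all cosets. -/
theorem IsHomogeneousConfiguration.prod_cosetDist_sub (hT : IsHomogeneousConfiguration v T)
    {γ : Γ₀} (q : ι ⧸ hT.ball γ) :
    ∏ q' : ι ⧸ hT.ball γ, hT.cosetDist γ (q - q') = hT.cosetNorm γ :=
  (Equiv.subLeft q).prod_comp (hT.cosetDist γ)

/-- A polynomial of degree less than the number of cosets is bounded on the balls by its values
at one point of each. -/
theorem IsHomogeneousConfiguration.ballBound_of_eval_le (hT : IsHomogeneousConfiguration v T)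
    (hinj : Function.Injective T) {γ μ : Γ₀} (hγ : γ ≠ 0) {b : L[X]}
    (hb : b.degree < Fintype.card (ι ⧸ hT.ball γ))
    (hμ : ∀ q : ι ⧸ hT.ball γ, v (b.eval (T q.out)) ≤ μ) (q : ι ⧸ hT.ball γ) :
    BallBound v (T q.out) γ μ b := by
  have hβ : ∀ q : ι ⧸ hT.ball γ, hT.cosetDist γ q ≠ 0 := fun q =>
    (lt_of_lt_of_le (zero_lt_iff.mpr hγ) (hT.le_cosetDist q)).ne'
  rw [Lagrange.eq_interpolate (s := Finset.univ) (hT.out_injective hinj γ).injOn hb,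
    Lagrange.interpolate_apply]
  refine BallBound.sum _ fun i _ => ?_
  have hbasis : BallBound v (T q.out) γ 1
      (Lagrange.basis Finset.univ (fun q : ι ⧸ hT.ball γ => T q.out) i) := by
    have hfac : ∀ j ∈ Finset.univ.erase i, BallBound v (T q.out) γ
        ((hT.cosetDist γ (i - j))⁻¹ * hT.cosetDist γ (q - j))
        (Lagrange.basisDivisor (T i.out) (T j.out)) := by
      intro j hj
      refine BallBound.C_mul (BallBound.X_sub_C (hT.le_cosetDist _) ?_) ?_
      · have := hT.dist_le_cosetDist (γ := γ) q.out j.out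
        rwa [QuotientAddGroup.out_eq', QuotientAddGroup.out_eq'] at this
      · have hij : (i.out : ι ⧸ hT.ball γ) ≠ j.out := by
          rw [QuotientAddGroup.out_eq', QuotientAddGroup.out_eq']
          exact (Finset.ne_of_mem_erase hj).symm
        have := hT.dist_eq_cosetDist hij
        rw [QuotientAddGroup.out_eq', QuotientAddGroup.out_eq'] at this
        rw [map_inv₀, this]
    -- The bound is the quotient of cosetNorm / dist(q, i) by cosetNorm / γ, that is γ / dist(q, i),
    -- which is at most 1.
    refine (BallBound.prod hγ _ hfac).mono ?_
    rw [Finset.prod_mul_distrib, Finset.prod_inv_distrib]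
    have h1 : ∀ r : ι ⧸ hT.ball γ, hT.cosetDist γ (r - i) *
        ∏ j ∈ Finset.univ.erase i, hT.cosetDist γ (r - j) = hT.cosetNorm γ := fun r => by
      rw [Finset.mul_prod_erase Finset.univ (fun j => hT.cosetDist γ (r - j)) (Finset.mem_univ i)]
      exact hT.prod_cosetDist_sub r
    have h2 := h1 i
    rw [sub_self, hT.cosetDist_zero] at h2
    have hP : ∏ j ∈ Finset.univ.erase i, hT.cosetDist γ (i - j) ≠ 0 :=
      Finset.prod_ne_zero_iff.mpr fun j _ => hβ _
    rw [mul_comm, ← div_eq_mul_inv, div_le_one₀ (zero_lt_iff.mpr hP)]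
    refine le_of_mul_le_mul_left ?_ (zero_lt_iff.mpr hγ)
    rw [h2, ← h1 q]
    exact mul_le_mul_left (hT.le_cosetDist _) _
  have := hbasis.C_mul (hμ i)
  rwa [mul_one] at this

/-- The product of the linear forms vanishing at one point of each coset, translated by `k`. -/
noncomputable def IsHomogeneousConfiguration.nodalPoly (hT : IsHomogeneousConfiguration v T)
    (γ : Γ₀) (k : ι) : L[X] :=
  ∏ q : ι ⧸ hT.ball γ, (X - C (T (q.out + k)))

theorem IsHomogeneousConfiguration.nodalPoly_monic (hT : IsHomogeneousConfiguration v T)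
    (γ : Γ₀) (k : ι) : (hT.nodalPoly γ k).Monic :=
  monic_prod_X_sub_C _ _

theorem IsHomogeneousConfiguration.natDegree_nodalPoly (hT : IsHomogeneousConfiguration v T)
    (γ : Γ₀) (k : ι) : (hT.nodalPoly γ k).natDegree = Fintype.card (ι ⧸ hT.ball γ) :=
  natDegree_finsetProd_X_sub_C_eq_card _ _

theorem IsHomogeneousConfiguration.ballBound_nodalPoly (hT : IsHomogeneousConfiguration v T)
    {γ : Γ₀} (hγ : γ ≠ 0) {k : ι} (hk : k ∈ hT.ball γ) (q : ι ⧸ hT.ball γ) :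
    BallBound v (T q.out) γ (hT.cosetNorm γ) (hT.nodalPoly γ k) := by
  rw [← hT.prod_cosetDist_sub q]
  refine BallBound.prod hγ _ fun q' _ => BallBound.X_sub_C (hT.le_cosetDist _) ?_
  have := hT.dist_le_cosetDist (γ := γ) q.out (q'.out + k)
  rwa [QuotientAddGroup.mk_add, (QuotientAddGroup.eq_zero_iff k).mpr hk, add_zero,
    QuotientAddGroup.out_eq', QuotientAddGroup.out_eq'] at this

/-- For each linear factor the root is either the centre, for the same coset, or outside the ball,
so the factors cancel one at a time. -/
theorem IsHomogeneousConfiguration.ballBound_of_mul_nodalPoly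
    (hT : IsHomogeneousConfiguration v T) {γ μ : Γ₀} (hγ : γ ≠ 0) {h : L[X]}
    (q : ι ⧸ hT.ball γ)
    (hb : BallBound v (T q.out) γ (μ * hT.cosetNorm γ) (h * hT.nodalPoly γ 0)) :
    BallBound v (T q.out) γ μ h := by
  rw [← hT.prod_cosetDist_sub q] at hb
  simp only [nodalPoly, add_zero] at hb
  refine hb.of_mul_prod hγ _ fun q' _ => ?_
  rcases eq_or_ne q' q with rfl | hq
  · exact Or.inl ⟨rfl, by rw [sub_self, hT.cosetDist_zero]⟩
  · refine Or.inr ⟨?_, hT.lt_cosetDist (sub_ne_zero.mpr hq.symm)⟩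
    have hij : (q.out : ι ⧸ hT.ball γ) ≠ q'.out := by
      rw [QuotientAddGroup.out_eq', QuotientAddGroup.out_eq']
      exact hq.symm
    have := hT.dist_eq_cosetDist hij
    rw [QuotientAddGroup.out_eq', QuotientAddGroup.out_eq'] at this
    exact this.symm

/-- Division by powers of the nodal polynomial respects bounds on the balls. -/
theorem IsHomogeneousConfiguration.exists_quotient (hT : IsHomogeneousConfiguration v T)
    (hinj : Function.Injective T) {γ μ : Γ₀} (hγ : γ ≠ 0) (m : ℕ) {h : L[X]}
    (hb : ∀ q : ι ⧸ hT.ball γ, BallBound v (T q.out) γ (μ * hT.cosetNorm γ ^ m) h) :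
    ∃ a : L[X], (∀ q : ι ⧸ hT.ball γ, BallBound v (T q.out) γ μ a) ∧
      (h - a * hT.nodalPoly γ 0 ^ m).degree <
        ((m * Fintype.card (ι ⧸ hT.ball γ) : ℕ) : WithBot ℕ) := by
  induction m generalizing h with
  | zero =>
    refine ⟨h, fun q => by simpa using hb q, ?_⟩
    rw [pow_zero, mul_one, sub_self, degree_zero]
    exact WithBot.bot_lt_coe _
  | succ m ih =>
    set f := hT.nodalPoly γ 0 with hf
    have hfm : f.Monic := hT.nodalPoly_monic γ 0
    have hfd : f.degree = Fintype.card (ι ⧸ hT.ball γ) := by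
      rw [degree_eq_natDegree hfm.ne_zero, hT.natDegree_nodalPoly]
    have hdiv : h %ₘ f + f * (h /ₘ f) = h := modByMonic_add_div h f
    have hmod : (h %ₘ f).degree < Fintype.card (ι ⧸ hT.ball γ) :=
      hfd ▸ degree_modByMonic_lt h hfm
    -- The remainder agrees with `h` at the zeros of `f`, so interpolation bounds it; cancelling `f`
    -- in the difference then bounds the quotient.
    have hmodb : ∀ q : ι ⧸ hT.ball γ,
        BallBound v (T q.out) γ (μ * hT.cosetNorm γ ^ (m + 1)) (h %ₘ f) := by
      refine hT.ballBound_of_eval_le hinj hγ hmod fun q => ?_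
      have h0 : f.eval (T q.out) = 0 := by
        rw [hf, nodalPoly, eval_prod]
        exact Finset.prod_eq_zero (Finset.mem_univ q) (by simp)
      have : (h %ₘ f).eval (T q.out) = h.eval (T q.out) := by
        conv_rhs => rw [← hdiv]
        rw [eval_add, eval_mul, h0, zero_mul, add_zero]
      rw [this]
      exact (hb q).eval_le (by simp)
    obtain ⟨a, ha, had⟩ := ih (h := h /ₘ f) fun q => by
      refine hT.ballBound_of_mul_nodalPoly hγ q ?_
      have e : h /ₘ f * hT.nodalPoly γ 0 = h - h %ₘ f := by
        rw [← hf]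
        linear_combination hdiv
      rw [e, mul_assoc, ← pow_succ]
      exact (hb q).sub (hmodb q)
    refine ⟨a, ha, ?_⟩
    have e : h - a * f ^ (m + 1) = (h /ₘ f - a * f ^ m) * f + h %ₘ f := by
      linear_combination -hdiv
    rw [e]
    refine (degree_add_le _ _).trans_lt (max_lt ?_ (hmod.trans_le ?_))
    · rw [hfm.degree_mul, hfd]
      rw [Nat.succ_mul, Nat.cast_add]
      exact WithBot.add_lt_add_right (WithBot.coe_ne_bot) had
    · exact_mod_cast Nat.le_mul_of_pos_left _ (Nat.succ_pos m)

/-- Every index is uniquely a coset representative plus an element of the ball. -/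
theorem IsHomogeneousConfiguration.prod_X_sub_C_eq (hT : IsHomogeneousConfiguration v T)
    (γ : Γ₀) : ∏ i, (X - C (T i)) = ∏ k : hT.ball γ, hT.nodalPoly γ k := by
  have hbij : Function.Bijective fun x : hT.ball γ × (ι ⧸ hT.ball γ) => x.2.out + (x.1 : ι) := by
    constructor
    · rintro ⟨k, q⟩ ⟨k', q'⟩ h
      have h1 : q = q' := by
        have := congrArg (fun i : ι => (i : ι ⧸ hT.ball γ)) h
        simpa [QuotientAddGroup.mk_add, (QuotientAddGroup.eq_zero_iff _).mpr k.2,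
          (QuotientAddGroup.eq_zero_iff _).mpr k'.2] using this
      subst h1
      exact Prod.ext (Subtype.ext (add_left_cancel h)) rfl
    · intro i
      exact ⟨(⟨_, hT.out_sub_mem i⟩, (i : ι ⧸ hT.ball γ)), by simp⟩
  rw [← (Equiv.ofBijective _ hbij).prod_comp, Fintype.prod_prod_type]
  rfl

end

end Homogeneous

/-! ### Approximate roots and products of distances in a homogeneous configuration -/

section HomogeneousProduct

open Polynomial

open Classical in
/-- If the polynomial with roots `T i` has coefficients in `R`, then an approximate root with
coefficients in `R` has the norm of the nodal polynomial at `T 0`. -/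
theorem IsHomogeneousConfiguration.exists_norm_eval_eq {L Γ₀ R : Type*} [Field L]
    [LinearOrderedCommGroupWithZero Γ₀] {v : Valuation L Γ₀} {ι : Type*} [AddCommGroup ι]
    [Fintype ι] {T : ι → L} (hT : IsHomogeneousConfiguration v T) (hinj : Function.Injective T)
    [CommRing R] [IsDomain R] [Algebra ℚ R] [Algebra ℚ L] [CharZero L] {φ : R →+* L}
    (hv : ∀ r : ℚ, v (algebraMap ℚ L r) ≤ 1)
    {F : R[X]} (hF : F.Monic) (hFT : F.map φ = ∏ i, (X - C (T i)))
    (hG : ∀ G : R[X], ∀ i, v ((G.map φ).eval (T i)) = v ((G.map φ).eval (T 0)))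
    {i₀ : ι} (hi₀ : T i₀ ≠ T 0) :
    ∃ G : R[X], v ((G.map φ).eval (T 0)) = hT.cosetNorm (v (T i₀ - T 0)) := by
  set γ := v (T i₀ - T 0) with hγdef
  have hγ : γ ≠ 0 := (v.ne_zero_iff).mpr (sub_ne_zero.mpr hi₀)
  have hi₀m : i₀ ∈ hT.ball γ := le_rfl
  set d := Fintype.card (hT.ball γ) with hd
  set g := Fintype.card (ι ⧸ hT.ball γ) with hg
  have hdpos : 0 < d := Fintype.card_pos
  have hι : Fintype.card ι = d * g := by
    have := AddSubgroup.card_eq_card_quotient_mul_card_addSubgroup (hT.ball γ)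
    rw [Nat.card_eq_fintype_card, Nat.card_eq_fintype_card, Nat.card_eq_fintype_card] at this
    rw [this, mul_comm]
  have hFd : F.natDegree = d * g := by
    rw [← hF.natDegree_map φ, hFT, natDegree_finsetProd_X_sub_C_eq_card, Finset.card_univ, hι]
  -- an approximate root with coefficients in `R`
  obtain ⟨r, -, hrd, hr⟩ := exists_approximateRoot hF (monic_X_pow g) hdpos hFd
    (natDegree_X_pow g) (fun _ => True) trivial (fun _ _ _ _ => trivial) fun r _ _ => by
      refine ⟨(F - (X ^ g + r) ^ d) /ₘ (X ^ g) ^ (d - 1), trivial, ?_⟩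
      have hm : ((X ^ g : R[X]) ^ (d - 1)).Monic := (monic_X_pow g).pow _
      have e : F - (X ^ g + r) ^ d - (F - (X ^ g + r) ^ d) /ₘ (X ^ g) ^ (d - 1) *
          (X ^ g) ^ (d - 1) = (F - (X ^ g + r) ^ d) %ₘ (X ^ g) ^ (d - 1) := by
        linear_combination -modByMonic_add_div (F - (X ^ g + r) ^ d) ((X ^ g : R[X]) ^ (d - 1))
      rw [e]
      refine (degree_modByMonic_lt _ hm).trans_le ?_
      rw [← pow_mul, degree_X_pow, mul_comm]
  set f := hT.nodalPoly γ 0 with hf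
  have hfm : f.Monic := hT.nodalPoly_monic γ 0
  have hfb : ∀ q : ι ⧸ hT.ball γ, BallBound v (T q.out) γ (hT.cosetNorm γ) f :=
    hT.ballBound_nodalPoly hγ (zero_mem _)
  have hFb : ∀ q : ι ⧸ hT.ball γ, BallBound v (T q.out) γ (hT.cosetNorm γ ^ d) (F.map φ) := by
    intro q
    rw [hFT, hT.prod_X_sub_C_eq γ, hd, ← Finset.card_univ, ← Finset.prod_const]
    exact BallBound.prod hγ _ fun k _ => hT.ballBound_nodalPoly hγ k.2 q
  -- The same construction over `L`, started at the nodal polynomial, with corrections of norm at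
  -- most `cosetNorm` on all balls. Division by f^(d-1) keeps this bound because F has norm at most
  -- cosetNorm^d, and division by d because rationals have value at most 1.
  obtain ⟨s, hsb, hsd, hs⟩ := exists_approximateRoot (hF.map φ) hfm hdpos
    (by rw [hF.natDegree_map, hFd]) (hT.natDegree_nodalPoly γ 0)
    (fun r => ∀ q : ι ⧸ hT.ball γ, BallBound v (T q.out) γ (hT.cosetNorm γ) r)
    (fun q => BallBound.zero)
    (fun r a hr ha q => (hr q).add (((ha q).C_mul (hv _)).mono (one_mul _).le))
    (fun r hr hrd => hT.exists_quotient hinj hγ (d - 1) fun q => by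
      rw [← pow_succ', Nat.sub_add_cancel hdpos]
      exact (hFb q).sub (((hfb q).add (hr q)).pow hγ d))
  -- by uniqueness it is the same as the one over `L`
  have hXr : (X ^ g + r).Monic := (monic_X_pow g).add_of_left (by rwa [degree_X_pow])
  have hfs : s.degree < f.degree := by
    rwa [degree_eq_natDegree hfm.ne_zero, hT.natDegree_nodalPoly]
  have hrX : r.degree < (X ^ g : R[X]).degree := by rwa [degree_X_pow]
  have hGeq : (X ^ g + r).map φ = f + s := by
    refine approximateRoot_unique (F := F.map φ) (g := g) (d := d) (hXr.map φ)
      (hfm.add_of_left hfs) hdpos ?_ ?_ ?_ hs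
    · rw [hXr.natDegree_map, natDegree_add_eq_left_of_degree_lt hrX, natDegree_X_pow]
    · rw [natDegree_add_eq_left_of_degree_lt hfs, hT.natDegree_nodalPoly]
    · rw [← Polynomial.map_pow, ← Polynomial.map_sub]
      exact (degree_map_le).trans_lt hr
  refine ⟨X ^ g + r, ?_⟩
  rw [← hG _ (0 : ι ⧸ hT.ball γ).out]
  have hval : ∀ q : ι ⧸ hT.ball γ, v (((X ^ g + r).map φ).eval (T q.out)) =
      v (s.eval (T q.out)) := fun q => by
    rw [hGeq, eval_add]
    have h0 : f.eval (T q.out) = 0 := by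
      rw [hf, nodalPoly, eval_prod]
      exact Finset.prod_eq_zero (Finset.mem_univ q) (by simp)
    rw [h0, zero_add]
  set η := v (((X ^ g + r).map φ).eval (T (0 : ι ⧸ hT.ball γ).out)) with hη
  have hle : η ≤ hT.cosetNorm γ := by
    rw [hη, hval]
    exact (hsb 0).eval_le (by simp)
  refine le_antisymm hle (not_lt.mp fun hlt => ?_)
  -- If η were less than `cosetNorm`, interpolation would bound `s` by η on the whole ball. At a
  -- point at distance exactly γ from the centre, `f` has norm exactly `cosetNorm`, so the
  -- approximate root would have different norms at two points of the configuration.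
  have hsb' := hT.ballBound_of_eval_le (μ := η) hinj hγ hsd (fun q => by
    rw [← hval, hη, hG _ q.out, hG _ (0 : ι ⧸ hT.ball γ).out]) 0
  set j := (0 : ι ⧸ hT.ball γ).out + i₀ with hj
  have hjd : v (T j - T (0 : ι ⧸ hT.ball γ).out) = γ := by
    rw [hT.dist_eq, hj, add_sub_cancel_left]
  have h1 : v (s.eval (T j)) ≤ η := hsb'.eval_le hjd.le
  have h2 : v (f.eval (T j)) = hT.cosetNorm γ := by
    rw [hf, nodalPoly, eval_prod, map_prod, cosetNorm, ← Equiv.prod_comp (Equiv.neg _)]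
    refine Finset.prod_congr rfl fun q _ => ?_
    rw [eval_sub, eval_X, eval_C, add_zero, Equiv.neg_apply]
    rcases eq_or_ne q 0 with rfl | hq
    · rw [neg_zero, hT.cosetDist_zero, hjd]
    · have hjq : ((j : ι) : ι ⧸ hT.ball γ) = 0 := by
        rw [hj, QuotientAddGroup.mk_add, QuotientAddGroup.out_eq',
          (QuotientAddGroup.eq_zero_iff _).mpr hi₀m, add_zero]
      rw [hT.dist_eq_cosetDist (γ := γ), hjq, QuotientAddGroup.out_eq', zero_sub, neg_neg]
      rw [hjq, QuotientAddGroup.out_eq']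
      exact (neg_ne_zero.mpr hq).symm
  have h3 : v (((X ^ g + r).map φ).eval (T j)) = hT.cosetNorm γ := by
    rw [hGeq, eval_add, v.map_add_eq_of_lt_left, h2]
    rw [h2]
    exact h1.trans_lt hlt
  rw [hG _ j, ← hG _ (0 : ι ⧸ hT.ball γ).out, ← hη] at h3
  exact hlt.ne h3

-- All cosets have as many elements as the ball, so the product of `cosetDist` over all indices is a
-- power of `cosetNorm`; separating the indices in the ball, each of which contributes γ, gives the
-- other side.
open Classical in
theorem IsHomogeneousConfiguration.cosetNorm_pow {L Γ₀ : Type*} [Field L]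
    [LinearOrderedCommGroupWithZero Γ₀] {v : Valuation L Γ₀} {ι : Type*} [AddCommGroup ι]
    [Fintype ι] {T : ι → L} (hT : IsHomogeneousConfiguration v T) (γ : Γ₀) :
    hT.cosetNorm γ ^ Fintype.card (hT.ball γ) = γ ^ Fintype.card (hT.ball γ) *
      ∏ i ∈ Finset.univ.filter (fun i => i ∉ hT.ball γ), v (T i - T 0) := by
  have h1 : ∏ i : ι, hT.cosetDist γ (i : ι ⧸ hT.ball γ) =
      hT.cosetNorm γ ^ Fintype.card (hT.ball γ) := by
    have hbij : Function.Bijective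
        fun x : hT.ball γ × (ι ⧸ hT.ball γ) => x.2.out + (x.1 : ι) := by
      constructor
      · rintro ⟨k, q⟩ ⟨k', q'⟩ h
        have h1 : q = q' := by
          have := congrArg (fun i : ι => (i : ι ⧸ hT.ball γ)) h
          simpa [QuotientAddGroup.mk_add, (QuotientAddGroup.eq_zero_iff _).mpr k.2,
            (QuotientAddGroup.eq_zero_iff _).mpr k'.2] using this
        subst h1
        exact Prod.ext (Subtype.ext (add_left_cancel h)) rfl
      · intro i
        exact ⟨(⟨_, hT.out_sub_mem i⟩, (i : ι ⧸ hT.ball γ)), by simp⟩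
    rw [← (Equiv.ofBijective _ hbij).prod_comp, Fintype.prod_prod_type,
      ← Finset.card_univ, ← Finset.prod_const]
    refine Finset.prod_congr rfl fun k _ => Finset.prod_congr rfl fun q _ => ?_
    simp
  rw [← h1, ← Finset.prod_filter_mul_prod_filter_not Finset.univ (fun i => i ∈ hT.ball γ)]
  congr 1
  · rw [Finset.prod_congr rfl (g := fun _ => γ) fun i hi => ?_, Finset.prod_const,
      Fintype.card_subtype]
    rw [(QuotientAddGroup.eq_zero_iff i).mpr (Finset.mem_filter.mp hi).2, hT.cosetDist_zero]
  · exact Finset.prod_congr rfl fun i hi => hT.cosetDist_mk (Finset.mem_filter.mp hi).2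

open Classical in
/-- A lower bound for the degree of the product of the distances from `T 0` to the other
points. -/
theorem IsHomogeneousConfiguration.le_deg_prod {L Γ₀ R : Type*} [Field L]
    [LinearOrderedCommGroupWithZero Γ₀] {v : Valuation L Γ₀} {ι : Type*} [AddCommGroup ι]
    [Fintype ι] {T : ι → L} (hT : IsHomogeneousConfiguration v T) (hinj : Function.Injective T)
    [CommRing R] [IsDomain R] [Algebra ℚ R] [Algebra ℚ L] [CharZero L] {φ : R →+* L}
    (hv : ∀ r : ℚ, v (algebraMap ℚ L r) ≤ 1)
    {F : R[X]} (hF : F.Monic) (hFT : F.map φ = ∏ i, (X - C (T i)))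
    (hG : ∀ G : R[X], ∀ i, v ((G.map φ).eval (T i)) = v ((G.map φ).eval (T 0)))
    (deg : Γ₀ → ℤ) (hdeg : ∀ a b, a ≠ 0 → b ≠ 0 → deg (a * b) = deg a + deg b)
    (hGdeg : ∀ G : R[X], (G.map φ).eval (T 0) ≠ 0 → 0 ≤ deg (v ((G.map φ).eval (T 0))))
    {κ : ℤ} (hκ0 : 0 ≤ κ)
    (hκ : ∀ i, (∀ j, v (T j - T 0) ≤ v (T i - T 0)) → κ ≤ deg (v (T i - T 0)))
    (γ : Γ₀) (hγ : ∃ i, i ∉ hT.ball γ) :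
    κ * Fintype.card (hT.ball γ) ≤
      deg (∏ i ∈ Finset.univ.filter (fun i => i ∉ hT.ball γ), v (T i - T 0)) := by
  have hdeg1 : deg 1 = 0 := by
    have := hdeg 1 1 one_ne_zero one_ne_zero
    rw [mul_one] at this
    omega
  have hdegpow : ∀ a, a ≠ 0 → ∀ m : ℕ, deg (a ^ m) = m * deg a := by
    intro a ha m
    induction m with
    | zero => simp [hdeg1]
    | succ m ih =>
      rw [pow_succ, hdeg _ _ (pow_ne_zero m ha) ha, ih]
      push_cast
      ring
  have hne : ∀ γ : Γ₀, ∀ i ∉ hT.ball γ, v (T i - T 0) ≠ 0 := by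
    intro γ i hi h
    exact hi (hT.mem_ball.mpr (h ▸ zero_le))
  -- Induction on the number of points outside the ball, passing from γ to the next distance γ' that
  -- occurs.
  generalize hn : (Finset.univ.filter (fun i => i ∉ hT.ball γ)).card = n
  induction n using Nat.strong_induction_on generalizing γ with
  | _ n ih =>
    set O := Finset.univ.filter (fun i => i ∉ hT.ball γ) with hO
    have hOne : O.Nonempty := hγ.imp fun i hi => by simpa [hO] using hi
    obtain ⟨i₀, hi₀, hmin⟩ := O.exists_min_image (fun i => v (T i - T 0)) hOne
    have hi₀' : i₀ ∉ hT.ball γ := by simpa [hO] using hi₀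
    set γ' := v (T i₀ - T 0) with hγ'
    have hγ'0 : γ' ≠ 0 := hne γ i₀ hi₀'
    have hlt : γ < γ' := by rwa [hT.mem_ball, not_le] at hi₀'
    have hle : hT.ball γ ≤ hT.ball γ' := fun i hi => (hT.mem_ball.mp hi).trans hlt.le
    set O' := Finset.univ.filter (fun i => i ∉ hT.ball γ') with hO'
    have hO'O : O' ⊆ O := by
      intro i hi
      simp only [hO', hO, Finset.mem_filter, Finset.mem_univ, true_and] at hi ⊢
      exact fun h => hi (hle h)
    have hdiff : ∀ i ∈ O \ O', v (T i - T 0) = γ' := by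
      intro i hi
      rw [Finset.mem_sdiff] at hi
      refine le_antisymm ?_ (hmin i hi.1)
      have := hi.2
      simpa [hO', hT.mem_ball] using this
    have hcardO : O.card + Fintype.card (hT.ball γ) = Fintype.card ι := by
      rw [Fintype.card_subtype, hO, add_comm]
      exact Finset.card_filter_add_card_filter_not (s := Finset.univ) (fun i => i ∈ hT.ball γ)
    have hcardO' : O'.card + Fintype.card (hT.ball γ') = Fintype.card ι := by
      rw [Fintype.card_subtype, hO', add_comm]
      exact Finset.card_filter_add_card_filter_not (s := Finset.univ) (fun i => i ∈ hT.ball γ')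
    have hcardd : (O \ O').card + O'.card = O.card := Finset.card_sdiff_add_card_eq_card hO'O
    have hP' : ∏ i ∈ O', v (T i - T 0) ≠ 0 := Finset.prod_ne_zero_iff.mpr fun i hi =>
      hne γ' i (by simpa [hO'] using hi)
    have hprod : deg (∏ i ∈ O, v (T i - T 0)) =
        (O \ O').card * deg γ' + deg (∏ i ∈ O', v (T i - T 0)) := by
      rw [← Finset.prod_sdiff hO'O, Finset.prod_congr rfl hdiff, Finset.prod_const,
        hdeg _ _ (pow_ne_zero _ hγ'0) hP', hdegpow _ hγ'0]
    have hdpos : 0 < Fintype.card (hT.ball γ) := Fintype.card_pos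
    have hd'pos : 0 < Fintype.card (hT.ball γ') := Fintype.card_pos
    rw [hprod]
    by_cases hγall : ∃ i, i ∉ hT.ball γ'
    · have hsub : O'.card < O.card := by
        refine Finset.card_lt_card (Finset.ssubset_iff_subset_ne.mpr ⟨hO'O, fun h => ?_⟩)
        have : i₀ ∈ O' := h ▸ hi₀
        exact (by simpa [hO'] using this : i₀ ∉ hT.ball γ') le_rfl
      have hIH := ih O'.card (hn ▸ hsub) γ' hγall rfl
      -- With d' the size of the ball of radius γ' and S the degree of the product outside it, the
      -- d'-th power of the value of `G` has degree d' deg γ' + S, which is therefore nonnegative.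
      obtain ⟨G, hGv⟩ := hT.exists_norm_eval_eq hinj hv hF hFT hG
        (i₀ := i₀) (fun h => hγ'0 (by rw [hγ', h, sub_self, map_zero]))
      rw [← hγ'] at hGv
      have hpow := hT.cosetNorm_pow γ'
      rw [← hGv] at hpow
      have hG0 : (G.map φ).eval (T 0) ≠ 0 := by
        intro h
        rw [h, map_zero, zero_pow hd'pos.ne'] at hpow
        exact mul_ne_zero (pow_ne_zero _ hγ'0) hP' hpow.symm
      have h1 := congrArg deg hpow
      rw [hdegpow _ ((v.ne_zero_iff).mpr hG0), hdeg _ _ (pow_ne_zero _ hγ'0) hP',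
        hdegpow _ hγ'0] at h1
      have h2 : 0 ≤ Fintype.card (hT.ball γ') * deg γ' + deg (∏ i ∈ O', v (T i - T 0)) := by
        rw [← h1]
        exact mul_nonneg (Int.natCast_nonneg _) (hGdeg G hG0)
      set S := deg (∏ i ∈ O', v (T i - T 0))
      have e1 : ((O \ O').card : ℤ) = Fintype.card (hT.ball γ') - Fintype.card (hT.ball γ) := by
        omega
      have hd'Z : (0 : ℤ) < Fintype.card (hT.ball γ') := by exact_mod_cast hd'pos
      have hdZ : (0 : ℤ) < Fintype.card (hT.ball γ) := by exact_mod_cast hdpos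
      have hnn : (0 : ℤ) ≤ (O \ O').card := Int.natCast_nonneg _
      rw [e1] at hnn ⊢
      -- With d the size of the ball of radius γ, d' times the right side is (d' - d)(d' deg γ' + S)
      -- + d S; the first term is nonnegative and S ≥ κ d' by induction.
      refine le_of_mul_le_mul_left ?_ hd'Z
      nlinarith [mul_nonneg hnn h2, mul_le_mul_of_nonneg_left hIH hdZ.le]
    · push Not at hγall
      have hO'e : O' = ∅ := by
        rw [hO', Finset.filter_eq_empty_iff]
        exact fun i _ h => h (hγall i)
      rw [hO'e, Finset.prod_empty, hdeg1, add_zero, Finset.sdiff_empty]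
      have hκ' : κ ≤ deg γ' := hκ i₀ fun j => hγall j
      -- The complement of a proper subgroup is at least as large as the subgroup.
      have hhalf : Fintype.card (hT.ball γ) ≤ O.card := by
        have hdvd : Fintype.card (hT.ball γ) ∣ Fintype.card ι := by
          rw [← Nat.card_eq_fintype_card, ← Nat.card_eq_fintype_card]
          exact AddSubgroup.card_addSubgroup_dvd_card _
        have hdvd' : Fintype.card (hT.ball γ) ∣ O.card := by
          rw [← hcardO] at hdvd
          exact (Nat.dvd_add_left dvd_rfl).mp hdvd
        exact Nat.le_of_dvd (Finset.card_pos.mpr hOne) hdvd'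
      have hhZ : (Fintype.card (hT.ball γ) : ℤ) ≤ O.card := by exact_mod_cast hhalf
      calc κ * Fintype.card (hT.ball γ) ≤ κ * O.card := mul_le_mul_of_nonneg_left hhZ hκ0
        _ ≤ O.card * deg γ' := by
          rw [mul_comm]
          exact mul_le_mul_of_nonneg_left hκ' (Int.natCast_nonneg _)

end HomogeneousProduct

/-! ### A valuation of rank two -/

section LexValuation

/-- The lexicographic value group of rank two, with zero adjoined. -/
abbrev LexValueGroup : Type := WithZero (Multiplicative (ℤ ×ₗ ℤ))

/-- The value of `ϖ ^ a * s ^ b`. -/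
noncomputable def lexValue (a b : ℤ) : LexValueGroup :=
  ((Multiplicative.ofAdd (toLex (-a, -b)) : Multiplicative (ℤ ×ₗ ℤ)) : LexValueGroup)

theorem lexValue_mul (a b a' b' : ℤ) :
    lexValue a b * lexValue a' b' = lexValue (a + a') (b + b') := by
  rw [lexValue, lexValue, lexValue, ← WithZero.coe_mul, ← ofAdd_add, ← toLex_add, Prod.mk_add_mk,
    neg_add, neg_add]

theorem lexValue_zero : lexValue 0 0 = 1 := rfl

theorem lexValue_ne_zero (a b : ℤ) : lexValue a b ≠ 0 := WithZero.coe_ne_zero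

theorem lexValue_le (a b a' b' : ℤ) :
    lexValue a b ≤ lexValue a' b' ↔ a' < a ∨ a' = a ∧ b' ≤ b := by
  rw [lexValue, lexValue, WithZero.coe_le_coe, Multiplicative.ofAdd_le, Prod.Lex.toLex_le_toLex]
  simp only [neg_lt_neg_iff, neg_inj, neg_le_neg_iff, eq_comm]

theorem lexValue_pow (a b : ℤ) (m : ℕ) : lexValue a b ^ m = lexValue (m * a) (m * b) := by
  induction m with
  | zero => simp [lexValue_zero]
  | succ m ih =>
    rw [pow_succ, ih, lexValue_mul]
    push_cast
    rw [add_mul, one_mul, add_mul, one_mul]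

theorem exists_lexValue_eq {c : LexValueGroup} (hc : c ≠ 0) : ∃ a b, c = lexValue a b := by
  obtain ⟨c', rfl⟩ := WithZero.ne_zero_iff_exists.mp hc
  refine ⟨-(ofLex (Multiplicative.toAdd c')).1, -(ofLex (Multiplicative.toAdd c')).2, ?_⟩
  rw [lexValue, neg_neg, neg_neg]
  rfl

/-- The second component of an element of the lexicographic value group. -/
noncomputable def lexDegree (c : LexValueGroup) : ℤ :=
  (ofLex (Multiplicative.toAdd (WithZero.unzeroD c))).2
where WithZero.unzeroD (c : LexValueGroup) : Multiplicative (ℤ ×ₗ ℤ) :=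
  WithZero.recZeroCoe 1 id c

theorem lexDegree_lexValue (a b : ℤ) : lexDegree (lexValue a b) = -b := rfl

theorem lexDegree_mul {c d : LexValueGroup} (hc : c ≠ 0) (hd : d ≠ 0) :
    lexDegree (c * d) = lexDegree c + lexDegree d := by
  obtain ⟨a, b, rfl⟩ := exists_lexValue_eq hc
  obtain ⟨a', b', rfl⟩ := exists_lexValue_eq hd
  rw [lexValue_mul, lexDegree_lexValue, lexDegree_lexValue, lexDegree_lexValue, neg_add]

/-- An element of smaller value can be written with the exponents of the larger one, at the price of
a factor `u'` that need not be a unit. This is the ultrametric inequality in terms of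
representations. -/
theorem exists_eq_of_lexValue_le {R : Type*} [CommRing R] {ϖ s : R} {a b a' b' : ℕ}
    (hle : lexValue a' b' ≤ lexValue a b) (u g : R) :
    ∃ u' g', ϖ ^ a' * (s ^ b' * u + ϖ * g) = ϖ ^ a * (s ^ b * u' + ϖ * g') := by
  rw [lexValue_le] at hle
  rcases hle with hlt | ⟨heq, hle⟩
  · obtain ⟨c, rfl⟩ := Nat.exists_eq_add_of_lt (Int.ofNat_lt.mp hlt)
    exact ⟨0, ϖ ^ c * (s ^ b' * u + ϖ * g), by ring⟩
  · obtain rfl : a = a' := by exact_mod_cast heq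
    obtain ⟨c, rfl⟩ := Nat.exists_eq_add_of_le (Int.ofNat_le.mp hle)
    exact ⟨s ^ c * u, g, by ring⟩

/-- Data for the rank two valuation defined by `ϖ` and then by `s` modulo `ϖ`. -/
structure IsLexPair {R : Type*} [CommRing R] (ϖ s : R) : Prop where
  prime : Prime ϖ
  not_dvd : ¬ ϖ ∣ s
  not_isUnit : ∀ h g : R, ¬ IsUnit (s * h + ϖ * g)
  exists_rep : ∀ f : R, f ≠ 0 → ∃ (a b : ℕ) (u g : R), IsUnit u ∧ f = ϖ ^ a * (s ^ b * u + ϖ * g)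

namespace IsLexPair

variable {R : Type*} [CommRing R] {ϖ s : R} (hR : IsLexPair ϖ s)

open Classical in
/-- The rank two valuation of an element. -/
noncomputable def val (f : R) : LexValueGroup :=
  if hf : f ≠ 0 then lexValue (hR.exists_rep f hf).choose (hR.exists_rep f hf).choose_spec.choose
  else 0

theorem val_zero : hR.val 0 = 0 := by simp [val]

variable [IsDomain R]
include hR

/-- If a < a', then ϖ would divide s^b u. If a = a' and b < b', then modulo ϖ the power s^b cancels
and the unit u would lie in the ideal (s, ϖ). Only the left side needs a unit, so arbitrary
representations bound the value from above. -/
theorem rep_le {a b a' b' : ℕ} {u g h' g' : R} (hu : IsUnit u)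
    (h : ϖ ^ a * (s ^ b * u + ϖ * g) = ϖ ^ a' * (s ^ b' * h' + ϖ * g')) :
    lexValue a b ≤ lexValue a' b' := by
  rw [lexValue_le]
  have hϖ := hR.prime.ne_zero
  have hs : ∀ b : ℕ, ¬ ϖ ∣ s ^ b * u := fun b hd =>
    (hR.prime.dvd_or_dvd hd).elim (fun h => hR.not_dvd (hR.prime.dvd_of_dvd_pow h))
      (fun h => hR.prime.not_isUnit (isUnit_of_dvd_unit h hu))
  rcases lt_trichotomy a a' with haa | haa | haa
  · exfalso
    obtain ⟨c, rfl⟩ := Nat.exists_eq_add_of_lt haa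
    have h1 : s ^ b * u + ϖ * g = ϖ ^ (c + 1) * (s ^ b' * h' + ϖ * g') := by
      refine mul_left_cancel₀ (pow_ne_zero a hϖ) ?_
      rw [h]
      ring
    refine hs b ⟨ϖ ^ c * (s ^ b' * h' + ϖ * g') - g, ?_⟩
    rw [mul_sub, ← mul_assoc, ← pow_succ', ← h1]
    ring
  · subst haa
    right
    refine ⟨rfl, ?_⟩
    by_contra hlt
    have hlt : b < b' := by omega
    obtain ⟨c, rfl⟩ := Nat.exists_eq_add_of_lt hlt
    have h1 := mul_left_cancel₀ (pow_ne_zero a hϖ) h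
    have h2 : ϖ ∣ s ^ b * (u - s ^ (c + 1) * h') := ⟨g' - g, by linear_combination h1⟩
    rcases hR.prime.dvd_or_dvd h2 with h3 | ⟨w, hw⟩
    · exact hR.not_dvd (hR.prime.dvd_of_dvd_pow h3)
    · refine hR.not_isUnit (s ^ c * h') w ?_
      have : s * (s ^ c * h') + ϖ * w = u := by rw [← hw]; ring
      rwa [this]
  · exact Or.inl (by exact_mod_cast haa)

theorem rep_unique {a b a' b' : ℕ} {u g u' g' : R} (hu : IsUnit u) (hu' : IsUnit u')
    (h : ϖ ^ a * (s ^ b * u + ϖ * g) = ϖ ^ a' * (s ^ b' * u' + ϖ * g')) :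
    lexValue a b = lexValue a' b' :=
  le_antisymm (hR.rep_le hu h) (hR.rep_le hu' h.symm)

theorem rep_ne_zero {a b : ℕ} {u g : R} (hu : IsUnit u) :
    ϖ ^ a * (s ^ b * u + ϖ * g) ≠ 0 := by
  refine mul_ne_zero (pow_ne_zero a hR.prime.ne_zero) fun h => ?_
  have : ϖ ∣ s ^ b * u := ⟨-g, by linear_combination h⟩
  exact (hR.prime.dvd_or_dvd this).elim (fun h => hR.not_dvd (hR.prime.dvd_of_dvd_pow h))
      (fun h => hR.prime.not_isUnit (isUnit_of_dvd_unit h hu))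

theorem val_rep {a b : ℕ} {u g : R} (hu : IsUnit u) :
    hR.val (ϖ ^ a * (s ^ b * u + ϖ * g)) = lexValue a b := by
  have h0 := hR.rep_ne_zero (a := a) (b := b) (g := g) hu
  rw [val, dif_pos h0]
  obtain ⟨u', g', hu', h⟩ := (hR.exists_rep _ h0).choose_spec.choose_spec
  exact hR.rep_unique hu' hu h.symm

theorem val_le {a b : ℕ} (h g : R) :
    hR.val (ϖ ^ a * (s ^ b * h + ϖ * g)) ≤ lexValue a b := by
  by_cases h0 : ϖ ^ a * (s ^ b * h + ϖ * g) = 0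
  · rw [h0, val_zero]
    exact zero_le
  · obtain ⟨a', b', u, g', hu, he⟩ := hR.exists_rep _ h0
    rw [he, hR.val_rep hu]
    exact hR.rep_le hu he.symm

/-- The rank two valuation defined by `ϖ` and then by `s` modulo `ϖ`. -/
noncomputable def valuation : Valuation R LexValueGroup where
  toFun := hR.val
  map_zero' := hR.val_zero
  map_one' := by
    have := hR.val_rep (a := 0) (b := 0) (g := 0) isUnit_one
    simpa [lexValue_zero] using this
  map_mul' f f' := by
    by_cases hf : f = 0
    · rw [hf, zero_mul, val_zero, zero_mul]
    by_cases hf' : f' = 0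
    · rw [hf', mul_zero, val_zero, mul_zero]
    obtain ⟨a, b, u, g, hu, rfl⟩ := hR.exists_rep f hf
    obtain ⟨a', b', u', g', hu', rfl⟩ := hR.exists_rep f' hf'
    rw [hR.val_rep hu, hR.val_rep hu', lexValue_mul]
    have : ϖ ^ a * (s ^ b * u + ϖ * g) * (ϖ ^ a' * (s ^ b' * u' + ϖ * g')) =
      ϖ ^ (a + a') * (s ^ (b + b') * (u * u') +
        ϖ * (s ^ b * u * g' + g * (s ^ b' * u' + ϖ * g'))) := by ring
    rw [this, hR.val_rep (hu.mul hu')]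
    push_cast
    rfl
  map_add_le_max' := by
    have key : ∀ f f' : R, hR.val f' ≤ hR.val f → hR.val (f + f') ≤ hR.val f := by
      intro f f' hle
      by_cases hf' : f' = 0
      · rw [hf', add_zero]
      by_cases hf : f = 0
      · exfalso
        obtain ⟨a', b', u', g', hu', rfl⟩ := hR.exists_rep f' hf'
        rw [hf, val_zero, hR.val_rep hu', le_zero_iff] at hle
        exact lexValue_ne_zero _ _ hle
      obtain ⟨a, b, u, g, hu, rfl⟩ := hR.exists_rep f hf
      obtain ⟨a', b', u', g', hu', rfl⟩ := hR.exists_rep f' hf'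
      rw [hR.val_rep hu, hR.val_rep hu'] at hle
      obtain ⟨u'', g'', h⟩ := exists_eq_of_lexValue_le (ϖ := ϖ) (s := s) hle u' g'
      rw [h, hR.val_rep hu]
      have : ϖ ^ a * (s ^ b * u + ϖ * g) + ϖ ^ a * (s ^ b * u'' + ϖ * g'') =
        ϖ ^ a * (s ^ b * (u + u'') + ϖ * (g + g'')) := by ring
      rw [this]
      exact hR.val_le _ _
    intro f f'
    rcases le_total (hR.val f') (hR.val f) with h | h
    · exact (key f f' h).trans (le_max_left _ _)
    · rw [add_comm]
      exact (key f' f h).trans (le_max_right _ _)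

theorem valuation_rep {a b : ℕ} {u g : R} (hu : IsUnit u) :
    hR.valuation (ϖ ^ a * (s ^ b * u + ϖ * g)) = lexValue a b :=
  hR.val_rep hu

theorem valuation_isUnit {u : R} (hu : IsUnit u) : hR.valuation u = 1 := by
  have := hR.valuation_rep (a := 0) (b := 0) (g := 0) hu
  simpa [lexValue_zero] using this

theorem valuation_fst : hR.valuation ϖ = lexValue 1 0 := by
  have := hR.valuation_rep (a := 1) (b := 0) (g := 0) isUnit_one
  simpa using this

theorem valuation_snd : hR.valuation s = lexValue 0 1 := by
  have := hR.valuation_rep (a := 0) (b := 1) (g := 0) isUnit_one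
  simpa using this

theorem valuation_le_one (f : R) : hR.valuation f ≤ 1 := by
  have := hR.val_le (a := 0) (b := 0) f 0
  simpa [lexValue_zero, valuation] using this

theorem valuation_ne_zero {f : R} (hf : f ≠ 0) : hR.valuation f ≠ 0 := by
  obtain ⟨a, b, u, g, hu, rfl⟩ := hR.exists_rep f hf
  rw [hR.valuation_rep hu]
  exact lexValue_ne_zero _ _

/-- A ring homomorphism that multiplies `s` by a unit, fixes `ϖ`, preserves the valuation. -/
theorem valuation_map (σ : R →+* R) (hϖ : σ ϖ = ϖ) {c : R} (hc : IsUnit c) (hs : σ s = c * s)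
    (f : R) : hR.valuation (σ f) = hR.valuation f := by
  by_cases hf : f = 0
  · rw [hf, map_zero]
  obtain ⟨a, b, u, g, hu, rfl⟩ := hR.exists_rep f hf
  have : σ (ϖ ^ a * (s ^ b * u + ϖ * g)) = ϖ ^ a * (s ^ b * (c ^ b * σ u) + ϖ * σ g) := by
    simp only [map_mul, map_add, map_pow, hϖ, hs]
    ring
  rw [this, hR.valuation_rep hu, hR.valuation_rep ((hc.pow b).mul (hu.map σ))]

/-- The rank two valuation on the field of fractions. -/
noncomputable def fractionValuation : Valuation (FractionRing R) LexValueGroup :=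
  hR.valuation.extendToLocalization (S := nonZeroDivisors R) (fun _ hf h =>
    hR.valuation_ne_zero (nonZeroDivisors.ne_zero hf) ((Valuation.mem_supp_iff _ _).mp h)) _

theorem fractionValuation_algebraMap (f : R) :
    hR.fractionValuation (algebraMap R (FractionRing R) f) = hR.valuation f :=
  Valuation.extendToLocalization_apply_map_apply _ _ _ _

end IsLexPair

end LexValuation

/-! ### Adjoining roots of unity to a discrete valuation ring -/

section RootsOfUnity

/-- A discrete valuation ring of characteristic zero is dominated by one that contains a
primitive root of unity of given order. -/
theorem exists_isDiscreteValuationRing_isPrimitiveRoot (A : Type u) [CommRing A] [IsDomain A]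
    [IsDiscreteValuationRing A] [CharZero A] (N : ℕ) [NeZero N] :
    ∃ (B : Type u) (_ : CommRing B) (_ : IsDomain B) (_ : IsDiscreteValuationRing B)
      (f : A →+* B) (ζ : B), Function.Injective f ∧ IsLocalHom f ∧ IsPrimitiveRoot ζ N := by
  let K := FractionRing A
  have : CharZero K := charZero_of_injective_algebraMap (IsFractionRing.injective A K)
  have : NeZero ((N : ℕ) : K) := ⟨Nat.cast_ne_zero.mpr (NeZero.ne N)⟩
  let E := CyclotomicField N K
  have : FiniteDimensional K E := IsCyclotomicExtension.finiteDimensional {N} K E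
  -- The integral closure in the cyclotomic field is Dedekind, and its localization at a prime over
  -- the maximal ideal of `A` is a discrete valuation ring dominating `A`.
  let B := integralClosure A E
  have hD : IsDedekindDomain B := IsIntegralClosure.isDedekindDomain A K E B
  have hinj : Function.Injective (algebraMap A B) := by
    have h : Function.Injective (algebraMap A E) :=
      (algebraMap K E).injective.comp (IsFractionRing.injective A K)
    rw [IsScalarTower.algebraMap_eq A B E, RingHom.coe_comp] at h
    exact h.of_comp
  obtain ⟨P, hP, hPm⟩ := Ideal.exists_ideal_over_maximal_of_isIntegral (S := B)
    (IsLocalRing.maximalIdeal A)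
    (by rw [(RingHom.injective_iff_ker_eq_bot _).mp hinj]; exact bot_le)
  have hP0 : P ≠ ⊥ := by
    rintro rfl
    refine IsDiscreteValuationRing.not_a_field A ?_
    rw [← hPm, ← RingHom.ker_eq_comap_bot]
    exact (RingHom.injective_iff_ker_eq_bot _).mp hinj
  have hprime : P.IsPrime := hP.isPrime
  let B' := Localization.AtPrime P
  have hinj' : Function.Injective (algebraMap B B') :=
    IsLocalization.injective B' P.primeCompl_le_nonZeroDivisors
  have hz : IsPrimitiveRoot (IsCyclotomicExtension.zeta N K E) N :=
    IsCyclotomicExtension.zeta_spec N K E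
  have hzi : IsIntegral A (IsCyclotomicExtension.zeta N K E) :=
    IsIntegral.of_pow (NeZero.pos N) (by rw [hz.pow_eq_one]; exact isIntegral_one)
  have hzB : IsPrimitiveRoot (⟨_, hzi⟩ : B) N :=
    hz.of_map_of_injective (f := algebraMap B E) Subtype.val_injective
  refine ⟨B', inferInstance, inferInstance,
    IsLocalization.AtPrime.isDiscreteValuationRing_of_dedekind_domain B hP0 B',
    (algebraMap B B').comp (algebraMap A B), algebraMap B B' ⟨_, hzi⟩, hinj'.comp hinj, ⟨?_⟩,
    hzB.map_of_injective hinj'⟩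
  intro a ha
  by_contra hna
  have : algebraMap A B a ∈ P := by
    rw [← Ideal.mem_comap, hPm]
    exact (IsLocalRing.mem_maximalIdeal a).mpr hna
  exact (IsLocalRing.mem_maximalIdeal _).mp
    ((IsLocalization.AtPrime.to_map_mem_maximal_iff B' P _).mpr this) ha

end RootsOfUnity

/-! ### The rank two valuation on power series over a discrete valuation ring -/

section PowerSeriesOverDVR

open PowerSeries

variable {B : Type*} [CommRing B] [IsDomain B] [IsDiscreteValuationRing B] {ϖ : B}

theorem PowerSeries.C_dvd_iff {R : Type*} [CommRing R] (a : R) (f : R⟦X⟧) :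
    C a ∣ f ↔ ∀ i, a ∣ coeff i f := by
  constructor
  · rintro ⟨g, rfl⟩ i
    exact ⟨coeff i g, by rw [coeff_C_mul]⟩
  · intro h
    choose g hg using h
    refine ⟨PowerSeries.mk g, ?_⟩
    ext i
    rw [coeff_C_mul, coeff_mk, hg]

/-- Once the largest power of `ϖ` is removed, some coefficient is a unit. The exponent of `X` is the
least index of such a coefficient, the coefficients before it being multiples of `ϖ`. -/
theorem PowerSeries.isLexPair (hϖ : Irreducible ϖ) : IsLexPair (C ϖ) (X : B⟦X⟧) where
  prime := by
    have hp := hϖ.prime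
    refine ⟨fun h => hp.ne_zero ((map_eq_zero_iff _ C_injective).mp h), fun h => ?_,
      fun f g h => ?_⟩
    · exact hp.not_isUnit (by simpa using h.map (constantCoeff (R := B)))
    · have hker : ∀ f : B⟦X⟧, C ϖ ∣ f ↔
          PowerSeries.map (Ideal.Quotient.mk (Ideal.span {ϖ})) f = 0 := by
        intro f
        rw [PowerSeries.C_dvd_iff, PowerSeries.ext_iff]
        refine forall_congr' fun i => ?_
        rw [coeff_map, map_zero, Ideal.Quotient.eq_zero_iff_mem, Ideal.mem_span_singleton]
      have : (Ideal.span {ϖ}).IsPrime := (Ideal.span_singleton_prime hp.ne_zero).mpr hp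
      rw [hker, hker]
      rw [hker, map_mul] at h
      exact mul_eq_zero.mp h
  not_dvd h := by
    have := (PowerSeries.C_dvd_iff _ _).mp h 1
    rw [coeff_one_X] at this
    exact hϖ.not_isUnit (isUnit_of_dvd_one this)
  not_isUnit h g hu := by
    have := hu.map (constantCoeff (R := B))
    simp only [map_add, map_mul, constantCoeff_X, zero_mul, zero_add, constantCoeff_C] at this
    exact hϖ.not_isUnit (isUnit_of_mul_isUnit_left this)
  exists_rep f hf := by
    have hdvd : ∀ b : B, ¬ IsUnit b ↔ ϖ ∣ b := by
      intro b
      rw [← Ideal.mem_span_singleton, ← hϖ.maximalIdeal_eq, IsLocalRing.mem_maximalIdeal,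
        mem_nonunits_iff]
    have hfin : FiniteMultiplicity (C ϖ) f := by
      obtain ⟨i, hi⟩ := PowerSeries.exists_coeff_ne_zero_iff_ne_zero.mpr hf
      obtain ⟨n, hn⟩ := FiniteMultiplicity.of_prime_left hϖ.prime hi
      refine ⟨n, fun h => hn ?_⟩
      rw [← map_pow, PowerSeries.C_dvd_iff] at h
      exact h i
    obtain ⟨f₁, hf₁, hnd⟩ := hfin.exists_eq_pow_mul_and_not_dvd
    have hex : ∃ i, IsUnit (coeff i f₁) := by
      by_contra! h
      exact hnd ((PowerSeries.C_dvd_iff _ _).mpr fun i => (hdvd _).mp (h i))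
    classical
    refine ⟨multiplicity (C ϖ) f, Nat.find hex, ?_⟩
    set b := Nat.find hex
    have htr : C ϖ ∣ ((trunc b f₁ : Polynomial B) : B⟦X⟧) := by
      rw [PowerSeries.C_dvd_iff]
      intro i
      rw [Polynomial.coeff_coe, coeff_trunc]
      split_ifs with h
      · exact (hdvd _).mp (Nat.find_min hex h)
      · exact dvd_zero _
    obtain ⟨g, hg⟩ := htr
    refine ⟨PowerSeries.mk fun i => coeff (i + b) f₁, g, ?_, ?_⟩
    · rw [PowerSeries.isUnit_iff_constantCoeff, ← coeff_zero_eq_constantCoeff_apply, coeff_mk,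
        zero_add]
      exact Nat.find_spec hex
    · have := PowerSeries.eq_X_pow_mul_shift_add_trunc b f₁
      rw [← hg, ← this]
      exact hf₁

end PowerSeriesOverDVR

/-! ### A solution at infinity by Hensel's lemma -/

section HenselRoot

open PowerSeries

/-- A monic polynomial `P` of degree `N` takes the value `s ^ (- N)` at some `ξ / s`, where `ξ` is
a power series in `s` with constant term `1`. -/
theorem exists_powerSeries_scaleRoots_eval {B : Type*} [CommRing B] [Nontrivial B]
    {P : Polynomial B} (hP : P.Monic) (hN : IsUnit (P.natDegree : B)) (hN0 : P.natDegree ≠ 0) :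
    ∃ ξ : B⟦X⟧, constantCoeff ξ = 1 ∧ ((P.map (C (R := B))).scaleRoots X).eval ξ = 1 := by
  have hPm : (P.map (C (R := B))).Monic := hP.map _
  have hdeg : (P.map (C (R := B))).natDegree = P.natDegree := hP.natDegree_map _
  -- The equation s^N P(ξ / s) = 1 without denominators. Modulo s it becomes ξ^N = 1, with simple
  -- root 1 because N is a unit.
  set f : Polynomial B⟦X⟧ := (P.map (C (R := B))).scaleRoots X - 1 with hf
  have hfm : f.Monic := by
    have h1 : ((P.map (C (R := B))).scaleRoots X).Monic :=
      (Polynomial.monic_scaleRoots_iff X).mpr hPm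
    refine h1.sub_of_left ?_
    rw [Polynomial.degree_scaleRoots, Polynomial.degree_one, hP.degree_map]
    exact Polynomial.natDegree_pos_iff_degree_pos.mp (Nat.pos_of_ne_zero hN0)
  have hmap : f.map (constantCoeff (R := B)) = Polynomial.X ^ P.natDegree - 1 := by
    rw [hf, Polynomial.map_sub, Polynomial.map_one, Polynomial.map_scaleRoots _ _ _
      (by rw [hPm.leadingCoeff, map_one]; exact one_ne_zero), constantCoeff_X, Polynomial.map_map]
    have : (constantCoeff (R := B)).comp C = RingHom.id B := by ext; simp
    rw [this, Polynomial.map_id, Polynomial.scaleRoots_zero, hP.leadingCoeff, one_smul]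
  have hmem : ∀ g : B⟦X⟧, g ∈ Ideal.span {(X : B⟦X⟧)} ↔ constantCoeff g = 0 := fun g => by
    rw [Ideal.mem_span_singleton, X_dvd_iff]
  obtain ⟨ξ, hξ, hξ1⟩ := HenselianRing.is_henselian (I := Ideal.span {(X : B⟦X⟧)}) f hfm 1
    (by
      rw [hmem, ← Polynomial.eval_map_apply, hmap, map_one]
      simp)
    (by
      refine IsUnit.map _ (PowerSeries.isUnit_iff_constantCoeff.mpr ?_)
      rw [← Polynomial.eval_map_apply, ← Polynomial.derivative_map, hmap, map_one]
      simpa [Polynomial.derivative_X_pow] using hN)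
  refine ⟨ξ, ?_, ?_⟩
  · rw [hmem, map_sub, map_one, sub_eq_zero] at hξ1
    exact hξ1
  · have : f.eval ξ = 0 := hξ
    rwa [hf, Polynomial.eval_sub, Polynomial.eval_one, sub_eq_zero] at this

end HenselRoot

/-! ### The fibre of P at infinity -/

section ConfigurationAtInfinity

open Polynomial

/-- The `N` solutions of `P(Z) = P(Y)`, for a monic polynomial `P` of degree `N` over a discrete
valuation ring `A`, together with a valuation of rank two for which `Y` is infinitely large
compared to constants and infinitely small compared to the inverse of a uniformizer. -/
structure ConfigurationAtInfinity (A : Type u) [CommRing A] [IsLocalRing A] (P : A[X]) (N : ℕ)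
    [NeZero N] where
  L : Type u
  [field : Field L]
  φ : A →+* L
  injective : Function.Injective φ
  v : Valuation L LexValueGroup
  Y : ZMod N → L
  σ : ZMod N → L →+* L
  v_unit : ∀ a : A, IsUnit a → v (φ a) = 1
  v_mem : ∀ a ∈ IsLocalRing.maximalIdeal A, v (φ a) ≤ lexValue 1 0
  deg_v : ∀ a : A, a ≠ 0 → lexDegree (v (φ a)) = 0
  v_Y : ∀ i, v (Y i) = lexValue 0 (-1)
  σ_φ : ∀ k a, σ k (φ a) = φ a
  v_σ : ∀ k l, v (σ k l) = v l
  σ_Y : ∀ k i, σ k (Y i) = Y (i + k)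
  prod_eq : ∏ i, (X - C (Y i)) = P.map φ - C ((P.map φ).eval (Y 0))

attribute [instance] ConfigurationAtInfinity.field

theorem exists_zmod_rescale {B : Type*} [CommRing B] {N : ℕ} [NeZero N] {ζ : B}
    (hζ : IsPrimitiveRoot ζ N) :
    ∃ z : ZMod N → B, Function.Injective z ∧ (∀ i j, z (i + j) = z i * z j) ∧
      (∀ i, z i ^ N = 1) ∧ z 0 = 1 := by
  refine ⟨fun i => ζ ^ i.val, fun i j h => ?_, fun i j => ?_, fun i => ?_, by simp⟩
  · exact ZMod.val_injective N (hζ.pow_inj (ZMod.val_lt i) (ZMod.val_lt j) h)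
  · simp only
    rw [ZMod.val_add, ← pow_add, ← pow_eq_pow_mod _ hζ.pow_eq_one]
  · simp only
    rw [← pow_mul, mul_comm, pow_mul, hζ.pow_eq_one, one_pow]

/-- With Y = ξ / s and P(Y) = s^(-N), the substitutions s ↦ ζ^i s fix P(Y) and produce all its
preimages. They preserve the valuation of B[[s]] for which ϖ is infinitesimal compared to every
power of s. -/
theorem exists_configurationAtInfinity (A : Type u) [CommRing A] [IsDomain A]
    [IsDiscreteValuationRing A] [Algebra ℚ A] {P : A[X]} (hP : P.Monic) (N : ℕ) [NeZero N]
    (hN : P.natDegree = N) : Nonempty (ConfigurationAtInfinity A P N) := by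
  have : CharZero A := algebraRat.charZero A
  obtain ⟨B, _, _, _, f, ζ, hf, hfl, hζ⟩ :=
    exists_isDiscreteValuationRing_isPrimitiveRoot A N
  obtain ⟨z, hzinj, hzadd, hzN, hz0⟩ := exists_zmod_rescale hζ
  have hzu : ∀ i, IsUnit (z i) := fun i =>
    IsUnit.of_pow_eq_one (hzN i) (NeZero.ne N)
  obtain ⟨ϖ, hϖ⟩ := IsDiscreteValuationRing.exists_irreducible B
  have hR := PowerSeries.isLexPair hϖ
  have hPf : (P.map f).Monic := hP.map f
  have hdeg : (P.map f).natDegree = N := by rw [hP.natDegree_map, hN]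
  have hNu : IsUnit ((P.map f).natDegree : B) := by
    have h1 : IsUnit ((N : ℕ) : ℚ) := isUnit_iff_ne_zero.mpr (Nat.cast_ne_zero.mpr (NeZero.ne N))
    have := h1.map (f.comp (algebraMap ℚ A))
    rwa [map_natCast, ← hdeg] at this
  obtain ⟨ξ, hξ1, hξ⟩ := exists_powerSeries_scaleRoots_eval hPf hNu
    (by rw [hdeg]; exact NeZero.ne N)
  let R := PowerSeries B
  let L := FractionRing R
  let ι : R →+* L := algebraMap R L
  have hι : Function.Injective ι := IsFractionRing.injective R L
  let ψ : B →+* L := ι.comp PowerSeries.C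
  have hψ : Function.Injective ψ := hι.comp PowerSeries.C_injective
  let s : L := ι PowerSeries.X
  have hs : s ≠ 0 := fun h => PowerSeries.X_ne_zero ((map_eq_zero_iff ι hι).mp h)
  let v := hR.fractionValuation
  have hv : ∀ r : R, v (ι r) = hR.valuation r := hR.fractionValuation_algebraMap
  let ρ : ZMod N → R →+* R := fun k => PowerSeries.rescale (z k)
  have hρ : ∀ k, Function.Injective (ρ k) := fun k =>
    PowerSeries.rescale_injective (hzu k).ne_zero
  have hιρ : ∀ k, Function.Injective (ι.comp (ρ k)) := fun k => by
    rw [RingHom.coe_comp]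
    exact hι.comp (hρ k)
  let σ : ZMod N → L →+* L := fun k => IsFractionRing.lift (hιρ k)
  have hσ : ∀ k r, σ k (ι r) = ι (ρ k r) := fun k r =>
    IsFractionRing.lift_algebraMap (hιρ k) r
  have hρC : ∀ k b, ρ k (PowerSeries.C b) = PowerSeries.C b := by
    intro k b
    refine PowerSeries.ext fun i => ?_
    change PowerSeries.coeff i (PowerSeries.rescale (z k) (PowerSeries.C b)) = _
    rw [PowerSeries.coeff_rescale, PowerSeries.coeff_C]
    split_ifs with h
    · rw [h, pow_zero, one_mul]
    · rw [mul_zero]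
  have hσψ : ∀ k b, σ k (ψ b) = ψ b := fun k b => by
    rw [RingHom.comp_apply, hσ, hρC]
  have hσs : ∀ k, σ k s = ψ (z k) * s := fun k => by
    rw [hσ, PowerSeries.rescale_X, map_mul]
    rfl
  have hσσ : ∀ i j l, σ j (σ i l) = σ (i + j) l := by
    intro i j l
    obtain ⟨a, b, -, rfl⟩ := IsFractionRing.div_surjective (A := R) l
    have : ∀ r, ρ j (ρ i r) = ρ (i + j) r := fun r => by
      simp only [ρ]
      rw [PowerSeries.rescale_rescale, hzadd]
    simp only [map_div₀]
    change σ j (σ i (ι a)) / σ j (σ i (ι b)) = σ (i + j) (ι a) / σ (i + j) (ι b)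
    simp only [hσ, this]
  have hvσ : ∀ k l, v (σ k l) = v l := by
    intro k l
    obtain ⟨a, b, -, rfl⟩ := IsFractionRing.div_surjective (A := R) l
    have : ∀ r, v (σ k (ι r)) = v (ι r) := fun r => by
      rw [hσ, hv, hv]
      exact hR.valuation_map (ρ k) (hρC k ϖ) ((hzu k).map PowerSeries.C)
        (PowerSeries.rescale_X (z k)) r
    rw [map_div₀, map_div₀, map_div₀]
    exact congrArg₂ _ (this a) (this b)
  have hξu : IsUnit ξ := PowerSeries.isUnit_iff_constantCoeff.mpr (by rw [hξ1]; exact isUnit_one)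
  let y : L := ι ξ / s
  have hvy : v y = lexValue 0 (-1) := by
    have h1 : v y * lexValue 0 1 = 1 := by
      rw [← hR.valuation_snd, ← hv, ← map_mul, div_mul_cancel₀ _ hs, hv, hR.valuation_isUnit hξu]
    rw [← mul_left_inj' (lexValue_ne_zero 0 1), h1, lexValue_mul]
    rfl
  have hPy : s ^ N * ((P.map f).map ψ).eval y = 1 := by
    have h1 : ((((P.map f).map ψ)).scaleRoots s).eval (ι ξ) = 1 := by
      have := congrArg ι hξ
      rw [map_one, ← eval_map_apply, map_scaleRoots _ _ _ (by
        rw [(hPf.map _).leadingCoeff, map_one]; exact one_ne_zero), Polynomial.map_map] at this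
      exact this
    have h2 := scaleRoots_eval_mul ((P.map f).map ψ) y s
    rw [mul_div_cancel₀ _ hs, h1, hPf.natDegree_map, hdeg] at h2
    exact h2.symm
  have hval : ∀ b : B, b ≠ 0 → ∃ n : ℕ, v (ψ b) = lexValue n 0 := by
    intro b hb
    obtain ⟨n, w, rfl⟩ := IsDiscreteValuationRing.eq_unit_mul_pow_irreducible hb hϖ
    refine ⟨n, ?_⟩
    rw [RingHom.comp_apply, hv, map_mul, map_pow, map_mul, map_pow, hR.valuation_fst,
      hR.valuation_isUnit (w.isUnit.map _), one_mul, lexValue_pow, mul_one, mul_zero]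
  -- The conjugates have distinct leading terms (z i)⁻¹ / s.
  have hYinj : Function.Injective fun i => σ i y := by
    intro i j h
    have h1 : ∀ i, σ i y = ι (ρ i ξ) / (ψ (z i) * s) := fun i => by
      rw [map_div₀, hσ, hσs]
    simp only [h1] at h
    rw [div_eq_div_iff (mul_ne_zero ((map_ne_zero_iff ψ hψ).mpr (hzu i).ne_zero) hs)
      (mul_ne_zero ((map_ne_zero_iff ψ hψ).mpr (hzu j).ne_zero) hs), ← mul_assoc, ← mul_assoc,
      mul_left_inj' hs, RingHom.comp_apply, RingHom.comp_apply, ← map_mul, ← map_mul] at h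
    have h2 := congrArg (PowerSeries.constantCoeff (R := B)) (hι h)
    have h3 : ∀ k, PowerSeries.constantCoeff (ρ k ξ) = 1 := fun k => by
      change PowerSeries.constantCoeff (PowerSeries.rescale (z k) ξ) = 1
      rw [← PowerSeries.coeff_zero_eq_constantCoeff_apply, PowerSeries.coeff_rescale, pow_zero,
        one_mul, PowerSeries.coeff_zero_eq_constantCoeff_apply, hξ1]
    rw [map_mul, map_mul, h3, h3, one_mul, one_mul] at h2
    exact (hzinj h2).symm
  have hPYi : ∀ i, ((P.map f).map ψ).eval (σ i y) = ((P.map f).map ψ).eval y := by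
    intro i
    have h1 : ((P.map f).map ψ).map (σ i) = (P.map f).map ψ := by
      rw [Polynomial.map_map]
      congr 1
      ext b
      exact hσψ i b
    have h2 : ((P.map f).map ψ).eval (σ i y) = σ i (((P.map f).map ψ).eval y) := by
      rw [← eval_map_apply, h1]
    have h3 := congrArg (σ i) hPy
    rw [map_mul, map_pow, hσs, mul_pow, ← map_pow, hzN, map_one, map_one, one_mul, ← h2,
      ← hPy] at h3
    exact mul_left_cancel₀ (pow_ne_zero N hs) h3
  refine ⟨⟨L, ψ.comp f, hψ.comp hf, v, fun i => σ i y, σ, ?_, ?_, ?_, ?_, ?_, hvσ, ?_, ?_⟩⟩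
  · intro a ha
    rw [RingHom.comp_apply, RingHom.comp_apply, hv,
      hR.valuation_isUnit ((ha.map f).map PowerSeries.C)]
  · intro a ha
    by_cases ha0 : a = 0
    · rw [ha0, map_zero, map_zero]
      exact zero_le
    · have h1 : f a ∈ IsLocalRing.maximalIdeal B := by
        rw [IsLocalRing.mem_maximalIdeal, mem_nonunits_iff] at ha ⊢
        exact fun h => ha (isUnit_of_map_unit f a h)
      rw [hϖ.maximalIdeal_eq, Ideal.mem_span_singleton] at h1
      obtain ⟨c, hc⟩ := h1
      rw [RingHom.comp_apply, hc, RingHom.comp_apply, hv, map_mul, map_mul, hR.valuation_fst]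
      exact mul_le_of_le_one_right' (hR.valuation_le_one _)
  · intro a ha
    obtain ⟨n, hn⟩ := hval (f a) ((map_ne_zero_iff f hf).mpr ha)
    rw [RingHom.comp_apply, hn, lexDegree_lexValue, neg_zero]
  · exact fun i => (hvσ i y).trans hvy
  · exact fun k a => hσψ k (f a)
  · exact fun k i => hσσ i k y
  · rw [← Polynomial.map_map]
    have hσ0 : σ 0 y = y := by
      have : ∀ r, ρ 0 r = r := fun r => by simp only [ρ]; rw [hz0, PowerSeries.rescale_one]; rfl
      rw [map_div₀, hσ, hσs, hz0, map_one, one_mul, this]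
    rw [hσ0]
    have hm : (((P.map f).map ψ) - C (((P.map f).map ψ).eval y)).Monic := by
      refine (hPf.map ψ).sub_of_left (lt_of_le_of_lt degree_C_le ?_)
      rw [hPf.degree_map, degree_eq_natDegree hPf.ne_zero, hdeg]
      exact_mod_cast NeZero.pos N
    have hm' : (∏ i, (X - C (σ i y))).Monic := monic_prod_of_monic _ _ fun i _ => monic_X_sub_C _
    have hd' : (∏ i, (X - C (σ i y))).degree = (N : WithBot ℕ) := by
      rw [degree_prod]
      simp [ZMod.card]
    have hd : (((P.map f).map ψ) - C (((P.map f).map ψ).eval y)).degree = (N : WithBot ℕ) := by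
      rw [degree_sub_C, hPf.degree_map, degree_eq_natDegree hPf.ne_zero, hdeg]
      rw [hPf.degree_map, degree_eq_natDegree hPf.ne_zero, hdeg]
      exact_mod_cast NeZero.pos N
    refine eq_of_degree_sub_lt_of_eval_index_eq Finset.univ (v := fun i => σ i y)
      hYinj.injOn ?_ fun i _ => ?_
    · rw [Finset.card_univ, ZMod.card]
      refine (degree_sub_lt_left (hd'.trans hd.symm) hm'.ne_zero
        (hm'.leadingCoeff.trans hm.leadingCoeff.symm)).trans_eq hd'
    · rw [eval_sub, hPYi, eval_C, sub_self, eval_prod]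
      exact Finset.prod_eq_zero (Finset.mem_univ i) (by simp)

end ConfigurationAtInfinity

/-! ### Properness and integrality of the time -/

section ProperAction

variable {A B : Type u} [CommRing A] [CommRing B] [Algebra A B]
variable (k : Type*) [Field k] [CharZero k] [Algebra k A]

/-- The comorphism `B ⊗ B → A[t] ⊗ B` of `(pr₂, σ)`. -/
noncomputable def gaComorphism (D : Derivation A B B) (hD : IsLocallyNilpotentDerivation D) :
    B ⊗[A] B →ₐ[A] Polynomial A ⊗[A] B :=
  Algebra.TensorProduct.lift Algebra.TensorProduct.includeRight (coaction k D hD)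
    fun _ _ => Commute.all _ _

theorem gaGraph_eq (D : Derivation A B B) (hD : IsLocallyNilpotentDerivation D) :
    gaGraph k D hD = (pullbackSpecIso A (Polynomial A) B).hom ≫
      Spec.map (CommRingCat.ofHom (gaComorphism k D hD).toRingHom) ≫
        (pullbackSpecIso A B B).inv := by
  refine pullback.hom_ext ?_ ?_
  · rw [gaGraph, pullback.lift_fst, Category.assoc, Category.assoc, pullbackSpecIso_inv_fst,
      ← Spec.map_comp, ← CommRingCat.ofHom_comp, ← pullbackSpecIso_hom_snd]
    congr 3
    ext b
    simp [gaComorphism]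
  · rw [gaGraph, pullback.lift_snd, Category.assoc, Category.assoc, pullbackSpecIso_inv_snd,
      ← Spec.map_comp, ← CommRingCat.ofHom_comp, gaAction]
    congr 3
    ext b
    simp [gaComorphism, ← Algebra.TensorProduct.one_def]

/-- Proper morphisms are universally closed, and a universally closed affine morphism is integral.
-/
theorem GeneratesProperAction.isIntegral {D : Derivation A B B}
    {hD : IsLocallyNilpotentDerivation D} (h : GeneratesProperAction k D hD) :
    (gaComorphism k D hD).toRingHom.IsIntegral := by
  rw [GeneratesProperAction, gaGraph_eq, MorphismProperty.cancel_left_of_respectsIso @IsProper,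
    MorphismProperty.cancel_right_of_respectsIso @IsProper] at h
  have h1 : IsIntegralHom (Spec.map (CommRingCat.ofHom (gaComorphism k D hD).toRingHom)) :=
    IsIntegralHom.iff_universallyClosed_and_isAffineHom.mpr ⟨h.toUniversallyClosed, inferInstance⟩
  exact IsIntegralHom.SpecMap_iff.mp h1

/-- The exponential of a locally nilpotent derivation at time `t`, at a point `θ`. -/
noncomputable def expAt {C : Type*} [CommRing C] [Algebra A C] (D : Derivation A B B)
    (hD : IsLocallyNilpotentDerivation D) (θ : B →ₐ[A] C) (t : C) : B →+* C :=
  (Polynomial.eval₂RingHom (θ : B →+* C) t).comp (expAlgHom k D hD : B →+* Polynomial B)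

/-- The point of `𝔾ₐ × Spec B` with coordinates `t` and `θ`. -/
noncomputable def gaPoint {C : Type*} [CommRing C] [Algebra A C] (θ : B →ₐ[A] C) (t : C) :
    Polynomial A ⊗[A] B →ₐ[A] C :=
  Algebra.TensorProduct.lift (Polynomial.aeval t) θ fun _ _ => Commute.all _ _

theorem gaPoint_tmul {C : Type*} [CommRing C] [Algebra A C] (θ : B →ₐ[A] C) (t : C)
    (P : Polynomial A) (b : B) : gaPoint θ t (P ⊗ₜ b) = Polynomial.aeval t P * θ b :=
  Algebra.TensorProduct.lift_tmul _ _ _ _ _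

theorem gaPoint_comm_polyEquivTensor {C : Type*} [CommRing C] [Algebra A C] (θ : B →ₐ[A] C)
    (t : C) (P : Polynomial B) :
    gaPoint θ t (Algebra.TensorProduct.comm A B (Polynomial A) (polyEquivTensor A B P)) =
      P.eval₂ (θ : B →+* C) t := by
  induction P using Polynomial.induction_on' with
  | add p q hp hq => rw [map_add, map_add, map_add, hp, hq, Polynomial.eval₂_add]
  | monomial i b =>
    rw [Polynomial.eval₂_monomial, polyEquivTensor_apply, Polynomial.eval₂_monomial,
      Algebra.TensorProduct.tmul_pow, one_pow, RingHom.coe_coe,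
      Algebra.TensorProduct.includeLeft_apply, Algebra.TensorProduct.tmul_mul_tmul, mul_one,
      one_mul, Algebra.TensorProduct.comm_tmul, gaPoint_tmul, map_pow, Polynomial.aeval_X,
      mul_comm]
    rfl

theorem gaPoint_coaction {C : Type*} [CommRing C] [Algebra A C] (D : Derivation A B B)
    (hD : IsLocallyNilpotentDerivation D) (θ : B →ₐ[A] C) (t : C) (b : B) :
    gaPoint θ t (coaction k D hD b) = expAt k D hD θ t b :=
  gaPoint_comm_polyEquivTensor θ t (expAlgHom k D hD b)

theorem gaPoint_gaComorphism_mem {C : Type*} [CommRing C] [Algebra A C] (D : Derivation A B B)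
    (hD : IsLocallyNilpotentDerivation D) (θ : B →ₐ[A] C) (t : C) (S : Subring C)
    (h0 : ∀ b, θ b ∈ S) (h1 : ∀ b, expAt k D hD θ t b ∈ S) (w : B ⊗[A] B) :
    gaPoint θ t (gaComorphism k D hD w) ∈ S := by
  induction w with
  | zero => rw [map_zero, map_zero]; exact S.zero_mem
  | add x y hx hy => rw [map_add, map_add]; exact S.add_mem hx hy
  | tmul b b' =>
    rw [gaComorphism, Algebra.TensorProduct.lift_tmul, map_mul, gaPoint_coaction,
      Algebra.TensorProduct.includeRight_apply, gaPoint_tmul, map_one, one_mul]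
    exact S.mul_mem (h0 b) (h1 b')

/-- If the action is proper, then `t` is integral over any ring that contains the coordinates of
a point and of its image at time `t`. -/
theorem GeneratesProperAction.isIntegralElem {D : Derivation A B B}
    {hD : IsLocallyNilpotentDerivation D} (h : GeneratesProperAction k D hD)
    {C : Type*} [CommRing C] [Algebra A C] (θ : B →ₐ[A] C) (t : C) (S : Subring C)
    (h0 : ∀ b, θ b ∈ S) (h1 : ∀ b, expAt k D hD θ t b ∈ S) : IsIntegral S t := by
  have hmem := gaPoint_gaComorphism_mem k D hD θ t S h0 h1
  obtain ⟨f, hf, hft⟩ := h.isIntegral k (Polynomial.X ⊗ₜ 1)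
  refine ⟨f.map (((gaPoint θ t).toRingHom.comp (gaComorphism k D hD).toRingHom).codRestrict S
    hmem), hf.map _, ?_⟩
  have h2 := congrArg (gaPoint θ t).toRingHom hft
  have h3 : (gaPoint θ t).toRingHom (Polynomial.X ⊗ₜ 1) = t := by
    refine (gaPoint_tmul θ t _ _).trans ?_
    rw [Polynomial.aeval_X, map_one, mul_one]
  rw [Polynomial.hom_eval₂, map_zero, h3] at h2
  rw [Polynomial.eval₂_map]
  exact h2

end ProperAction

/-! ### The exponential at a point -/

section ExpAt

variable {A B : Type u} {C : Type*} [CommRing A] [CommRing B] [Algebra A B] [CommRing C]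
  [Algebra A C]
variable (k : Type*) [Field k] [CharZero k] [Algebra k A]
variable (D : Derivation A B B) (hD : IsLocallyNilpotentDerivation D) (θ : B →ₐ[A] C) (t : C)

/-- The increment is exhibited as a multiple of t, so that a vanishing increment forces t or the
remaining sum to vanish. -/
theorem expAt_eq_sum (b : B) {m : ℕ} (hm : (⇑D)^[m] (D b) = 0) :
    expAt k D hD θ t b = θ b + t * ∑ j ∈ Finset.range m,
      algebraMap A C (algebraMap k A (((j + 1).factorial : k)⁻¹)) * θ ((⇑D)^[j] (D b)) * t ^ j := by
  have h1 : expAt k D hD θ t b = (expPoly k D hD b).eval₂ (θ : B →+* C) t := rfl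
  rw [h1, Polynomial.eval₂_eq_sum_range' (θ : B →+* C) (n := m + 1), Finset.sum_range_succ',
    add_comm, Finset.mul_sum]
  · congr 1
    · rw [expPoly_coeff]
      simp
    · refine Finset.sum_congr rfl fun j _ => ?_
      rw [expPoly_coeff, Algebra.smul_def, RingHom.coe_coe, map_mul, AlgHom.commutes,
        Function.iterate_succ_apply]
      ring
  · rw [Nat.lt_succ_iff, Polynomial.natDegree_le_iff_coeff_eq_zero]
    intro i hi
    rw [expPoly_coeff, derivation_iterate_eq_zero_of_le D (m := m + 1) (by
      rw [Function.iterate_succ_apply, hm]) hi, smul_zero]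

theorem expAt_of_eq_zero {b : B} (hb : D b = 0) : expAt k D hD θ t b = θ b := by
  rw [expAt_eq_sum k D hD θ t b (m := 0) hb, Finset.sum_range_zero, mul_zero, add_zero]

theorem expAt_of_eq_algebraMap {b : B} {a : A} (hb : D b = algebraMap A B a) :
    expAt k D hD θ t b = θ b + t * algebraMap A C a := by
  rw [expAt_eq_sum k D hD θ t b (m := 1) (by simp [hb]), Finset.sum_range_one]
  simp [hb]

theorem expAt_algebraMap (a : A) : expAt k D hD θ t (algebraMap A B a) = algebraMap A C a := by
  rw [expAt_of_eq_zero k D hD θ t (D.map_algebraMap a), AlgHom.commutes]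

theorem expAt_of_comp_eq_zero (h : ∀ b, θ (D b) = 0) (b : B) :
    expAt k D hD θ t b = θ b := by
  obtain ⟨m, hm⟩ := hD (D b)
  rw [expAt_eq_sum k D hD θ t b hm, Finset.sum_eq_zero, mul_zero, add_zero]
  intro j _
  rw [← Function.iterate_succ_apply, Function.iterate_succ_apply', h, mul_zero, zero_mul]

/-- The exponential at time `t`, at a point, as a homomorphism of algebras. -/
noncomputable def expPoint : B →ₐ[A] C where
  toRingHom := expAt k D hD θ t
  commutes' := expAt_algebraMap k D hD θ t

theorem expPoint_apply (b : B) : expPoint k D hD θ t b = expAt k D hD θ t b := rfl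

end ExpAt

/-! ### The derivations on polynomials in two and three variables -/

section Plane

variable {A : Type*} [CommRing A]

/-- The inclusion of `A[y]` in `A[y, z]`. -/
noncomputable def inclPlane : Polynomial A →ₐ[A] MvPolynomial (Fin 2) A :=
  Polynomial.aeval (MvPolynomial.X 0)

/-- The `A`-derivation `a ∂_y + q(y) ∂_z` of `A[y, z]`. -/
noncomputable def planeDerivation (a : A) (q : Polynomial A) :
    Derivation A (MvPolynomial (Fin 2) A) (MvPolynomial (Fin 2) A) :=
  a • MvPolynomial.pderiv 0 + inclPlane q • MvPolynomial.pderiv 1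

/-- Evaluation of a polynomial in two variables. -/
noncomputable def planeEval {C : Type*} [CommRing C] [Algebra A C] (y z : C) :
    MvPolynomial (Fin 2) A →ₐ[A] C :=
  MvPolynomial.aeval ![y, z]

/-- Evaluation of a polynomial in three variables. -/
noncomputable def spaceEval {C : Type*} [CommRing C] [Algebra A C] (y z u : C) :
    Poly3 A →ₐ[A] C :=
  MvPolynomial.aeval ![y, z, u]

section

variable {C : Type*} [CommRing C] [Algebra A C]

@[simp] theorem planeEval_X_zero (y z : C) :
    planeEval (A := A) y z (MvPolynomial.X 0) = y := by simp [planeEval]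

@[simp] theorem planeEval_X_one (y z : C) :
    planeEval (A := A) y z (MvPolynomial.X 1) = z := by simp [planeEval]

theorem plane_algHom_ext {f g : MvPolynomial (Fin 2) A →ₐ[A] C}
    (h0 : f (MvPolynomial.X 0) = g (MvPolynomial.X 0))
    (h1 : f (MvPolynomial.X 1) = g (MvPolynomial.X 1)) : f = g := by
  refine MvPolynomial.algHom_ext fun i => ?_
  fin_cases i
  · exact h0
  · exact h1

theorem space_algHom_ext {f g : Poly3 A →ₐ[A] C}
    (h0 : f (MvPolynomial.X 0) = g (MvPolynomial.X 0))
    (h1 : f (MvPolynomial.X 1) = g (MvPolynomial.X 1))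
    (h2 : f (MvPolynomial.X 2) = g (MvPolynomial.X 2)) : f = g := by
  refine MvPolynomial.algHom_ext fun i => ?_
  fin_cases i
  · exact h0
  · exact h1
  · exact h2

@[simp] theorem planeEval_inclPlane (y z : C) (f : Polynomial A) :
    planeEval y z (inclPlane f) = Polynomial.aeval y f := by
  rw [inclPlane, ← Polynomial.aeval_algHom_apply, planeEval_X_zero]

theorem comp_planeEval {C' : Type*} [CommRing C'] [Algebra A C'] (g : C →ₐ[A] C') (y z : C)
    (f : MvPolynomial (Fin 2) A) : g (planeEval y z f) = planeEval (g y) (g z) f :=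
  congrArg (fun h : MvPolynomial (Fin 2) A →ₐ[A] C' => h f)
    (plane_algHom_ext (f := g.comp (planeEval y z)) (g := planeEval (g y) (g z))
      (by simp) (by simp))

@[simp] theorem spaceEval_X_zero (y z u : C) :
    spaceEval (A := A) y z u (MvPolynomial.X 0) = y := by simp [spaceEval]

@[simp] theorem spaceEval_X_one (y z u : C) :
    spaceEval (A := A) y z u (MvPolynomial.X 1) = z := by simp [spaceEval]

@[simp] theorem spaceEval_X_two (y z u : C) :
    spaceEval (A := A) y z u (MvPolynomial.X 2) = u := by simp [spaceEval]

theorem inclYZ_eq : inclYZ (A := A) = planeEval (MvPolynomial.X 0) (MvPolynomial.X 1) := rfl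

theorem inclYZ_inclPlane (f : Polynomial A) : inclYZ (inclPlane f) = inclY f := by
  rw [inclYZ_eq, planeEval_inclPlane, inclY]

@[simp] theorem spaceEval_inclYZ (y z u : C) (f : MvPolynomial (Fin 2) A) :
    spaceEval y z u (inclYZ f) = planeEval y z f := by
  rw [inclYZ_eq, comp_planeEval, spaceEval_X_zero, spaceEval_X_one]

end

theorem planeDerivation_X_zero (a : A) (q : Polynomial A) :
    planeDerivation a q (MvPolynomial.X 0) = algebraMap A _ a := by
  simp [planeDerivation, MvPolynomial.algebraMap_eq, MvPolynomial.smul_eq_C_mul]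

theorem planeDerivation_X_one (a : A) (q : Polynomial A) :
    planeDerivation a q (MvPolynomial.X 1) = inclPlane q := by
  simp [planeDerivation, MvPolynomial.pderiv_X]

theorem planeDerivation_inclPlane (a : A) (q f : Polynomial A) :
    planeDerivation a q (inclPlane f) = algebraMap A _ a * inclPlane (Polynomial.derivative f) := by
  rw [inclPlane, Derivation.map_aeval, planeDerivation_X_zero, smul_eq_mul, mul_comm]

theorem triangularDerivation_X_zero (a : A) (q : Polynomial A) (p : MvPolynomial (Fin 2) A) :
    triangularDerivation a q p (MvPolynomial.X 0) = algebraMap A _ a := by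
  simp [triangularDerivation, MvPolynomial.pderiv_X, MvPolynomial.algebraMap_eq,
    MvPolynomial.smul_eq_C_mul]

theorem triangularDerivation_X_one (a : A) (q : Polynomial A) (p : MvPolynomial (Fin 2) A) :
    triangularDerivation a q p (MvPolynomial.X 1) = inclY q := by
  simp [triangularDerivation, MvPolynomial.pderiv_X]

theorem triangularDerivation_X_two (a : A) (q : Polynomial A) (p : MvPolynomial (Fin 2) A) :
    triangularDerivation a q p (MvPolynomial.X 2) = inclYZ p := by
  simp [triangularDerivation, MvPolynomial.pderiv_X]

theorem triangularDerivation_inclYZ (a : A) (q : Polynomial A) (p f : MvPolynomial (Fin 2) A) :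
    triangularDerivation a q p (inclYZ f) = inclYZ (planeDerivation a q f) := by
  induction f using MvPolynomial.induction_on with
  | C c =>
    rw [← MvPolynomial.algebraMap_eq, AlgHom.commutes, Derivation.map_algebraMap,
      Derivation.map_algebraMap, map_zero]
  | add f g hf hg => simp only [map_add, hf, hg]
  | mul_X f i hf =>
    rw [map_mul, Derivation.leibniz, Derivation.leibniz, hf, map_add, smul_eq_mul, smul_eq_mul,
      smul_eq_mul, smul_eq_mul, map_mul, map_mul]
    congr 2
    fin_cases i
    · simp only [Fin.zero_eta]
      rw [planeDerivation_X_zero, AlgHom.commutes, inclYZ_eq, planeEval_X_zero,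
        triangularDerivation_X_zero]
    · simp only [Fin.mk_one]
      rw [planeDerivation_X_one, inclYZ_inclPlane, inclYZ_eq, planeEval_X_one,
        triangularDerivation_X_one]

theorem triangularDerivation_iterate_inclYZ (a : A) (q : Polynomial A)
    (p f : MvPolynomial (Fin 2) A) (j : ℕ) :
    (⇑(triangularDerivation a q p))^[j] (inclYZ f) = inclYZ ((⇑(planeDerivation a q))^[j] f) := by
  induction j generalizing f with
  | zero => rfl
  | succ j ih => rw [Function.iterate_succ_apply, triangularDerivation_inclYZ, ih,
      Function.iterate_succ_apply]

end Plane

/-! ### Valuative consequences of properness -/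

section ValuativeConsequences

variable {A : Type u} [CommRing A] {Ω : Type*} [Field Ω] [Algebra A Ω]
  {Γ₀ : Type*} [LinearOrderedCommGroupWithZero Γ₀] (w : Valuation Ω Γ₀)

theorem Valuation.aeval_le_one (hw : ∀ a : A, w (algebraMap A Ω a) ≤ 1) {y : Ω} (hy : w y ≤ 1)
    (f : Polynomial A) : w (Polynomial.aeval y f) ≤ 1 := by
  rw [Polynomial.aeval_eq_sum_range]
  refine w.map_sum_le fun i _ => ?_
  rw [Algebra.smul_def, map_mul, map_pow]
  exact mul_le_one' (hw _) (pow_le_one' hy i)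

theorem Valuation.mvAeval_le_one {σ : Type*} (hw : ∀ a : A, w (algebraMap A Ω a) ≤ 1) {y : σ → Ω}
    (hy : ∀ i, w (y i) ≤ 1) (f : MvPolynomial σ A) : w (MvPolynomial.aeval y f) ≤ 1 := by
  induction f using MvPolynomial.induction_on with
  | C a => rw [← MvPolynomial.algebraMap_eq, AlgHom.commutes]; exact hw a
  | add f g hf hg => rw [map_add]; exact w.map_add_le hf hg
  | mul_X f i hf =>
    rw [map_mul, map_mul, MvPolynomial.aeval_X]
    exact mul_le_one' hf (hy i)

theorem planeEval_le_one (hw : ∀ a : A, w (algebraMap A Ω a) ≤ 1) {y z : Ω} (hy : w y ≤ 1)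
    (hz : w z ≤ 1) (f : MvPolynomial (Fin 2) A) : w (planeEval y z f) ≤ 1 :=
  w.mvAeval_le_one hw (by simp [Fin.forall_fin_two, hy, hz]) f

theorem spaceEval_le_one (hw : ∀ a : A, w (algebraMap A Ω a) ≤ 1) {y z u : Ω} (hy : w y ≤ 1)
    (hz : w z ≤ 1) (hu : w u ≤ 1) (f : Poly3 A) : w (spaceEval y z u f) ≤ 1 :=
  w.mvAeval_le_one hw (by simp [Fin.forall_fin_succ, hy, hz, hu]) f

/-- The valuative form of properness: if two integral points of the plane lie on one fibre of
`x ^ n z - Q(y)`, and the increments of the third coordinate are integral, then the time between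
them is integral. -/
def HasIntegralTime (x : A) (n : ℕ) (q Q : Polynomial A) (p : MvPolynomial (Fin 2) A) : Prop :=
  ∀ y₀ z₀ y₁ z₁ : Ω, w y₀ ≤ 1 → w z₀ ≤ 1 → w y₁ ≤ 1 → w z₁ ≤ 1 →
    algebraMap A Ω (x ^ n) * z₁ - Polynomial.aeval y₁ Q =
      algebraMap A Ω (x ^ n) * z₀ - Polynomial.aeval y₀ Q →
    ∀ (M : ℕ) (J : MvPolynomial (Fin 2) A) (s : Ω),
      planeDerivation (x ^ n) q J = MvPolynomial.C (x ^ M) * p → w s ≤ 1 →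
      planeEval y₁ z₁ J - planeEval y₀ z₀ J = algebraMap A Ω (x ^ M) * s →
      ∃ t : Ω, w t ≤ 1 ∧ y₁ = y₀ + t * algebraMap A Ω (x ^ n)

/-- The action has no fixed points over the closed point. -/
def HasNoFixedPoint (q : Polynomial A) (p : MvPolynomial (Fin 2) A) : Prop :=
  ∀ y z : Ω, w y ≤ 1 → w z ≤ 1 → w (Polynomial.aeval y q) < 1 → ¬ w (planeEval y z p) < 1

variable {w}

/-- This is the change of coordinate u ↦ u - f. A potential `J` for the new coefficient gives the
potential J + x^M f for the old one, and the increment of u changes by an integral amount. -/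
theorem HasIntegralTime.sub {x : A} {n : ℕ} {q Q : Polynomial A} {p : MvPolynomial (Fin 2) A}
    (hw : ∀ a : A, w (algebraMap A Ω a) ≤ 1) (h : HasIntegralTime w x n q Q p)
    (f : MvPolynomial (Fin 2) A) :
    HasIntegralTime w x n q Q (p - planeDerivation (x ^ n) q f) := by
  intro y₀ z₀ y₁ z₁ hy₀ hz₀ hy₁ hz₁ hv M J s hJ hs hd
  refine h y₀ z₀ y₁ z₁ hy₀ hz₀ hy₁ hz₁ hv M (J + MvPolynomial.C (x ^ M) * f)
    (s + (planeEval y₁ z₁ f - planeEval y₀ z₀ f)) ?_ ?_ ?_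
  · rw [map_add, hJ, Derivation.leibniz, ← MvPolynomial.algebraMap_eq, Derivation.map_algebraMap,
      smul_zero, add_zero, smul_eq_mul]
    ring
  · exact w.map_add_le hs (w.map_sub_le (planeEval_le_one w hw hy₁ hz₁ f)
      (planeEval_le_one w hw hy₀ hz₀ f))
  · rw [map_add, map_add, map_mul, map_mul, ← MvPolynomial.algebraMap_eq, AlgHom.commutes,
      AlgHom.commutes]
    linear_combination hd

theorem planeEval_planeDerivation (x : A) (n : ℕ) (q : Polynomial A) (y z : Ω)
    (f : MvPolynomial (Fin 2) A) :
    planeEval y z (planeDerivation (x ^ n) q f) =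
      algebraMap A Ω (x ^ n) * planeEval y z (MvPolynomial.pderiv 0 f) +
        Polynomial.aeval y q * planeEval y z (MvPolynomial.pderiv 1 f) := by
  simp [planeDerivation, Algebra.smul_def]

theorem planeEval_planeDerivation_lt_one {x : A} {n : ℕ} (hn : 0 < n) {q : Polynomial A}
    (hw : ∀ a : A, w (algebraMap A Ω a) ≤ 1) (hx : w (algebraMap A Ω x) < 1) {y z : Ω}
    (hy : w y ≤ 1) (hz : w z ≤ 1) (hq : w (Polynomial.aeval y q) < 1)
    (f : MvPolynomial (Fin 2) A) :
    w (planeEval y z (planeDerivation (x ^ n) q f)) < 1 := by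
  rw [planeEval_planeDerivation]
  refine w.map_add_lt ?_ ?_
  · rw [map_mul, map_pow, map_pow]
    exact mul_lt_one_of_lt_of_le (pow_lt_one₀ zero_le hx hn.ne') (planeEval_le_one w hw hy hz _)
  · rw [map_mul]
    exact mul_lt_one_of_lt_of_le hq (planeEval_le_one w hw hy hz _)

/-- The polynomial D f lies in the ideal generated by x^n and q, so it is small wherever q is. -/
theorem HasNoFixedPoint.sub {x : A} {n : ℕ} (hn : 0 < n) {q : Polynomial A}
    {p : MvPolynomial (Fin 2) A} (hw : ∀ a : A, w (algebraMap A Ω a) ≤ 1)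
    (hx : w (algebraMap A Ω x) < 1) (h : HasNoFixedPoint w q p) (f : MvPolynomial (Fin 2) A) :
    HasNoFixedPoint w q (p - planeDerivation (x ^ n) q f) := by
  intro y z hy hz hq hlt
  refine h y z hy hz hq ?_
  have := w.map_add_lt hlt (planeEval_planeDerivation_lt_one hn hw hx hy hz hq f)
  rwa [← map_add, sub_add_cancel] at this

variable (k : Type*) [Field k] [CharZero k] [Algebra k A]

/-- The flow of a triangular derivation through a point. -/
theorem exists_expPoint_eq {x : A} (hx0 : algebraMap A Ω x ≠ 0) {n : ℕ} {q Q : Polynomial A}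
    (hQ : Polynomial.derivative Q = q) (p : MvPolynomial (Fin 2) A) {y₀ z₀ y₁ z₁ t : Ω}
    (hv : algebraMap A Ω (x ^ n) * z₁ - Polynomial.aeval y₁ Q =
      algebraMap A Ω (x ^ n) * z₀ - Polynomial.aeval y₀ Q)
    (ht : y₁ = y₀ + t * algebraMap A Ω (x ^ n)) {M : ℕ} {J : MvPolynomial (Fin 2) A} {s : Ω}
    (hJ : planeDerivation (x ^ n) q J = MvPolynomial.C (x ^ M) * p)
    (hs : planeEval y₁ z₁ J - planeEval y₀ z₀ J = algebraMap A Ω (x ^ M) * s) :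
    expPoint k (triangularDerivation (x ^ n) q p)
      (triangularDerivation_isLocallyNilpotent (x ^ n) q p) (spaceEval y₀ z₀ 0) t =
        spaceEval y₁ z₁ s := by
  set D := triangularDerivation (x ^ n) q p with hDdef
  set hD := triangularDerivation_isLocallyNilpotent (x ^ n) q p
  set E := expPoint k D hD (spaceEval y₀ z₀ 0) t with hE
  have hxn : ∀ m, algebraMap A Ω (x ^ m) ≠ 0 := fun m => by
    rw [map_pow]; exact pow_ne_zero m hx0
  have h0 : E (MvPolynomial.X 0) = y₁ := by
    rw [hE, expPoint_apply, expAt_of_eq_algebraMap k D hD _ t (triangularDerivation_X_zero _ _ _),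
      spaceEval_X_zero, ht]
  -- The flow preserves x^n z - Q(y) and J - x^M u, and since x ≠ 0 these determine the final z and
  -- u from the final y.
  have hinv : D (algebraMap A _ (x ^ n) * MvPolynomial.X 1 - inclY Q) = 0 := by
    rw [map_sub, Derivation.leibniz, Derivation.map_algebraMap, smul_zero, add_zero,
      triangularDerivation_X_one, smul_eq_mul, ← inclYZ_inclPlane Q, triangularDerivation_inclYZ,
      planeDerivation_inclPlane, hQ, map_mul, AlgHom.commutes, inclYZ_inclPlane, sub_self]
  have hY : ∀ (g : Poly3 A →ₐ[A] Ω) (f : Polynomial A),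
      g (inclY f) = Polynomial.aeval (g (MvPolynomial.X 0)) f := fun g f => by
    rw [inclY, ← Polynomial.aeval_algHom_apply]
  have h1 : E (MvPolynomial.X 1) = z₁ := by
    have h := expAt_of_eq_zero k D hD (spaceEval y₀ z₀ 0) t hinv
    rw [← expPoint_apply, ← hE, map_sub, map_mul, AlgHom.commutes, hY, h0, map_sub, map_mul,
      AlgHom.commutes, hY, spaceEval_X_zero, spaceEval_X_one, ← hv] at h
    exact mul_left_cancel₀ (hxn n) (sub_left_injective h)
  have hinv' : D (inclYZ J - algebraMap A _ (x ^ M) * MvPolynomial.X 2) = 0 := by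
    rw [map_sub, Derivation.leibniz, Derivation.map_algebraMap, smul_zero, add_zero,
      triangularDerivation_X_two, smul_eq_mul, triangularDerivation_inclYZ, hJ, map_mul,
      ← MvPolynomial.algebraMap_eq, AlgHom.commutes, sub_self]
  have hEYZ : ∀ f, E (inclYZ f) = planeEval y₁ z₁ f := fun f => by
    rw [inclYZ_eq, comp_planeEval, h0, h1]
  have h2 : E (MvPolynomial.X 2) = s := by
    have h := expAt_of_eq_zero k D hD (spaceEval y₀ z₀ 0) t hinv'
    rw [← expPoint_apply, ← hE, map_sub, map_mul, AlgHom.commutes, hEYZ, map_sub, map_mul,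
      AlgHom.commutes, spaceEval_X_two, mul_zero, sub_zero, spaceEval_inclYZ] at h
    refine mul_left_cancel₀ (hxn M) ?_
    rw [← hs, ← h]
    ring
  exact space_algHom_ext (by rw [h0, spaceEval_X_zero]) (by rw [h1, spaceEval_X_one])
    (by rw [h2, spaceEval_X_two])

/-- The time (y₁ - y₀) / x^n carries (y₀, z₀, 0) to (y₁, z₁, s). Both points are integral, so the
time is integral over the valuation ring, which is integrally closed. -/
theorem GeneratesProperAction.hasIntegralTime {x : A} (hx0 : algebraMap A Ω x ≠ 0) {n : ℕ}
    {q Q : Polynomial A} (hQ : Polynomial.derivative Q = q) {p : MvPolynomial (Fin 2) A}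
    (hw : ∀ a : A, w (algebraMap A Ω a) ≤ 1)
    (h : GeneratesProperAction k (triangularDerivation (x ^ n) q p)
      (triangularDerivation_isLocallyNilpotent (x ^ n) q p)) :
    HasIntegralTime w x n q Q p := by
  intro y₀ z₀ y₁ z₁ hy₀ hz₀ hy₁ hz₁ hv M J s hJ hs hd
  have hxn : algebraMap A Ω (x ^ n) ≠ 0 := by
    rw [map_pow]; exact pow_ne_zero n hx0
  set t := (y₁ - y₀) / algebraMap A Ω (x ^ n) with ht
  have ht' : y₁ = y₀ + t * algebraMap A Ω (x ^ n) := by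
    rw [ht, div_mul_cancel₀ _ hxn]
    ring
  refine ⟨t, ?_, ht'⟩
  have hE := exists_expPoint_eq k hx0 hQ p hv ht' hJ hd
  have hi := h.isIntegralElem k (spaceEval y₀ z₀ 0) t w.integer
    (fun b => spaceEval_le_one w hw hy₀ hz₀ (by simp) b)
    (fun b => by
      rw [← expPoint_apply, hE]
      exact spaceEval_le_one w hw hy₁ hz₁ hs b)
  have := (Valuation.integer.integers w).mem_of_integral hi
  exact this

/-- If q and p vanish at a point over the residue field, the point is fixed for every time. Taking
the time to be an indeterminate over that field, properness would make the indeterminate algebraic.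
-/
theorem GeneratesProperAction.hasNoFixedPoint {x : A} {n : ℕ} (hn : 0 < n)
    {q : Polynomial A} {p : MvPolynomial (Fin 2) A}
    (hw : ∀ a : A, w (algebraMap A Ω a) ≤ 1) (hx : w (algebraMap A Ω x) < 1)
    (h : GeneratesProperAction k (triangularDerivation (x ^ n) q p)
      (triangularDerivation_isLocallyNilpotent (x ^ n) q p)) :
    HasNoFixedPoint w q p := by
  intro y z hy hz hq hp
  let O := w.valuationSubring
  let F := IsLocalRing.ResidueField O
  let ρ : O →+* F := IsLocalRing.residue O
  have hρ : ∀ o : O, w (o : Ω) < 1 → ρ o = 0 := by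
    intro o ho
    rw [IsLocalRing.residue_eq_zero_iff, IsLocalRing.mem_maximalIdeal, mem_nonunits_iff]
    intro hu
    exact ho.ne ((Valuation.integer.integers w).valuation_unit hu.unit)
  let iA : A →+* O := (algebraMap A Ω).codRestrict O.toSubring hw
  let _ : Algebra A O := iA.toAlgebra
  let _ : Algebra A F := (ρ.comp iA).toAlgebra
  let ρ' : O →ₐ[A] F := { ρ with commutes' := fun _ => rfl }
  let j : O →ₐ[A] Ω := { O.subtype with commutes' := fun _ => rfl }
  let Y : O := ⟨y, hy⟩
  let Z : O := ⟨z, hz⟩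
  let c : F →ₐ[A] Polynomial F := { (Polynomial.C : F →+* Polynomial F) with
    commutes' := fun _ => rfl }
  let θ : Poly3 A →ₐ[A] Polynomial F := (c.comp ρ').comp (spaceEval Y Z 0)
  have hθ : ∀ f : Poly3 A, w (spaceEval y z 0 f) < 1 → θ f = 0 := by
    intro f hf
    have h1 : j (spaceEval Y Z 0 f) = spaceEval y z 0 f :=
      congrArg (fun g : Poly3 A →ₐ[A] Ω => g f) (space_algHom_ext
        (f := j.comp (spaceEval Y Z 0)) (g := spaceEval y z 0)
        (by rw [AlgHom.comp_apply, spaceEval_X_zero, spaceEval_X_zero]; rfl)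
        (by rw [AlgHom.comp_apply, spaceEval_X_one, spaceEval_X_one]; rfl)
        (by rw [AlgHom.comp_apply, spaceEval_X_two, spaceEval_X_two, map_zero]))
    have h2 : ρ (spaceEval Y Z 0 f) = 0 := hρ _ (by
      have h3 : ((spaceEval Y Z 0 f : O) : Ω) = spaceEval y z 0 f := h1
      rw [h3]
      exact hf)
    have h4 : θ f = Polynomial.C (ρ (spaceEval Y Z 0 f)) := rfl
    rw [h4, h2, Polynomial.C_0]
  have hD : ∀ f, θ (triangularDerivation (x ^ n) q p f) = 0 := by
    intro f
    have e1 : θ (algebraMap A _ (x ^ n)) = 0 := hθ _ (by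
      rw [AlgHom.commutes, map_pow, map_pow]
      exact pow_lt_one₀ zero_le hx hn.ne')
    have e2 : θ (inclY q) = 0 := hθ _ (by
      rw [inclY, ← Polynomial.aeval_algHom_apply, spaceEval_X_zero]
      exact hq)
    have e3 : θ (inclYZ p) = 0 := hθ _ (by
      rw [spaceEval_inclYZ]
      exact hp)
    simp only [triangularDerivation, Derivation.add_apply, Derivation.smul_apply, smul_eq_mul,
      Algebra.smul_def, map_add, map_mul, e1, e2, e3, zero_mul, add_zero]
  have hS : ∀ f, θ f ∈ (Polynomial.C : F →+* Polynomial F).range := fun f => ⟨_, rfl⟩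
  have hi := h.isIntegralElem k θ (Polynomial.X : Polynomial F)
    (Polynomial.C : F →+* Polynomial F).range hS (fun f => by
      rw [expAt_of_comp_eq_zero k _ _ θ _ hD]
      exact hS f)
  have hi' : IsIntegral F (Polynomial.X : Polynomial F) := by
    refine hi.map_of_comp_eq ((Polynomial.constantCoeff : Polynomial F →+* F).comp
      (Subring.subtype _)) (RingHom.id _) ?_
    refine RingHom.ext fun ⟨b, a, ha⟩ => ?_
    subst ha
    change Polynomial.C (Polynomial.constantCoeff (Polynomial.C a)) = Polynomial.C a
    rw [Polynomial.constantCoeff_apply, Polynomial.coeff_C_zero]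
  exact Polynomial.transcendental_X F hi'.isAlgebraic

/-- A nontrivial flow between integral points changes the third coordinate. -/
theorem HasNoFixedPoint.eq_zero_of_increment_eq_zero [Algebra ℚ A] {x : A}
    (hx0 : algebraMap A Ω x ≠ 0) {n : ℕ}
    (hn : 0 < n) {q Q : Polynomial A} (hQ : Polynomial.derivative Q = q)
    {p : MvPolynomial (Fin 2) A} (hw : ∀ a : A, w (algebraMap A Ω a) ≤ 1)
    (hx : w (algebraMap A Ω x) < 1) (h : HasNoFixedPoint w q p) {y₀ z₀ y₁ z₁ t : Ω}
    (hy₀ : w y₀ ≤ 1) (hz₀ : w z₀ ≤ 1)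
    (hv : algebraMap A Ω (x ^ n) * z₁ - Polynomial.aeval y₁ Q =
      algebraMap A Ω (x ^ n) * z₀ - Polynomial.aeval y₀ Q)
    (ht : y₁ = y₀ + t * algebraMap A Ω (x ^ n)) (htw : w t ≤ 1) {M : ℕ}
    {J : MvPolynomial (Fin 2) A}
    (hJ : planeDerivation (x ^ n) q J = MvPolynomial.C (x ^ M) * p)
    (hs : planeEval y₁ z₁ J = planeEval y₀ z₀ J) (hq : w (Polynomial.aeval y₀ q) < 1) :
    t = 0 := by
  have hE := congrArg (fun g : Poly3 A →ₐ[A] Ω => g (MvPolynomial.X 2))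
    (exists_expPoint_eq ℚ hx0 hQ p hv ht hJ (s := 0) (by rw [hs, sub_self, mul_zero]))
  simp only [expPoint_apply, spaceEval_X_two] at hE
  set D := triangularDerivation (x ^ n) q p
  obtain ⟨m, hm⟩ := triangularDerivation_isLocallyNilpotent (x ^ n) q p (D (MvPolynomial.X 2))
  -- One more term than necessary is kept, so that the sum certainly contains the term j = 0.
  have hm' : (⇑D)^[m + 1] (D (MvPolynomial.X 2)) = 0 :=
    derivation_iterate_eq_zero_of_le D hm (Nat.le_succ m)
  rw [expAt_eq_sum ℚ D _ _ _ _ hm', spaceEval_X_two, zero_add, mul_eq_zero] at hE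
  refine hE.resolve_right fun hsum => ?_
  rw [Finset.sum_range_succ'] at hsum
  -- The terms after the first involve values of the image of the plane derivation, at a point where
  -- x and q are small. If the sum vanished, its first term, the value of p, would be small as well.
  have h1 : w (∑ j ∈ Finset.range m,
      algebraMap A Ω (algebraMap ℚ A (((j + 1 + 1).factorial : ℚ)⁻¹)) *
      spaceEval y₀ z₀ 0 ((⇑D)^[j + 1] (D (MvPolynomial.X 2))) * t ^ (j + 1)) < 1 := by
    refine w.map_sum_lt one_ne_zero fun j _ => ?_
    rw [triangularDerivation_X_two, triangularDerivation_iterate_inclYZ, spaceEval_inclYZ,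
      Function.iterate_succ_apply', map_mul, map_mul, map_pow]
    refine mul_lt_one_of_lt_of_le ?_ (pow_le_one' htw _)
    rw [mul_comm]
    refine mul_lt_one_of_lt_of_le ?_ (hw _)
    exact planeEval_planeDerivation_lt_one hn hw hx hy₀ hz₀ hq _
  refine h y₀ z₀ hy₀ hz₀ hq ?_
  rw [triangularDerivation_X_two] at hsum h1
  simp only [Function.iterate_zero, id_eq, spaceEval_inclYZ, zero_add, Nat.factorial_one,
    Nat.cast_one, inv_one, map_one, one_mul, pow_zero, mul_one] at hsum
  rw [← neg_eq_iff_add_eq_zero] at hsum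
  rw [← hsum, Valuation.map_neg]
  exact h1

end ValuativeConsequences

/-! ### Difference quotients and relative norms -/

section DifferenceQuotient

open Polynomial

variable {R E : Type*} [CommRing R] [CommRing E] (ψ : R →+* E)

/-- The difference quotient `(f(Z) - f(Y)) / (Z - Y)`. -/
noncomputable def diffQuot (f : R[X]) : R[X][X] :=
  (f.map C - C f) /ₘ (X - C X)

theorem X_sub_C_X_mul_diffQuot (f : R[X]) : (X - C X) * diffQuot f = f.map C - C f := by
  rw [diffQuot, mul_divByMonic_eq_iff_isRoot, IsRoot, eval_sub, eval_C, Polynomial.eval_map,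
    eval₂_C_X,
    sub_self]

/-- The value of the difference quotient of `f` at `(y, z)`. -/
noncomputable def diffQuotEval (y z : E) (f : R[X]) : E :=
  ((diffQuot f).map (eval₂RingHom ψ y)).eval z

theorem map_C_map_eval₂RingHom (y : E) (f : R[X]) :
    (f.map C).map (eval₂RingHom ψ y) = f.map ψ := by
  rw [Polynomial.map_map]
  congr 1
  ext r
  simp

theorem X_sub_C_mul_map_diffQuot (y : E) (f : R[X]) :
    (X - C y) * (diffQuot f).map (eval₂RingHom ψ y) = f.map ψ - C (f.eval₂ ψ y) := by
  have := congrArg (Polynomial.map (eval₂RingHom ψ y)) (X_sub_C_X_mul_diffQuot f)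
  rwa [Polynomial.map_mul, Polynomial.map_sub, Polynomial.map_sub, map_C_map_eval₂RingHom, map_X,
    map_C, map_C, coe_eval₂RingHom, eval₂_X] at this

theorem sub_mul_diffQuotEval (y z : E) (f : R[X]) :
    (z - y) * diffQuotEval ψ y z f = f.eval₂ ψ z - f.eval₂ ψ y := by
  have := congrArg (Polynomial.eval z) (X_sub_C_mul_map_diffQuot ψ y f)
  rwa [eval_mul, eval_sub, eval_X, eval_C, eval_sub, eval_C, Polynomial.eval_map ψ] at this

theorem diffQuotEval_self (y : E) (f : R[X]) :
    diffQuotEval ψ y y f = (derivative f).eval₂ ψ y := by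
  have := congrArg (fun g => (derivative g).eval y) (X_sub_C_mul_map_diffQuot ψ y f)
  simp only [derivative_mul, derivative_sub, derivative_X, derivative_C, sub_zero, one_mul,
    eval_add, eval_mul, eval_sub, eval_X, eval_C, sub_self, zero_mul, add_zero,
    derivative_map] at this
  rw [diffQuotEval, this, Polynomial.eval_map]

theorem Polynomial.Monic.diffQuot [Nontrivial R] {f : R[X]} (hf : f.Monic) (hd : f.natDegree ≠ 0) :
    (diffQuot f).Monic ∧ (diffQuot f).natDegree = f.natDegree - 1 := by
  have hlt : (C f : R[X][X]).degree < (f.map (C (R := R))).degree := by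
    rw [hf.degree_map]
    refine degree_C_le.trans_lt ?_
    exact natDegree_pos_iff_degree_pos.mp (Nat.pos_of_ne_zero hd)
  have h1 : (f.map C - C f).Monic := (hf.map C).sub_of_left hlt
  rw [← X_sub_C_X_mul_diffQuot] at h1
  have h2 := (monic_X_sub_C _).of_mul_monic_left h1
  refine ⟨h2, ?_⟩
  have h3 : ((X - C X) * _root_.diffQuot f).natDegree = f.natDegree := by
    rw [X_sub_C_X_mul_diffQuot, natDegree_sub_C, hf.natDegree_map]
  rw [(monic_X_sub_C _).natDegree_mul h2, natDegree_X_sub_C] at h3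
  omega

/-- The norm of the difference quotient of `T` along the fibres of `P`. -/
noncomputable def relativeNorm (P T : R[X]) : R[X] :=
  resultant (diffQuot P) (diffQuot T)

theorem roots_prod_X_sub_C_finset {E ι : Type*} [CommRing E] [IsDomain E] (s : Finset ι)
    (a : ι → E) : (∏ i ∈ s, (X - C (a i))).roots = s.val.map a := by
  have := roots_multiset_prod_X_sub_C (s.val.map a)
  rwa [Multiset.map_map] at this

theorem resultant_prod_X_sub_C {E ι : Type*} [CommRing E] [IsDomain E] (s : Finset ι) (a : ι → E)
    (g : E[X]) {n : ℕ} (hg : g.natDegree ≤ n) :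
    resultant (∏ i ∈ s, (X - C (a i))) g s.card n = ∏ i ∈ s, g.eval (a i) := by
  have h := resultant_eq_prod_eval (∏ i ∈ s, (X - C (a i))) g n hg
    (Splits.prod fun i _ => Splits.X_sub_C _)
  rw [(monic_prod_of_monic _ _ fun i _ => monic_X_sub_C _).leadingCoeff, one_pow, one_mul,
    natDegree_prod_of_monic _ _ (fun i _ => monic_X_sub_C _), roots_prod_X_sub_C_finset] at h
  simpa using h

/-- Resultants commute with specialization when their formal degrees are kept. That of `diffQuot P`
has to equal the number of roots, while the degree of `diffQuot T` may drop. -/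
theorem eval₂_relativeNorm [IsDomain E] {ι : Type*} {P : R[X]} (T : R[X]) (y : E)
    {s : Finset ι} {a : ι → E} (hcard : (diffQuot P).natDegree = s.card)
    (h : (diffQuot P).map (eval₂RingHom ψ y) = ∏ i ∈ s, (X - C (a i))) :
    (relativeNorm P T).eval₂ ψ y = ∏ i ∈ s, diffQuotEval ψ y (a i) T := by
  rw [← coe_eval₂RingHom, relativeNorm, ← resultant_map_map, h, hcard,
    resultant_prod_X_sub_C _ _ _ (natDegree_map_le)]
  rfl

end DifferenceQuotient

/-! ### Polynomials without integral roots -/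

section NoIntegralRoots

open Polynomial

variable {Ω Γ₀ : Type*} [Field Ω] [LinearOrderedCommGroupWithZero Γ₀] {w : Valuation Ω Γ₀}

/-- Multiplying by X - r with w r > 1 keeps the constant coefficient strictly dominant. -/
theorem Valuation.coeff_prod_X_sub_C_lt (s : Multiset Ω) (hs : ∀ r ∈ s, 1 < w r) :
    (s.map fun r => X - C r).prod.coeff 0 ≠ 0 ∧
    ∀ k, w ((s.map fun r => X - C r).prod.coeff (k + 1)) <
      w ((s.map fun r => X - C r).prod.coeff 0) := by
  induction s using Multiset.induction_on with
  | empty => simp [coeff_one]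
  | cons r s ih =>
    obtain ⟨h0, h1⟩ := ih fun r hr => hs r (Multiset.mem_cons_of_mem hr)
    have hr := hs r (Multiset.mem_cons_self r s)
    have hr0 : r ≠ 0 := fun h => by simp [h] at hr
    rw [Multiset.map_cons, Multiset.prod_cons]
    set g := (s.map fun r => X - C r).prod
    have hg : ∀ k, w (g.coeff k) ≤ w (g.coeff 0) := fun k => by
      cases k with
      | zero => exact le_rfl
      | succ k => exact (h1 k).le
    have hc0 : ((X - C r) * g).coeff 0 = -(r * g.coeff 0) := by
      rw [sub_mul, coeff_sub, coeff_X_mul_zero, coeff_C_mul, zero_sub]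
    have hpos : 0 < w (g.coeff 0) := w.pos_iff.mpr h0
    refine ⟨by rw [hc0]; exact neg_ne_zero.mpr (mul_ne_zero hr0 h0), fun k => ?_⟩
    rw [hc0, Valuation.map_neg, map_mul, sub_mul, coeff_sub, coeff_X_mul, coeff_C_mul]
    refine w.map_sub_lt ((hg k).trans_lt ?_) ?_
    · exact lt_mul_of_one_lt_left hpos hr
    · rw [map_mul]
      exact mul_lt_mul_of_pos_left (h1 k) (zero_lt_one.trans hr)

/-- A polynomial over a discrete valuation ring without integral roots is constant up to
coefficients that are multiples of the constant one by non-units. -/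
theorem coeff_succ_mem_of_no_integral_root {A : Type*} [CommRing A] [IsDomain A]
    [IsDiscreteValuationRing A] [Algebra A Ω] [IsAlgClosed Ω]
    (hw : ∀ a : A, w (algebraMap A Ω a) ≤ 1) (f : A[X])
    (hf : ∀ y : Ω, w y ≤ 1 → aeval y f ≠ 0) :
    f.coeff 0 ≠ 0 ∧
    ∀ k, ∃ c ∈ IsLocalRing.maximalIdeal A, f.coeff (k + 1) = f.coeff 0 * c := by
  set F := f.map (algebraMap A Ω) with hF
  have hsp : F.Splits := IsAlgClosed.splits F
  have hF0 : F ≠ 0 := by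
    intro h
    refine hf 0 (by simp) ?_
    rw [aeval_def, ← Polynomial.eval_map, ← hF, h, eval_zero]
  have hroots : ∀ r ∈ F.roots, 1 < w r := by
    intro r hr
    by_contra h
    refine hf r (not_lt.mp h) ?_
    rw [aeval_def, ← Polynomial.eval_map]
    exact (mem_roots hF0).mp hr
  obtain ⟨h0, h1⟩ := w.coeff_prod_X_sub_C_lt F.roots hroots
  have hFe : F = C F.leadingCoeff * (F.roots.map fun r => X - C r).prod :=
    hsp.eq_prod_roots
  have hlc : 0 < w F.leadingCoeff := w.pos_iff.mpr (leadingCoeff_ne_zero.mpr hF0)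
  have key : ∀ k, w (algebraMap A Ω (f.coeff (k + 1))) < w (algebraMap A Ω (f.coeff 0)) := by
    intro k
    rw [← coeff_map, ← coeff_map, ← hF, hFe, coeff_C_mul, coeff_C_mul, map_mul, map_mul]
    exact mul_lt_mul_of_pos_left (h1 k) hlc
  have hf0 : f.coeff 0 ≠ 0 := fun h => by
    have := key 0
    rw [h, map_zero, map_zero] at this
    exact not_lt_zero this
  refine ⟨hf0, fun k => ?_⟩
  -- One coefficient divides the other; the strict inequality of values decides which one, and that
  -- the quotient is not a unit.
  rcases ValuationRing.cond (f.coeff 0) (f.coeff (k + 1)) with ⟨c, hc | hc⟩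
  · refine ⟨c, ?_, hc.symm⟩
    rw [IsLocalRing.mem_maximalIdeal, mem_nonunits_iff]
    intro hu
    obtain ⟨d, hd⟩ := hu.exists_right_inv
    have h2 := key k
    rw [← hc, map_mul, map_mul] at h2
    have h3 : w (algebraMap A Ω c) * w (algebraMap A Ω d) = 1 := by
      rw [← map_mul, ← map_mul, hd, map_one, map_one]
    have h4 : 1 ≤ w (algebraMap A Ω c) := by
      rw [← h3]
      exact mul_le_of_le_one_right' (hw d)
    exact (not_lt.mpr (le_mul_of_one_le_right' h4)) h2
  · exfalso
    have h2 := key k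
    rw [← hc, map_mul, map_mul] at h2
    exact (not_lt.mpr (mul_le_of_le_one_right' (hw c))) h2

end NoIntegralRoots

/-! ### Reduction of polynomials modulo the maximal ideal -/

section ReductionOfPolynomials

open Polynomial

variable {A : Type*} [CommRing A] [IsDomain A] [IsDiscreteValuationRing A]

theorem map_residue_eq_zero_iff {x : A} (hx : Irreducible x) (f : A[X]) :
    f.map (IsLocalRing.residue A) = 0 ↔ C x ∣ f := by
  rw [C_dvd_iff_dvd_coeff, Polynomial.ext_iff]
  refine forall_congr' fun i => ?_
  rw [coeff_map, coeff_zero, IsLocalRing.residue_eq_zero_iff, hx.maximalIdeal_eq,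
    Ideal.mem_span_singleton]

theorem exists_C_mul_eq_map_residue_ne_zero {f : A[X]} (hf : f ≠ 0) :
    ∃ (c : A) (g : A[X]), c ≠ 0 ∧ f = C c * g ∧ g.map (IsLocalRing.residue A) ≠ 0 := by
  obtain ⟨x, hx⟩ := IsDiscreteValuationRing.exists_irreducible A
  have hfin : FiniteMultiplicity (C x) f :=
    FiniteMultiplicity.of_not_isUnit (by
      rw [isUnit_C]
      exact hx.not_isUnit) hf
  obtain ⟨g, hg, hnd⟩ := hfin.exists_eq_pow_mul_and_not_dvd
  refine ⟨x ^ multiplicity (C x) f, g, pow_ne_zero _ hx.ne_zero, ?_, ?_⟩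
  · rw [C_pow]
    exact hg
  · rwa [ne_eq, map_residue_eq_zero_iff hx]

end ReductionOfPolynomials

/-! ### Values at infinity and relative norms -/

namespace ConfigurationAtInfinity

open Polynomial

variable {A : Type u} [CommRing A] [IsDomain A] [IsDiscreteValuationRing A] {P : A[X]} {N : ℕ}
  [NeZero N] (c : ConfigurationAtInfinity A P N)

theorem v_φ_le_one (a : A) : c.v (c.φ a) ≤ 1 := by
  by_cases ha : IsUnit a
  · exact (c.v_unit a ha).le
  · refine (c.v_mem a ((IsLocalRing.mem_maximalIdeal a).mpr ha)).trans ?_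
    rw [← lexValue_zero, lexValue_le]
    exact Or.inl zero_lt_one

theorem v_Y_pow (i : ZMod N) (m : ℕ) : c.v (c.Y i) ^ m = lexValue 0 (-m) := by
  rw [c.v_Y, lexValue_pow, mul_zero, mul_neg_one]

theorem v_monomial_le (a : A) (i : ZMod N) (m : ℕ) :
    c.v (c.φ a * c.Y i ^ m) ≤ lexValue 0 (-m) := by
  rw [map_mul, map_pow, v_Y_pow]
  exact mul_le_of_le_one_left' (c.v_φ_le_one a)

theorem v_eval_le (f : A[X]) (i : ZMod N) :
    c.v (f.eval₂ c.φ (c.Y i)) ≤ lexValue 0 (-f.natDegree) := by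
  rw [eval₂_eq_sum_range]
  refine c.v.map_sum_le fun j hj => (c.v_monomial_le _ _ _).trans ?_
  rw [lexValue_le]
  right
  rw [Finset.mem_range] at hj
  exact ⟨rfl, by omega⟩

/-- The highest term with unit coefficient dominates: lower terms have smaller powers of Y, and
higher ones have coefficients in the maximal ideal, infinitesimal compared to any power of Y. This
is why rank two is needed: the valuation sees the degree of the reduction. -/
theorem v_eval_of_map_ne_zero {f : A[X]} (hf : f.map (IsLocalRing.residue A) ≠ 0) (i : ZMod N) :
    c.v (f.eval₂ c.φ (c.Y i)) = lexValue 0 (-(f.map (IsLocalRing.residue A)).natDegree) := by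
  set m := (f.map (IsLocalRing.residue A)).natDegree with hm
  have hlead : IsUnit (f.coeff m) := by
    have : (f.map (IsLocalRing.residue A)).coeff m ≠ 0 := leadingCoeff_ne_zero.mpr hf
    rw [coeff_map, ne_eq, IsLocalRing.residue_eq_zero_iff, IsLocalRing.mem_maximalIdeal,
      mem_nonunits_iff, not_not] at this
    exact this
  have hvm : c.v (c.φ (f.coeff m) * c.Y i ^ m) = lexValue 0 (-m) := by
    rw [map_mul, map_pow, v_Y_pow, c.v_unit _ hlead, one_mul]
  rw [eval₂_eq_sum_range, ← hvm]
  refine c.v.map_sum_eq_of_lt (f := fun j => c.φ (f.coeff j) * c.Y i ^ j) (j := m) ?_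
    fun j hj => ?_
  · rw [Finset.mem_range, Nat.lt_succ_iff]
    exact natDegree_map_le
  · rw [hvm]
    simp only [Finset.mem_sdiff, Finset.mem_singleton] at hj
    rcases lt_or_gt_of_ne hj.2 with hlt | hgt
    · refine (c.v_monomial_le _ _ _).trans_lt (lt_of_not_ge fun h => ?_)
      rw [lexValue_le] at h
      omega
    · have hmem : f.coeff j ∈ IsLocalRing.maximalIdeal A := by
        rw [← IsLocalRing.residue_eq_zero_iff, ← coeff_map]
        exact coeff_eq_zero_of_natDegree_lt hgt
      rw [map_mul, map_pow, v_Y_pow]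
      refine (mul_le_mul_left (c.v_mem _ hmem) _).trans_lt (lt_of_not_ge fun h => ?_)
      rw [lexValue_mul, lexValue_le] at h
      omega

theorem eval_ne_zero_and_deg_nonneg {f : A[X]} (hf : f ≠ 0) (i : ZMod N) :
    f.eval₂ c.φ (c.Y i) ≠ 0 ∧ 0 ≤ lexDegree (c.v (f.eval₂ c.φ (c.Y i))) := by
  obtain ⟨a, g, ha, rfl, hg⟩ := exists_C_mul_eq_map_residue_ne_zero hf
  have hva : c.v (c.φ a) ≠ 0 := c.v.ne_zero_iff.mpr ((map_ne_zero_iff _ c.injective).mpr ha)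
  have hv := c.v_eval_of_map_ne_zero hg i
  have hv0 : c.v (g.eval₂ c.φ (c.Y i)) ≠ 0 := by rw [hv]; exact lexValue_ne_zero _ _
  rw [eval₂_mul, eval₂_C]
  refine ⟨?_, ?_⟩
  · rw [← c.v.ne_zero_iff, map_mul]
    exact mul_ne_zero hva hv0
  · rw [map_mul, lexDegree_mul hva hv0, c.deg_v a ha, hv, lexDegree_lexValue, zero_add, neg_neg]
    exact Int.natCast_nonneg _

/-- The degree of a polynomial that is constant up to multiples of its constant term by
non-units. -/
theorem deg_eval_eq_zero {f : A[X]} (h0 : f.coeff 0 ≠ 0)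
    (h : ∀ k, ∃ a ∈ IsLocalRing.maximalIdeal A, f.coeff (k + 1) = f.coeff 0 * a) (i : ZMod N) :
    lexDegree (c.v (f.eval₂ c.φ (c.Y i))) = 0 := by
  obtain ⟨a, ha⟩ := Classical.skolem.mp h
  have hf : c.v (f.eval₂ c.φ (c.Y i)) = c.v (c.φ (f.coeff 0)) := by
    have hv0 : 0 < c.v (c.φ (f.coeff 0)) :=
      c.v.pos_iff.mpr ((map_ne_zero_iff _ c.injective).mpr h0)
    rw [eval₂_eq_sum_range, Finset.sum_range_succ', pow_zero, mul_one]
    refine c.v.map_add_eq_of_lt_right (c.v.map_sum_lt hv0.ne' fun j _ => ?_)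
    rw [(ha j).2, map_mul, map_mul, map_mul, mul_assoc]
    refine mul_lt_of_lt_one_right hv0 ?_
    rw [map_pow, v_Y_pow]
    refine (mul_le_mul_left (c.v_mem _ (ha j).1) _).trans_lt (lt_of_not_ge fun h => ?_)
    rw [← lexValue_zero, lexValue_mul, lexValue_le] at h
    omega
  rw [hf, c.deg_v _ h0]

theorem σ_eval (f : A[X]) (k i : ZMod N) :
    c.σ k (f.eval₂ c.φ (c.Y i)) = f.eval₂ c.φ (c.Y (i + k)) := by
  rw [hom_eval₂, c.σ_Y]
  congr 1
  exact RingHom.ext fun a => c.σ_φ k a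

/-- Translations of the indices are realized by the endomorphisms `c.σ k`, which preserve the
valuation. -/
theorem isHomogeneousConfiguration (T : A[X]) :
    IsHomogeneousConfiguration c.v fun i => T.eval₂ c.φ (c.Y i) := by
  intro i j k
  simp only
  rw [← c.σ_eval, ← c.σ_eval, ← map_sub, c.v_σ]

theorem map_eval₂RingHom_diffQuot :
    (diffQuot P).map (eval₂RingHom c.φ (c.Y 0)) =
      ∏ i ∈ Finset.univ.erase (0 : ZMod N), (X - C (c.Y i)) := by
  have h := c.prod_eq
  rw [← Finset.mul_prod_erase _ _ (Finset.mem_univ (0 : ZMod N)), Polynomial.eval_map,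
    ← X_sub_C_mul_map_diffQuot] at h
  exact (mul_left_cancel₀ (X_sub_C_ne_zero _) h).symm

theorem eval_Y (i : ZMod N) : P.eval₂ c.φ (c.Y i) = P.eval₂ c.φ (c.Y 0) := by
  have := congrArg (Polynomial.eval (c.Y i)) c.prod_eq
  rw [eval_prod, Finset.prod_eq_zero (Finset.mem_univ i) (by simp), eval_sub, eval_C,
    Polynomial.eval_map, Polynomial.eval_map] at this
  exact (sub_eq_zero.mp this.symm)

/-- Each factor is Y_i - Y_0 times a difference quotient of T. The former multiply to P'(Y_0) up to
sign, the latter to the relative norm. -/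
theorem prod_sub_eq (hP : P.Monic) (hd : P.natDegree = N) (T : A[X]) :
    ∏ i ∈ Finset.univ.erase (0 : ZMod N), (T.eval₂ c.φ (c.Y i) - T.eval₂ c.φ (c.Y 0)) =
      (-1) ^ (N - 1) * (derivative P).eval₂ c.φ (c.Y 0) *
        (relativeNorm P T).eval₂ c.φ (c.Y 0) := by
  have hcard : (Finset.univ.erase (0 : ZMod N)).card = N - 1 := by
    rw [Finset.card_erase_of_mem (Finset.mem_univ _), Finset.card_univ, ZMod.card]
  rw [eval₂_relativeNorm c.φ T (c.Y 0) (a := c.Y)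
    (by rw [hcard, (hP.diffQuot (by rw [hd]; exact NeZero.ne N)).2, hd])
    c.map_eval₂RingHom_diffQuot]
  have h1 : ∏ i ∈ Finset.univ.erase (0 : ZMod N), (c.Y i - c.Y 0) =
      (-1) ^ (N - 1) * (derivative P).eval₂ c.φ (c.Y 0) := by
    rw [← diffQuotEval_self, diffQuotEval, c.map_eval₂RingHom_diffQuot, eval_prod, ← hcard,
      ← Finset.prod_const, ← Finset.prod_mul_distrib]
    refine Finset.prod_congr rfl fun i _ => ?_
    rw [eval_sub, eval_X, eval_C]
    ring
  rw [← h1, ← Finset.prod_mul_distrib]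
  exact Finset.prod_congr rfl fun i _ => (sub_mul_diffQuotEval c.φ _ _ T).symm

/-- The characteristic polynomial of `T` over the subring generated by `P`. -/
theorem exists_charpoly (hd : P.natDegree = N) (T : A[X]) :
    ∃ F : A[X][X], F.Monic ∧ F.map (eval₂RingHom c.φ (P.eval₂ c.φ (c.Y 0))) =
      ∏ i, (X - C (T.eval₂ c.φ (c.Y i))) := by
  set ψ := eval₂RingHom c.φ (P.eval₂ c.φ (c.Y 0)) with hψ
  -- The element P(Y_0) is transcendental over `A`, so that `F` is monic as soon as its image is.
  have hinj : Function.Injective ψ := by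
    rw [injective_iff_map_eq_zero]
    intro f hf
    by_contra hf0
    have hc : f.comp P ≠ 0 := by
      rw [ne_eq, comp_eq_zero_iff, not_or, not_and]
      refine ⟨hf0, fun _ h => ?_⟩
      have := congrArg natDegree h
      rw [natDegree_C, hd] at this
      exact NeZero.ne N this
    refine (c.eval_ne_zero_and_deg_nonneg hc 0).1 ?_
    rw [eval₂_comp]
    exact hf
  -- The resultant in Z of P(Z) - v and W - T(Z): the inner variable v specializes to P(Y_0), and W
  -- remains.
  set F : A[X][X] := resultant (P.map ((C : A[X] →+* A[X][X]).comp C) - C (C X))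
    (C X - T.map ((C : A[X] →+* A[X][X]).comp C)) N T.natDegree with hF
  have key : F.map ψ = ∏ i, (X - C (T.eval₂ c.φ (c.Y i))) := by
    rw [← coe_mapRingHom, hF, ← resultant_map_map]
    have hcomp : ((mapRingHom ψ).comp ((C : A[X] →+* A[X][X]).comp C))
        = (C : c.L →+* c.L[X]).comp c.φ := by
      ext a
      simp [hψ]
    have e1 : (P.map ((C : A[X] →+* A[X][X]).comp C) - C (C X)).map (mapRingHom ψ) =
        ∏ i : ZMod N, (X - C (C (c.Y i))) := by
      rw [Polynomial.map_sub, Polynomial.map_map, hcomp, map_C, coe_mapRingHom, map_C, hψ,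
        coe_eval₂RingHom, eval₂_X]
      have := congrArg (Polynomial.map (C : c.L →+* c.L[X])) c.prod_eq
      rw [Polynomial.map_prod, Polynomial.map_sub, Polynomial.map_map, map_C,
        Polynomial.eval_map] at this
      rw [← this]
      simp
    have e2 : (C X - T.map ((C : A[X] →+* A[X][X]).comp C)).map (mapRingHom ψ) =
        C X - T.map ((C : c.L →+* c.L[X]).comp c.φ) := by
      rw [Polynomial.map_sub, Polynomial.map_map, hcomp, map_C, coe_mapRingHom, map_X]
    have h3 := resultant_prod_X_sub_C Finset.univ (fun i : ZMod N => C (c.Y i))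
      (C X - T.map ((C : c.L →+* c.L[X]).comp c.φ)) (n := T.natDegree)
      ((natDegree_sub_le _ _).trans (by simp [natDegree_map_le]))
    rw [Finset.card_univ, ZMod.card] at h3
    rw [e1, e2, h3]
    refine Finset.prod_congr rfl fun i _ => ?_
    rw [eval_sub, eval_C, Polynomial.eval_map, hom_eval₂]
  exact ⟨F, monic_of_injective hinj (key ▸ monic_prod_of_monic _ _ fun i _ => monic_X_sub_C _), key⟩

theorem ball_zero_eq {L Γ₀ ι : Type*} [Field L] [LinearOrderedCommGroupWithZero Γ₀]
    {v : Valuation L Γ₀} [AddCommGroup ι] {T : ι → L} (hT : IsHomogeneousConfiguration v T)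
    (hinj : Function.Injective T) : hT.ball 0 = ⊥ := by
  ext i
  rw [hT.mem_ball, le_zero_iff, map_eq_zero, sub_eq_zero, hinj.eq_iff, AddSubgroup.mem_bot]

theorem map_residue_natDegree_derivative [Algebra ℚ A] {f : A[X]} (hf : f.Monic) :
    ((derivative f).map (IsLocalRing.residue A)).natDegree = f.natDegree - 1 := by
  have : Algebra ℚ (IsLocalRing.ResidueField A) :=
    ((IsLocalRing.residue A).comp (algebraMap ℚ A)).toAlgebra
  have : CharZero (IsLocalRing.ResidueField A) := algebraRat.charZero _
  rw [← derivative_map, natDegree_derivative, hf.natDegree_map]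

/-- If the relative norm of `T` is constant up to multiples of its constant term by non-units,
then `T` is, up to terms of small degree, a polynomial in `P` modulo the maximal ideal. -/
theorem exists_natDegree_sub_comp_lt [Algebra ℚ A] (hP : P.Monic) (hd : P.natDegree = N)
    (hN : 2 ≤ N) (T : A[X]) (h0 : (relativeNorm P T).coeff 0 ≠ 0)
    (h : ∀ k, ∃ a ∈ IsLocalRing.maximalIdeal A,
      (relativeNorm P T).coeff (k + 1) = (relativeNorm P T).coeff 0 * a) :
    ∃ g : A[X], (((N : A[X]) * T - g.comp P).map (IsLocalRing.residue A)).natDegree < N := by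
  classical
  obtain ⟨c⟩ := exists_configurationAtInfinity A hP N hd
  by_contra! hcon
  obtain ⟨F, hF, hFT⟩ := c.exists_charpoly hd T
  set t : ZMod N → c.L := fun i => T.eval₂ c.φ (c.Y i) with ht
  set ψ := eval₂RingHom c.φ (P.eval₂ c.φ (c.Y 0)) with hψ
  let _ : Algebra ℚ c.L := (c.φ.comp (algebraMap ℚ A)).toAlgebra
  have : CharZero c.L := algebraRat.charZero _
  have hT := c.isHomogeneousConfiguration T
  have hnorm0 : relativeNorm P T ≠ 0 := fun h => h0 (by rw [h, coeff_zero])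
  have hder := map_residue_natDegree_derivative hP
  have hder0 : (derivative P).map (IsLocalRing.residue A) ≠ 0 := fun h => by
    rw [h, natDegree_zero] at hder
    omega
  have hprod := c.prod_sub_eq hP hd T
  have hv1 : c.v ((derivative P).eval₂ c.φ (c.Y 0)) = lexValue 0 (-((N - 1 : ℕ) : ℤ)) := by
    rw [c.v_eval_of_map_ne_zero hder0, hder, hd]
  have hv2 := (c.eval_ne_zero_and_deg_nonneg hnorm0 0).1
  -- The relative norm has degree 0, so the product of differences has the degree N - 1 of P'.
  have hdeg : lexDegree (∏ i ∈ Finset.univ.erase (0 : ZMod N), c.v (t i - t 0)) =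
      ((N - 1 : ℕ) : ℤ) := by
    rw [← map_prod, hprod, map_mul, map_mul, map_pow, Valuation.map_neg, map_one, one_pow, one_mul,
      lexDegree_mul (by rw [hv1]; exact lexValue_ne_zero _ _) (c.v.ne_zero_iff.mpr hv2), hv1,
      lexDegree_lexValue, c.deg_eval_eq_zero h0 h, neg_neg, add_zero]
  have hne : ∀ i ≠ 0, t i - t 0 ≠ 0 := by
    have hp0 : ∏ i ∈ Finset.univ.erase (0 : ZMod N), (t i - t 0) ≠ 0 := by
      rw [hprod]
      refine mul_ne_zero (mul_ne_zero (pow_ne_zero _ (neg_ne_zero.mpr one_ne_zero)) ?_) hv2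
      rw [← c.v.ne_zero_iff, hv1]
      exact lexValue_ne_zero _ _
    intro i hi
    exact Finset.prod_ne_zero_iff.mp hp0 i (Finset.mem_erase.mpr ⟨hi, Finset.mem_univ i⟩)
  have hinj : Function.Injective t := by
    intro i j hij
    by_contra hne'
    have h1 := hT (i - j) 0 j
    rw [sub_add_cancel, zero_add] at h1
    refine hne (i - j) (sub_ne_zero.mpr hne') (c.v.zero_iff.mp ?_)
    rw [← h1]
    simp only [ht] at hij
    simp [hij]
  -- The polynomial -F.coeff (N - 1) represents the trace of T, so `U` is N T minus the trace, and
  -- its value at Y_0 is -∑ (t i - t 0).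
  set U := (N : A[X]) * T - (-F.coeff (N - 1)).comp P with hU
  have hUN := hcon (-F.coeff (N - 1))
  rw [← hU] at hUN
  have hUe : U.eval₂ c.φ (c.Y 0) = -∑ i, (t i - t 0) := by
    have hcoeff : ψ (F.coeff (N - 1)) = -∑ i, t i := by
      rw [← coeff_map, hFT]
      have h1 : (∏ i, (X - C (t i))).natDegree = N := by
        rw [natDegree_prod_of_monic _ _ fun i _ => monic_X_sub_C _]
        simp [ZMod.card]
      have h2 := prod_X_sub_C_nextCoeff (s := Finset.univ) t
      rw [nextCoeff_of_natDegree_pos (by rw [h1]; omega), h1] at h2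
      exact h2
    rw [hU, eval₂_sub, eval₂_mul, eval₂_natCast, eval₂_comp, eval₂_neg]
    have h3 : (F.coeff (N - 1)).eval₂ c.φ (P.eval₂ c.φ (c.Y 0)) = -∑ i, t i := hcoeff
    rw [h3, Finset.sum_sub_distrib, Finset.sum_const, Finset.card_univ, ZMod.card, nsmul_eq_mul]
    simp only [ht]
    ring
  have hU0 : U.map (IsLocalRing.residue A) ≠ 0 := fun h => by
    rw [h, natDegree_zero] at hUN
    omega
  have hUv := c.v_eval_of_map_ne_zero hU0 0
  have hle := hT.le_deg_prod hinj (φ := ψ) (fun r => c.v_φ_le_one _) hF hFT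
    (fun G i => by
      have e : c.σ i ((G.map ψ).eval (t 0)) = (G.map ψ).eval (t i) := by
        rw [← eval_map_apply, Polynomial.map_map, ht]
        simp only
        rw [c.σ_eval, zero_add]
        congr 2
        refine Polynomial.ringHom_ext (fun a => ?_) ?_
        · simp [hψ, c.σ_φ]
        · simp only [hψ, RingHom.comp_apply, coe_eval₂RingHom, eval₂_X]
          rw [c.σ_eval, c.eval_Y]
      exact (congrArg c.v e).symm.trans (c.v_σ _ _))
    lexDegree (fun a b ha hb => lexDegree_mul ha hb)
    (fun G hG => by
      have e : (G.map ψ).eval (t 0) =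
          (G.eval₂ (compRingHom P) T).eval₂ c.φ (c.Y 0) := by
        rw [Polynomial.eval_map, ← coe_eval₂RingHom c.φ, hom_eval₂]
        congr 1
        refine Polynomial.ringHom_ext (fun a => ?_) ?_
        · simp [hψ]
        · simp [hψ]
      rw [e] at hG ⊢
      refine (c.eval_ne_zero_and_deg_nonneg (fun h => hG ?_) 0).2
      rw [h, eval₂_zero])
    (κ := (N : ℤ)) (Int.natCast_nonneg N)
    (fun i hi => by
      -- The degree is not monotone for the lexicographic order. The largest distance is squeezed
      -- between values of first component 0, that of `U` and a bound from T, so its own first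
      -- component is 0 and its degree is at least N.
      have h1 : c.v (U.eval₂ c.φ (c.Y 0)) ≤ c.v (t i - t 0) := by
        rw [hUe, Valuation.map_neg]
        exact c.v.map_sum_le fun j _ => hi j
      rw [hUv] at h1
      have h2 : c.v (t i - t 0) ≤ lexValue 0 (-T.natDegree) :=
        c.v.map_sub_le (c.v_eval_le T i) (c.v_eval_le T 0)
      have h3 : c.v (t i - t 0) ≠ 0 := fun h => by
        rw [h, le_zero_iff] at h1
        exact lexValue_ne_zero _ _ h1
      obtain ⟨a, b, hab⟩ := exists_lexValue_eq h3
      simp only [ht] at hab h1 h2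
      rw [hab] at h1 h2 ⊢
      rw [lexValue_le] at h1 h2
      rw [lexDegree_lexValue]
      omega)
    -- For radius 0 the ball is trivial, and the lower bound N contradicts the degree N - 1 found
    -- above.
    0 ⟨1, by
      have : Fact (1 < N) := ⟨by omega⟩
      rw [ball_zero_eq hT hinj, AddSubgroup.mem_bot]
      exact one_ne_zero⟩
  have hset : Finset.univ.filter (fun i => i ∉ hT.ball 0) = Finset.univ.erase (0 : ZMod N) := by
    ext i
    rw [ball_zero_eq hT hinj]
    simp [AddSubgroup.mem_bot]
  rw [hset] at hle
  have h5 := hle.trans_eq hdeg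
  have h6 : 0 < Fintype.card (hT.ball 0) := Fintype.card_pos
  have h7 : (1 : ℤ) ≤ Fintype.card (hT.ball 0) := by exact_mod_cast h6
  have h8 : (N : ℤ) * 1 ≤ N * Fintype.card (hT.ball 0) :=
    mul_le_mul_of_nonneg_left h7 (Int.natCast_nonneg N)
  omega

end ConfigurationAtInfinity

/-! ### Normal form of Q under a substitution congruent to the identity -/

section NormalForm

open Polynomial

variable {A : Type*} [CommRing A] [IsDomain A] [IsDiscreteValuationRing A]

theorem exists_eq_add_C_mul_of_map_residue_eq {x : A} (hx : Irreducible x) {f g : A[X]}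
    (h : f.map (IsLocalRing.residue A) = g.map (IsLocalRing.residue A)) :
    ∃ e, f = g + C x * e := by
  rw [← sub_eq_zero, ← Polynomial.map_sub, map_residue_eq_zero_iff hx] at h
  obtain ⟨e, he⟩ := h
  exact ⟨e, by rw [← he]; ring⟩

theorem exists_lift_degree_eq (f : (IsLocalRing.ResidueField A)[X]) :
    ∃ g : A[X], g.map (IsLocalRing.residue A) = f ∧ g.degree = f.degree := by
  refine exists_degree_eq_of_mem_lifts ?_
  rw [mem_lifts]
  exact map_surjective _ IsLocalRing.residue_surjective f

/-- Euclidean division by q over the residue field, lifted to `A`: `g` lifts minus the quotient, `r`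
lifts the remainder without raising its degree. -/
theorem exists_mul_add_eq {x : A} (hx : Irreducible x) {q : A[X]}
    (hq : q.map (IsLocalRing.residue A) ≠ 0) (e : A[X]) :
    ∃ g r s : A[X], e + q * g = r + C x * s ∧
      r.degree < (q.map (IsLocalRing.residue A)).degree := by
  set ρ := IsLocalRing.residue A
  obtain ⟨g, hg⟩ := map_surjective ρ IsLocalRing.residue_surjective (-(e.map ρ / q.map ρ))
  obtain ⟨r, hr, hrd⟩ := exists_lift_degree_eq (e.map ρ % q.map ρ)
  obtain ⟨s, hs⟩ := exists_eq_add_C_mul_of_map_residue_eq hx (f := e + q * g) (g := r) (by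
    rw [Polynomial.map_add, Polynomial.map_mul, hg, hr]
    linear_combination -(EuclideanDomain.div_add_mod (e.map ρ) (q.map ρ)))
  exact ⟨g, r, s, hs, hrd.trans_lt (EuclideanDomain.mod_lt _ hq)⟩

/-- A substitution congruent to the identity makes a polynomial congruent, modulo a power of the
uniformizer, to a polynomial of the degree of its reduction. -/
theorem exists_comp_eq_add {x : A} (hx : Irreducible x) {Q : A[X]} {N : ℕ}
    (hQ : (Q.map (IsLocalRing.residue A)).natDegree = N)
    (hq : (derivative Q).map (IsLocalRing.residue A) ≠ 0)
    (hqN : ((derivative Q).map (IsLocalRing.residue A)).natDegree < N) {n : ℕ} (hn : 0 < n) :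
    ∃ φ e R g : A[X], φ = X + C x * g ∧ Q.comp φ = R + C (x ^ n) * e ∧ R.natDegree ≤ N ∧
      IsUnit (R.coeff N) := by
  have hunit : ∀ a : A, IsLocalRing.residue A a ≠ 0 → IsUnit a := fun a ha => by
    rwa [ne_eq, IsLocalRing.residue_eq_zero_iff, IsLocalRing.mem_maximalIdeal, mem_nonunits_iff,
      not_not] at ha
  induction n, hn using Nat.le_induction with
  | base =>
    obtain ⟨R, hR, hRd⟩ := exists_lift_degree_eq (Q.map (IsLocalRing.residue A))
    obtain ⟨e, he⟩ := exists_eq_add_C_mul_of_map_residue_eq hx hR.symm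
    refine ⟨X, e, R, 0, by simp, by rw [comp_X, Nat.succ_eq_add_one, zero_add, pow_one]; exact he,
      ?_, hunit _ ?_⟩
    · rw [natDegree_eq_of_degree_eq hRd, hQ]
    · rw [← coeff_map, hR, ← hQ]
      refine leadingCoeff_ne_zero.mpr fun h => ?_
      rw [h, natDegree_zero] at hQ
      omega
  | succ n hn ih =>
    obtain ⟨φ, e, R, g, hφ, hQφ, hRN, hRu⟩ := ih
    -- Newton step: adding x^n g' to φ adds x^n q g' to Q(φ) modulo x^(n+1). The choice of g'
    -- leaves, modulo x, an error of degree less than that of q modulo x, which `R` absorbs without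
    -- changing its coefficient of degree N.
    obtain ⟨g', r, s, hs, hr⟩ := exists_mul_add_eq hx hq e
    obtain ⟨m, rfl⟩ : ∃ m, n = m + 1 := ⟨n - 1, (Nat.sub_add_cancel hn).symm⟩
    have hcomp : ∀ f h : A[X], f.comp h = (f.map C).eval h := fun f h => by
      rw [Polynomial.eval_map]; rfl
    obtain ⟨k, hk⟩ := binomExpansion (Q.map C) φ (C (x ^ (m + 1)) * g')
    obtain ⟨l, hl⟩ := evalSubFactor ((derivative Q).map C) φ X
    rw [derivative_map, ← hcomp, ← hcomp, ← hcomp] at hk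
    rw [← hcomp, ← hcomp, comp_X, hφ, add_sub_cancel_left, ← hφ] at hl
    refine ⟨φ + C (x ^ (m + 1)) * g', s + l * g * g' + k * C (x ^ m) * g' ^ 2,
      R + C (x ^ (m + 1)) * r, g + C (x ^ m) * g', ?_, ?_, ?_, ?_⟩
    · rw [hφ]
      simp only [C_pow]
      ring
    · rw [hk, hQφ]
      simp only [C_pow] at *
      linear_combination (C x ^ (m + 1)) * hs + (C x ^ (m + 1) * g') * hl
    · refine (natDegree_add_le _ _).trans (max_le hRN ((natDegree_C_mul_le _ _).trans ?_))
      have := natDegree_le_natDegree hr.le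
      omega
    · rw [coeff_add, coeff_C_mul, coeff_eq_zero_of_degree_lt (hr.trans_le (degree_le_natDegree.trans
        (by exact_mod_cast hqN.le))), mul_zero, add_zero]
      exact hRu

end NormalForm

/-! ### Derivatives along a curve and common zeros of difference quotients -/

section NoRoots

open Polynomial

theorem Derivation.map_planeEval {A C : Type*} [CommRing A] [CommRing C] [Algebra A C]
    (δ : Derivation A C C) (y z : C) (f : MvPolynomial (Fin 2) A) :
    δ (planeEval y z f) = planeEval y z (MvPolynomial.pderiv 0 f) * δ y +
      planeEval y z (MvPolynomial.pderiv 1 f) * δ z := by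
  induction f using MvPolynomial.induction_on with
  | C c =>
    rw [← MvPolynomial.algebraMap_eq, AlgHom.commutes, Derivation.map_algebraMap,
      Derivation.map_algebraMap, Derivation.map_algebraMap]
    simp
  | add f g hf hg => simp only [map_add, hf, hg]; ring
  | mul_X f i hf =>
    rw [map_mul, Derivation.leibniz, Derivation.leibniz, Derivation.leibniz, hf]
    fin_cases i
    · simp [MvPolynomial.pderiv_X]
      ring
    · simp [MvPolynomial.pderiv_X]
      ring

variable {R E : Type*} [CommRing R] [Field E] [IsAlgClosed E] (ψ : R →+* E)

theorem exists_diffQuotEval_eq_zero [Nontrivial R] {P : R[X]} (hP : P.Monic)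
    (hd : P.natDegree ≠ 0) (T : R[X]) {y : E} (h : (relativeNorm P T).eval₂ ψ y = 0) :
    ∃ z, diffQuotEval ψ y z P = 0 ∧ diffQuotEval ψ y z T = 0 := by
  obtain ⟨hm, -⟩ := hP.diffQuot hd
  set f := (diffQuot P).map (eval₂RingHom ψ y) with hf
  have hfm : f.Monic := hm.map _
  rw [← coe_eval₂RingHom, relativeNorm, ← resultant_map_map, ← hf, ← hm.natDegree_map
    (eval₂RingHom ψ y), ← hf, resultant_eq_prod_eval _ _ _ natDegree_map_le
    (IsAlgClosed.splits f), hfm.leadingCoeff, one_pow, one_mul, Multiset.prod_eq_zero_iff,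
    Multiset.mem_map] at h
  obtain ⟨z, hz, hzT⟩ := h
  exact ⟨z, (mem_roots hfm.ne_zero).mp hz, hzT⟩

end NoRoots

/-! ### Bounds for values of polynomials -/

section ValuationBounds

open Polynomial

theorem Valuation.eval_sub_eval_le {Ω Γ₀ : Type*} [Field Ω]
    [LinearOrderedCommGroupWithZero Γ₀] (w : Valuation Ω Γ₀) {y z : Ω} (hy : w y ≤ 1) (hz : w z ≤ 1)
    (f : Polynomial Ω)
    (hf : ∀ i, w (f.coeff i) ≤ 1) : w (f.eval z - f.eval y) ≤ w (z - y) := by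
  rw [eval_eq_sum_range, eval_eq_sum_range, ← Finset.sum_sub_distrib]
  refine w.map_sum_le fun i _ => ?_
  rw [← mul_sub, ← Commute.geom_sum₂_mul (Commute.all z y), map_mul, map_mul]
  refine (mul_le_of_le_one_left' (hf i)).trans (mul_le_of_le_one_left' (w.map_sum_le fun j _ => ?_))
  rw [map_mul, map_pow, map_pow]
  exact mul_le_one' (pow_le_one' hz _) (pow_le_one' hy _)

variable {A Ω Γ₀ : Type*} [CommRing A] [Field Ω] [Algebra A Ω] [LinearOrderedCommGroupWithZero Γ₀]
  (w : Valuation Ω Γ₀) (hw : ∀ a : A, w (algebraMap A Ω a) ≤ 1)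
include hw

theorem Valuation.le_one_of_aeval_le_one {P : A[X]} (hP : P.Monic) (hd : P.natDegree ≠ 0) {z : Ω}
    (h : w (aeval z P) ≤ 1) : w z ≤ 1 := by
  by_contra hz
  rw [not_le] at hz
  have hz0 : 0 < w z := zero_lt_one.trans hz
  have hlt : w (aeval z P) = w z ^ P.natDegree := by
    rw [aeval_eq_sum_range, Finset.sum_range_succ, hP.coeff_natDegree, one_smul, ← map_pow]
    refine w.map_add_eq_of_lt_right (w.map_sum_lt ?_ fun i hi => ?_)
    · rw [map_pow]
      exact (pow_pos hz0 _).ne'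
    · rw [Algebra.smul_def, map_mul, map_pow, map_pow]
      exact (mul_le_of_le_one_left' (hw _)).trans_lt
        (pow_lt_pow_right₀ hz (Finset.mem_range.mp hi))
  rw [hlt] at h
  exact (not_lt.mpr h) (one_lt_pow₀ hz hd)

theorem Valuation.diffQuotEval_le_one {y z : Ω} (hy : w y ≤ 1) (hz : w z ≤ 1) (f : A[X]) :
    w (diffQuotEval (algebraMap A Ω) y z f) ≤ 1 := by
  rw [diffQuotEval, Polynomial.eval_map, eval₂_eq_sum_range]
  refine w.map_sum_le fun i _ => ?_
  rw [map_mul, map_pow]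
  exact mul_le_one' (w.aeval_le_one hw hy _) (pow_le_one' hz i)

theorem Valuation.diffQuotEval_sub_le {y z : Ω} (hy : w y ≤ 1) (hz : w z ≤ 1) (f : A[X]) :
    w (diffQuotEval (algebraMap A Ω) y z f - diffQuotEval (algebraMap A Ω) y y f) ≤ w (z - y) := by
  refine w.eval_sub_eval_le hy hz _ fun i => ?_
  rw [coeff_map]
  exact w.aeval_le_one hw hy _

end ValuationBounds

/-! ### Absence of integral roots of the relative norm -/

section NoIntegralRootsOfNorm

open Polynomial

/-- The relative norm of `T = J(φ, e)` has no integral roots. -/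
theorem aeval_relativeNorm_ne_zero {A : Type u} [CommRing A] [IsDomain A] [Algebra ℚ A]
    {Ω : Type*} [Field Ω] [IsAlgClosed Ω] [Algebra A Ω] {Γ₀ : Type*}
    [LinearOrderedCommGroupWithZero Γ₀] {w : Valuation Ω Γ₀}
    (hw : ∀ a : A, w (algebraMap A Ω a) ≤ 1) {x : A} (hx0 : algebraMap A Ω x ≠ 0)
    (hx : w (algebraMap A Ω x) < 1) {n : ℕ} (hn : 0 < n) {q Q : A[X]} (hQ : derivative Q = q)
    {p : MvPolynomial (Fin 2) A} (hV : HasIntegralTime w x n q Q p) (hF : HasNoFixedPoint w q p)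
    {φ e P g : A[X]} {l : A} (hφ : φ = X + C x * g) (hQφ : Q.comp φ = C l * P + C (x ^ n) * e)
    (hP : P.Monic) (hd : P.natDegree ≠ 0) {M : ℕ} {J : MvPolynomial (Fin 2) A}
    (hJ : planeDerivation (x ^ n) q J = MvPolynomial.C (x ^ M) * p)
    {y₀ : Ω} (hy₀ : w y₀ ≤ 1) : aeval y₀ (relativeNorm P (planeEval φ e J)) ≠ 0 := by
  set T := planeEval φ e J with hT
  intro h0
  -- A root yields a second parameter with the same P and T; it may equal y₀, in which case the
  -- derivatives of P and T vanish there.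
  obtain ⟨y₁, hP1, hT1⟩ := exists_diffQuotEval_eq_zero (algebraMap A Ω) hP hd T h0
  have hP2 : aeval y₁ P = aeval y₀ P := by
    have := sub_mul_diffQuotEval (algebraMap A Ω) y₀ y₁ P
    rw [hP1, mul_zero] at this
    exact (sub_eq_zero.mp this.symm)
  have hT2 : aeval y₁ T = aeval y₀ T := by
    have := sub_mul_diffQuotEval (algebraMap A Ω) y₀ y₁ T
    rw [hT1, mul_zero] at this
    exact (sub_eq_zero.mp this.symm)
  have hy₁ : w y₁ ≤ 1 := w.le_one_of_aeval_le_one hw hP hd (by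
    rw [hP2]
    exact w.aeval_le_one hw hy₀ P)
  have hxmul : ∀ s : Ω, w s ≤ 1 → w (algebraMap A Ω x * s) < 1 := fun s hs => by
    rw [map_mul]
    exact mul_lt_one_of_lt_of_le hx hs
  have hxn : algebraMap A Ω (x ^ n) ≠ 0 := by
    rw [map_pow]
    exact pow_ne_zero _ hx0
  have hwxn : w (algebraMap A Ω (x ^ n)) < 1 := by
    rw [map_pow, map_pow]
    exact pow_lt_one₀ zero_le hx hn.ne'
  have hQy : ∀ y : Ω, aeval (aeval y φ) Q =
      algebraMap A Ω l * aeval y P + algebraMap A Ω (x ^ n) * aeval y e := fun y => by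
    have := congrArg (aeval y) hQφ
    rwa [aeval_comp, map_add, map_mul, map_mul, aeval_C, aeval_C] at this
  -- Along the curve x^n z - Q(y) equals -l P, so both points lie on one fibre.
  have hv : algebraMap A Ω (x ^ n) * aeval y₁ e - aeval (aeval y₁ φ) Q =
      algebraMap A Ω (x ^ n) * aeval y₀ e - aeval (aeval y₀ φ) Q := by
    rw [hQy, hQy, hP2]
    ring
  have hJT : ∀ y : Ω, planeEval (aeval y φ) (aeval y e) J = aeval y T := fun y =>
    (comp_planeEval (aeval y : A[X] →ₐ[A] Ω) φ e J).symm
  have hJ2 : planeEval (aeval y₁ φ) (aeval y₁ e) J = planeEval (aeval y₀ φ) (aeval y₀ e) J := by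
    rw [hJT, hJT, hT2]
  obtain ⟨t, ht, hyt⟩ := hV (aeval y₀ φ) (aeval y₀ e) (aeval y₁ φ) (aeval y₁ e)
    (w.aeval_le_one hw hy₀ φ) (w.aeval_le_one hw hy₀ e) (w.aeval_le_one hw hy₁ φ)
    (w.aeval_le_one hw hy₁ e) hv M J 0 hJ (by simp) (by rw [hJ2, sub_self, mul_zero])
  have hφsub : aeval y₁ φ - aeval y₀ φ =
      (y₁ - y₀) * (1 + algebraMap A Ω x * diffQuotEval (algebraMap A Ω) y₀ y₁ g) := by
    have h1 : (y₁ - y₀) * diffQuotEval (algebraMap A Ω) y₀ y₁ g = aeval y₁ g - aeval y₀ g :=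
      sub_mul_diffQuotEval (algebraMap A Ω) y₀ y₁ g
    rw [hφ]
    simp only [map_add, map_mul, aeval_X, aeval_C]
    linear_combination -(algebraMap A Ω x) * h1
  have hone : ∀ s : Ω, w s ≤ 1 → w (1 + algebraMap A Ω x * s) = 1 := fun s hs => by
    rw [w.map_add_eq_of_lt_left (by rw [map_one]; exact hxmul s hs), map_one]
  have hfac := hone _ (w.diffQuotEval_le_one hw hy₀ hy₁ g)
  -- The integral time bounds φ(y₁) - φ(y₀) by x^n, and this difference is y₁ - y₀ times a unit.
  have hsub : w (y₁ - y₀) < 1 := by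
    have h1 := congrArg w hφsub
    rw [map_mul, hfac, mul_one, hyt, add_sub_cancel_left] at h1
    rw [← h1, map_mul]
    exact Right.mul_lt_one_of_le_of_lt ht hwxn
  -- The difference quotient of P vanishes at (y₀, y₁), and differs from P'(y₀) by at most y₁ - y₀.
  have hP' : w (aeval y₀ (derivative P)) < 1 := by
    have h1 := w.diffQuotEval_sub_le hw hy₀ hy₁ P
    rw [hP1, zero_sub, Valuation.map_neg, diffQuotEval_self] at h1
    exact h1.trans_lt hsub
  have hderQ : aeval (aeval y₀ φ) q * (1 + algebraMap A Ω x * aeval y₀ (derivative g)) =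
      algebraMap A Ω l * aeval y₀ (derivative P) +
        algebraMap A Ω (x ^ n) * aeval y₀ (derivative e) := by
    have h1 := congrArg (fun f => aeval y₀ (derivative f)) hQφ
    simp only [derivative_comp, derivative_mul, derivative_C, zero_mul, zero_add,
      map_add, map_mul, aeval_C, aeval_comp, hQ] at h1
    rw [← h1, hφ]
    simp only [derivative_X, derivative_mul, derivative_C, zero_mul, zero_add,
      map_add, map_mul, aeval_C, map_one]
    ring
  have hfac' := hone _ (w.aeval_le_one hw hy₀ (derivative g))
  have hq : w (aeval (aeval y₀ φ) q) < 1 := by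
    have h1 := congrArg w hderQ
    rw [map_mul, hfac', mul_one] at h1
    rw [h1]
    refine w.map_add_lt ?_ ?_
    · rw [map_mul]
      exact Right.mul_lt_one_of_le_of_lt (hw l) hP'
    · rw [map_mul]
      exact mul_lt_one_of_lt_of_le hwxn (w.aeval_le_one hw hy₀ _)
  by_cases hne : y₁ = y₀
  · subst hne
    rw [diffQuotEval_self] at hP1 hT1
    -- Tangent case: with T' = 0 and P' = 0 the curve is tangent to the direction (x^n, q), along
    -- which J has derivative x^M p. Hence p vanishes at the point, which is then fixed modulo the
    -- maximal ideal.
    have hT' : planeEval (aeval y₁ φ) (aeval y₁ e) (MvPolynomial.pderiv 0 J) *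
        aeval y₁ (derivative φ) + planeEval (aeval y₁ φ) (aeval y₁ e) (MvPolynomial.pderiv 1 J) *
        aeval y₁ (derivative e) = 0 := by
      have h1 := congrArg (aeval y₁) ((derivative' (R := A)).map_planeEval φ e J)
      rw [map_add, map_mul, map_mul, comp_planeEval, comp_planeEval] at h1
      exact h1.symm.trans hT1
    have hP0 : aeval y₁ (derivative P) = 0 := hP1
    have hJ' := congrArg (planeEval (aeval y₁ φ) (aeval y₁ e)) hJ
    rw [planeEval_planeDerivation, map_mul, ← MvPolynomial.algebraMap_eq, AlgHom.commutes] at hJ'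
    have hφ' : aeval y₁ (derivative φ) = 1 + algebraMap A Ω x * aeval y₁ (derivative g) := by
      rw [hφ]
      simp
    rw [hP0, mul_zero, zero_add, ← hφ'] at hderQ
    rw [← hφ'] at hfac'
    have hp0 : planeEval (aeval y₁ φ) (aeval y₁ e) p = 0 := by
      have h2 : aeval y₁ (derivative φ) * algebraMap A Ω (x ^ M) *
          planeEval (aeval y₁ φ) (aeval y₁ e) p = 0 := by
        linear_combination -(aeval y₁ (derivative φ)) * hJ' + algebraMap A Ω (x ^ n) * hT' +
          (planeEval (aeval y₁ φ) (aeval y₁ e) (MvPolynomial.pderiv 1 J)) * hderQ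
      refine (mul_eq_zero.mp h2).resolve_left (mul_ne_zero (fun h => ?_) ?_)
      · rw [h, map_zero] at hfac'
        exact zero_ne_one hfac'
      · rw [map_pow]
        exact pow_ne_zero _ hx0
    refine hF _ _ (w.aeval_le_one hw hy₀ φ) (w.aeval_le_one hw hy₀ e) hq ?_
    rw [hp0, map_zero]
    exact zero_lt_one
  · have h1 := hF.eq_zero_of_increment_eq_zero hx0 hn hQ hw hx (w.aeval_le_one hw hy₀ φ)
      (w.aeval_le_one hw hy₀ e) hv hyt ht hJ hJ2 hq
    rw [h1, zero_mul, add_zero] at hyt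
    rw [hyt, sub_self] at hφsub
    refine (mul_ne_zero (sub_ne_zero.mpr hne) fun h => ?_) hφsub.symm
    rw [h, map_zero] at hfac
    exact zero_ne_one hfac

end NoIntegralRootsOfNorm

/-! ### Integrals of p (Q(s) - Q(y))^d as binomial sums -/

section BinomialSum

open Polynomial

/-- The sum `∑ j, d.choose j * V ^ (d - j) * I j`. -/
def binomialSum {C : Type*} [CommRing C] (V : C) (I : ℕ → C) (d : ℕ) : C :=
  ∑ j ∈ Finset.range (d + 1), (d.choose j : C) * V ^ (d - j) * I j

theorem map_binomialSum {C C' : Type*} [CommRing C] [CommRing C'] (f : C →+* C') (V : C)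
    (I : ℕ → C) (d : ℕ) : f (binomialSum V I d) = binomialSum (f V) (fun j => f (I j)) d := by
  simp only [binomialSum, map_sum, map_mul, map_pow, map_natCast]

/-- When I j is a primitive of c Q^j, the sum behaves as ∫ c (V + Q)^d with V held constant; the
last term accounts for the variation of V. -/
theorem Derivation.binomialSum_aux {A C : Type*} [CommRing A] [CommRing C] [Algebra A C]
    (δ : Derivation A C C) {V Q c : C} {I : ℕ → C} (hI : ∀ j, δ (I j) = c * Q ^ j) (d : ℕ) :
    δ (binomialSum V I d) = c * (V + Q) ^ d +
      (∑ j ∈ Finset.range (d + 1), (d.choose j : C) * (((d - j : ℕ) : C) * V ^ (d - j - 1)) * I j)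
        * δ V := by
  rw [binomialSum, map_sum, add_comm V Q, add_pow, Finset.mul_sum, Finset.sum_mul,
    ← Finset.sum_add_distrib]
  refine Finset.sum_congr rfl fun j _ => ?_
  rw [Derivation.leibniz, Derivation.leibniz, Derivation.leibniz_pow, Derivation.map_natCast, hI]
  simp only [smul_eq_mul, nsmul_eq_mul]
  ring

theorem Derivation.binomialSum_of_eq_zero {A C : Type*} [CommRing A] [CommRing C] [Algebra A C]
    (δ : Derivation A C C) {V Q c : C} {I : ℕ → C} (hI : ∀ j, δ (I j) = c * Q ^ j)
    (hV : δ V = 0) (d : ℕ) : δ (binomialSum V I d) = c * (V + Q) ^ d := by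
  rw [δ.binomialSum_aux hI, hV, mul_zero, add_zero]

theorem Derivation.binomialSum_succ {A C : Type*} [CommRing A] [CommRing C] [Algebra A C]
    (δ : Derivation A C C) {V Q c : C} {I : ℕ → C} (hI : ∀ j, δ (I j) = c * Q ^ j) (d : ℕ) :
    δ (binomialSum V I (d + 1)) =
      c * (V + Q) ^ (d + 1) + (d + 1 : ℕ) * binomialSum V I d * δ V := by
  rw [δ.binomialSum_aux hI, Finset.sum_range_succ, Nat.sub_self, Nat.cast_zero, zero_mul, mul_zero,
    zero_mul, add_zero, binomialSum, Finset.mul_sum]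
  congr 2
  refine Finset.sum_congr rfl fun j hj => ?_
  have hj' : j ≤ d := Nat.lt_succ_iff.mp (Finset.mem_range.mp hj)
  have h1 : ((d + 1).choose j : C) * ((d + 1 - j : ℕ) : C) =
      ((d + 1 : ℕ) : C) * (d.choose j : C) := by
    rw [← Nat.cast_mul, ← Nat.cast_mul, ← Nat.choose_mul_succ_eq, mul_comm]
  rw [show d + 1 - j - 1 = d - j by omega]
  linear_combination (V ^ (d - j) * I j) * h1

theorem exists_derivative_eq {R : Type*} [CommRing R] [Algebra ℚ R] (f : R[X]) :
    ∃ g : R[X], derivative g = f := by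
  induction f using Polynomial.induction_on' with
  | add f g hf hg =>
    obtain ⟨f', rfl⟩ := hf
    obtain ⟨g', rfl⟩ := hg
    exact ⟨f' + g', derivative_add⟩
  | monomial i a =>
    refine ⟨monomial (i + 1) (algebraMap ℚ R (1 / (i + 1)) * a), ?_⟩
    have h : algebraMap ℚ R (1 / (i + 1)) * ((i : R) + 1) = 1 := by
      rw [← map_natCast (algebraMap ℚ R), ← map_one (algebraMap ℚ R), ← map_add, ← map_mul,
        one_div_mul_cancel (by positivity)]
    rw [derivative_monomial, Nat.add_sub_cancel]
    congr 1
    push_cast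
    linear_combination a * h

variable {K : Type*} [Field K] [CharZero K]

/-- If `∫ p (Q(s) - Q(y)) ^ d ds` is a polynomial in `Q`, then so is `∫ p`. -/
theorem exists_eq_mul_comp_of_binomialSum_eq_comp {Q q p : K[X]} (hQ : derivative Q = q)
    (hq : q ≠ 0) {I : ℕ → K[X]} (hI : ∀ j, derivative (I j) = p * Q ^ j) (d : ℕ) {H : K[X]}
    (hH : binomialSum (-Q) I d = H.comp Q) : ∃ h : K[X], p = q * h.comp Q := by
  induction d generalizing H with
  | zero =>
    have h0 : I 0 = H.comp Q := by
      rw [← hH]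
      simp [binomialSum]
    refine ⟨derivative H, ?_⟩
    have := hI 0
    rw [h0, derivative_comp, hQ, pow_zero, mul_one] at this
    exact this.symm
  | succ d ih =>
    have h1 := (derivative' (R := K)).binomialSum_succ (V := -Q) (Q := Q) (c := p) hI d
    have h2 : derivative (binomialSum (-Q) I (d + 1)) =
        p * (-Q + Q) ^ (d + 1) + (d + 1 : ℕ) * binomialSum (-Q) I d * derivative (-Q) := h1
    rw [hH, derivative_comp, derivative_neg, hQ, neg_add_cancel, zero_pow (Nat.succ_ne_zero d),
      mul_zero, zero_add] at h2
    -- The derivative of the sum for d + 1 is -(d + 1) q times the sum for d, so dividing by q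
    -- lowers d by one.
    refine ih (H := C (-((d + 1 : ℕ) : K)⁻¹) * derivative H) ?_
    have hd : (((d + 1 : ℕ) : K)) ≠ 0 := Nat.cast_ne_zero.mpr (Nat.succ_ne_zero d)
    have h3 : (derivative H).comp Q = -(C (((d + 1 : ℕ) : K)) * binomialSum (-Q) I d) := by
      refine mul_left_cancel₀ hq ?_
      rw [h2, map_natCast]
      ring
    have h4 : C (((d + 1 : ℕ) : K)⁻¹) * C (((d + 1 : ℕ) : K)) = 1 := by
      rw [← C_mul, inv_mul_cancel₀ hd, C_1]
    rw [mul_comp, C_comp, h3, C_neg]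
    linear_combination -(binomialSum (-Q) I d) * h4

/-- If `∫ p (Q(s) - Q(y)) ^ d ds` is a polynomial in `Q` up to terms of degree less than the degree
of `Q`, and `d > 0`, then it is a polynomial in `Q`. -/
theorem exists_eq_comp_of_natDegree_sub_lt {Q q p : K[X]} (hQ : derivative Q = q)
    (hN : 2 ≤ Q.natDegree) {I : ℕ → K[X]} (hI : ∀ j, derivative (I j) = p * Q ^ j) {d : ℕ}
    (hd : 0 < d) {a : K} (ha : a ≠ 0) {g : K[X]}
    (hg : (C a * binomialSum (-Q) I d - g.comp Q).natDegree < Q.natDegree) :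
    ∃ H : K[X], binomialSum (-Q) I d = H.comp Q := by
  set U := C a * binomialSum (-Q) I d - g.comp Q with hU
  obtain ⟨m, rfl⟩ := Nat.exists_eq_succ_of_ne_zero hd.ne'
  have h1 := (derivative' (R := K)).binomialSum_succ (V := -Q) (Q := Q) (c := p) hI m
  have h2 : derivative (binomialSum (-Q) I (m + 1)) =
      p * (-Q + Q) ^ (m + 1) + (m + 1 : ℕ) * binomialSum (-Q) I m * derivative (-Q) := h1
  rw [derivative_neg, hQ, neg_add_cancel, zero_pow (Nat.succ_ne_zero m), mul_zero, zero_add] at h2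
  -- As d > 0, both parts of U' are multiples of q, while a nonzero U' would have degree less than
  -- that of q. So U is constant.
  have hdvd : q ∣ derivative U := by
    rw [hU, derivative_sub, derivative_C_mul, h2, derivative_comp, hQ]
    exact dvd_sub (Dvd.intro_left (C a * ((m + 1 : ℕ) * binomialSum (-Q) I m) * -1) (by ring))
      (dvd_mul_right _ _)
  have hqd : q.natDegree = Q.natDegree - 1 := by rw [← hQ, natDegree_derivative]
  have hU' : derivative U = 0 := by
    by_contra h
    have h3 := natDegree_le_of_dvd hdvd h
    rw [natDegree_derivative, hqd] at h3
    omega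
  have hUc : U = C (U.coeff 0) :=
    eq_C_of_natDegree_eq_zero (derivative_eq_zero.mp hU')
  refine ⟨C a⁻¹ * (C (U.coeff 0) + g), ?_⟩
  have h4 : C a * binomialSum (-Q) I (m + 1) = C (U.coeff 0) + g.comp Q := by
    rw [← hUc, hU]
    ring
  rw [mul_comp, C_comp, add_comp, C_comp, ← h4, ← mul_assoc, ← C_mul, inv_mul_cancel₀ ha, C_1,
    one_mul]

end BinomialSum

/-! ### The leading coefficient modulo the maximal ideal -/

section LeadingCoefficient

open Polynomial

/-- A potential of `p = x ^ e p' z ^ d + ∑ i < d, p i z ^ i` along `x ^ n ∂_y + q ∂_z`, and its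
reduction along a curve congruent to the identity. -/
theorem exists_potential {A : Type*} [CommRing A] [Algebra ℚ A] (x : A) {n d e : ℕ} (he : e < n)
    {q Q : A[X]} (hQ : derivative Q = q) (p : ℕ → A[X]) (p' : A[X]) :
    ∃ (J : MvPolynomial (Fin 2) A) (I : ℕ → A[X]) (J' : MvPolynomial (Fin 2) A),
      planeDerivation (x ^ n) q J = MvPolynomial.C (x ^ (n * (d + 1) - e)) *
        ((∑ i ∈ Finset.range d, inclPlane (p i) * MvPolynomial.X 1 ^ i) +
          MvPolynomial.C (x ^ e) * inclPlane p' * MvPolynomial.X 1 ^ d) ∧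
      (∀ j, derivative (I j) = p' * Q ^ j) ∧
      J = binomialSum (MvPolynomial.C (x ^ n) * MvPolynomial.X 1 - inclPlane Q)
        (fun j => inclPlane (I j)) d + MvPolynomial.C x * J' := by
  choose I hI using fun j => exists_derivative_eq (p' * Q ^ j)
  choose I' hI' using fun i j => exists_derivative_eq (p i * Q ^ j)
  set V : MvPolynomial (Fin 2) A := MvPolynomial.C (x ^ n) * MvPolynomial.X 1 - inclPlane Q with hV
  set D := planeDerivation (x ^ n) q with hD
  have hDC : ∀ (a : A) f, D (MvPolynomial.C a * f) = MvPolynomial.C a * D f := fun a f => by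
    rw [Derivation.leibniz, ← MvPolynomial.algebraMap_eq, Derivation.map_algebraMap, smul_zero,
      add_zero, smul_eq_mul]
  have hDV : D V = 0 := by
    rw [hV, map_sub, hDC, planeDerivation_X_one, planeDerivation_inclPlane, hQ,
      MvPolynomial.algebraMap_eq, sub_self]
  have hVQ : V + inclPlane Q = MvPolynomial.C (x ^ n) * MvPolynomial.X 1 := by rw [hV]; ring
  have hbs : ∀ (c : A[X]) (K : ℕ → A[X]), (∀ j, derivative (K j) = c * Q ^ j) → ∀ i,
      D (binomialSum V (fun j => inclPlane (K j)) i) =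
        MvPolynomial.C (x ^ (n * (i + 1))) * (inclPlane c * MvPolynomial.X 1 ^ i) := by
    intro c K hK i
    rw [D.binomialSum_of_eq_zero (Q := inclPlane Q) (c := MvPolynomial.C (x ^ n) * inclPlane c)
      (fun j => by
        rw [hD, planeDerivation_inclPlane, hK, MvPolynomial.algebraMap_eq, map_mul inclPlane,
          map_pow inclPlane]
        ring) hDV, hVQ, mul_pow, ← map_pow, ← pow_mul, Nat.mul_succ, pow_add, map_mul]
    ring
  -- A binomial sum of index i is a potential of x^(n (i + 1)) p i z^i. Reaching the exponent n (d +
  -- 1) - e leaves the factor x^(n (d - i) - e) for i < d, which is divisible by x because e < n.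
  refine ⟨binomialSum V (fun j => inclPlane (I j)) d + MvPolynomial.C x *
    ∑ i ∈ Finset.range d, MvPolynomial.C (x ^ (n * (d - i) - e - 1)) *
      binomialSum V (fun j => inclPlane (I' i j)) i, I, _, ?_, hI, rfl⟩
  have hnd : e + (n * (d + 1) - e) = n * (d + 1) := by
    have : n * 1 ≤ n * (d + 1) := Nat.mul_le_mul_left n (by omega)
    omega
  rw [map_add, hDC, map_sum, hbs p' I hI, mul_add (MvPolynomial.C _), add_comm, Finset.mul_sum,
    Finset.mul_sum]
  congr 1
  · refine Finset.sum_congr rfl fun i hi => ?_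
    have hid : 1 ≤ d - i := by
      have := Finset.mem_range.mp hi
      omega
    have h1 : 1 + (n * (d - i) - e - 1) + n * (i + 1) = n * (d + 1) - e := by
      have h2 : n * (d - i) + n * (i + 1) = n * (d + 1) := by
        rw [← Nat.mul_add]
        congr 1
        have := Finset.mem_range.mp hi
        omega
      have h3 : n * 1 ≤ n * (d - i) := Nat.mul_le_mul_left n hid
      omega
    rw [hDC, hbs (p i) (I' i) (hI' i), ← h1, pow_add, pow_add, pow_one, map_mul, map_mul]
    ring
  · have hpow : (MvPolynomial.C (x ^ (n * (d + 1))) : MvPolynomial (Fin 2) A) =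
        MvPolynomial.C (x ^ e) * MvPolynomial.C (x ^ (n * (d + 1) - e)) := by
      rw [← map_mul, ← pow_add, hnd]
    rw [hpow]
    ring

/-- Modulo x the curve has y = Y and V = -Q, so the coordinate z disappears and only the integral of
the leading coefficient survives. -/
theorem map_residue_planeEval {A : Type*} [CommRing A] [IsLocalRing A] {x : A}
    (hx : x ∈ IsLocalRing.maximalIdeal A) {n d : ℕ} (hn : 0 < n) {φ η g : A[X]}
    (hφ : φ = X + C x * g) (Q : A[X]) (I : ℕ → A[X]) (J' : MvPolynomial (Fin 2) A) :
    (planeEval φ η (binomialSum (MvPolynomial.C (x ^ n) * MvPolynomial.X 1 - inclPlane Q)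
        (fun j => inclPlane (I j)) d + MvPolynomial.C x * J')).map (IsLocalRing.residue A) =
      binomialSum (-(Q.map (IsLocalRing.residue A)))
        (fun j => (I j).map (IsLocalRing.residue A)) d := by
  have hx0 : IsLocalRing.residue A x = 0 := (IsLocalRing.residue_eq_zero_iff x).mpr hx
  set ρ := IsLocalRing.residue A
  have hφ' : φ.map ρ = X := by
    rw [hφ, Polynomial.map_add, Polynomial.map_mul, map_X, map_C, hx0, C_0, zero_mul, add_zero]
  have hf : ∀ f : A[X], (aeval φ f : A[X]).map ρ = f.map ρ := fun f => by
    have : (aeval φ f : A[X]) = f.comp φ := rfl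
    rw [this, Polynomial.map_comp, hφ', comp_X]
  have hC : ∀ a : A, planeEval φ η (MvPolynomial.C a) = C a := fun a => by
    rw [← MvPolynomial.algebraMap_eq, AlgHom.commutes]
    rfl
  have h1 := map_binomialSum ((mapRingHom ρ).comp (planeEval (A := A) φ η).toRingHom)
    (MvPolynomial.C (x ^ n) * MvPolynomial.X 1 - inclPlane Q) (fun j => inclPlane (I j)) d
  simp only [RingHom.comp_apply, AlgHom.toRingHom_eq_coe, RingHom.coe_coe, coe_mapRingHom, map_sub,
    map_mul, planeEval_inclPlane, hf, hC, map_C, map_pow, hx0, zero_pow hn.ne', C_0, zero_mul,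
    zero_sub] at h1
  rw [map_add, map_mul, Polynomial.map_add, Polynomial.map_mul, hC, map_C, hx0, C_0, zero_mul,
    add_zero, map_pow MvPolynomial.C, ← h1]

/-- Under the valuative consequences of properness, the leading coefficient `p'` of `p` with
respect to `z` is, modulo the maximal ideal, of the form `q h(Q)`. -/
theorem exists_leadingCoeff_eq_mul_comp {A : Type u} [CommRing A] [IsDomain A]
    [IsDiscreteValuationRing A] [Algebra ℚ A]
    {Ω : Type*} [Field Ω] [IsAlgClosed Ω] [Algebra A Ω] {Γ₀ : Type*}
    [LinearOrderedCommGroupWithZero Γ₀] {w : Valuation Ω Γ₀}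
    (hw : ∀ a : A, w (algebraMap A Ω a) ≤ 1) {x : A} (hxi : Irreducible x)
    (hx0 : algebraMap A Ω x ≠ 0)
    (hx : w (algebraMap A Ω x) < 1) {n : ℕ} (hn : 0 < n) {q Q : A[X]} (hQ : derivative Q = q)
    (hq : 0 < (q.map (IsLocalRing.residue A)).natDegree)
    {p : ℕ → A[X]} {p' : A[X]} {d e : ℕ} (hd : 0 < d) (he : e < n)
    {P : MvPolynomial (Fin 2) A}
    (hP : P = (∑ i ∈ Finset.range d, inclPlane (p i) * MvPolynomial.X 1 ^ i) +
          MvPolynomial.C (x ^ e) * inclPlane p' * MvPolynomial.X 1 ^ d)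
    (hV : HasIntegralTime w x n q Q P) (hF : HasNoFixedPoint w q P) :
    ∃ h : A[X], p'.map (IsLocalRing.residue A) =
      (q * h.comp Q).map (IsLocalRing.residue A) := by
  let _ : Algebra ℚ (IsLocalRing.ResidueField A) :=
    ((IsLocalRing.residue A).comp (algebraMap ℚ A)).toAlgebra
  have : CharZero (IsLocalRing.ResidueField A) := algebraRat.charZero _
  have hres : Function.Surjective (IsLocalRing.residue A) := IsLocalRing.residue_surjective
  have hxm : x ∈ IsLocalRing.maximalIdeal A := by
    rw [hxi.maximalIdeal_eq]
    exact Ideal.mem_span_singleton_self x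
  set ρ := IsLocalRing.residue A with hρ
  have hQρ : derivative (Q.map ρ) = q.map ρ := by rw [derivative_map, hQ]
  set N := (Q.map ρ).natDegree with hN
  have hqN : (q.map ρ).natDegree = N - 1 := by rw [← hQρ, natDegree_derivative]
  have hN2 : 2 ≤ N := by omega
  have : NeZero N := ⟨by omega⟩
  have hq0 : q.map ρ ≠ 0 := fun h => by
    rw [h, natDegree_zero] at hq
    exact lt_irrefl 0 hq
  obtain ⟨J, I, J', hJ, hI, hJe⟩ := exists_potential x (d := d) he hQ p p'
  rw [← hP] at hJ
  obtain ⟨φ, η, R, g, hφ, hQφ, hRN, hRu⟩ := exists_comp_eq_add hxi (Q := Q) hN.symm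
    (by rw [hQ]; exact hq0) (by rw [hQ, ← hρ, hqN]; omega) hn
  obtain ⟨l, hl⟩ := hRu
  set S : A[X] := C (↑l⁻¹ : A) * R with hS
  have hRS : R = C (l : A) * S := by
    rw [hS, ← mul_assoc, ← C_mul, Units.mul_inv, C_1, one_mul]
  have hSd : S.natDegree ≤ N := (natDegree_C_mul_le _ _).trans hRN
  have hSm : S.Monic := by
    refine monic_of_natDegree_le_of_coeff_eq_one N hSd ?_
    rw [hS, coeff_C_mul, ← hl, Units.inv_mul]
  have hSN : S.natDegree = N := by
    refine le_antisymm hSd (le_natDegree_of_ne_zero ?_)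
    rw [hS, coeff_C_mul, ← hl, Units.inv_mul]
    exact one_ne_zero
  clear_value S
  rw [hRS] at hQφ
  have hroot := fun (y : Ω) (hy : w y ≤ 1) => aeval_relativeNorm_ne_zero hw hx0 hx hn hQ hV hF
    hφ hQφ hSm (by rw [hSN]; omega) hJ hy
  obtain ⟨h0, hk⟩ := coeff_succ_mem_of_no_integral_root hw _ hroot
  obtain ⟨G, hG⟩ := ConfigurationAtInfinity.exists_natDegree_sub_comp_lt hSm hSN hN2 _ h0 hk
  have hT := map_residue_planeEval (d := d) hxm hn (η := η) hφ Q I J'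
  rw [← hJe] at hT
  have hQS : Q.map ρ = C (ρ l) * S.map ρ := by
    have h1 := congrArg (Polynomial.map ρ) hQφ
    have hφ' : φ.map ρ = X := by
      rw [hφ, Polynomial.map_add, Polynomial.map_mul, map_X, map_C,
        (IsLocalRing.residue_eq_zero_iff x).mpr hxm, C_0, zero_mul, add_zero]
    rw [Polynomial.map_comp, hφ', comp_X, Polynomial.map_add, Polynomial.map_mul,
      Polynomial.map_mul, map_C, map_C, map_pow, (IsLocalRing.residue_eq_zero_iff x).mpr hxm,
      zero_pow hn.ne', C_0, zero_mul,
      add_zero] at h1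
    exact h1
  have hlu : ρ l ≠ 0 := (l.isUnit.map ρ).ne_zero
  have hSQ : S.map ρ = C (ρ l)⁻¹ * Q.map ρ := by
    rw [hQS, ← mul_assoc, ← C_mul, inv_mul_cancel₀ hlu, C_1, one_mul]
  have hIρ : ∀ j, derivative ((I j).map ρ) = p'.map ρ * (Q.map ρ) ^ j := fun j => by
    rw [derivative_map, hI, Polynomial.map_mul, Polynomial.map_pow]
  have hG' : (C (N : IsLocalRing.ResidueField A) *
      binomialSum (-(Q.map ρ)) (fun j => (I j).map ρ) d -
        ((G.map ρ).comp (C (ρ l)⁻¹ * X)).comp (Q.map ρ)).natDegree < (Q.map ρ).natDegree := by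
    rw [comp_assoc, mul_comp, C_comp, X_comp, ← hSQ, ← hT, ← Polynomial.map_comp, C_eq_natCast]
    rw [← hρ, Polynomial.map_sub, Polynomial.map_mul, Polynomial.map_natCast] at hG
    exact hG
  obtain ⟨H, hH⟩ := exists_eq_comp_of_natDegree_sub_lt hQρ hN2 hIρ hd
    (Nat.cast_ne_zero.mpr (NeZero.ne N)) hG'
  obtain ⟨h, hh⟩ := exists_eq_mul_comp_of_binomialSum_eq_comp hQρ hq0 hIρ d hH
  obtain ⟨h', rfl⟩ := map_surjective ρ hres h
  exact ⟨h', by rw [hh, Polynomial.map_mul, Polynomial.map_comp]⟩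

end LeadingCoefficient

/-! ### Removing the powers of z -/

section Reduction

open Polynomial

variable {A : Type u} [CommRing A]

theorem exists_eq_sum_inclPlane_mul_pow (P : MvPolynomial (Fin 2) A) :
    ∃ (d : ℕ) (p : ℕ → A[X]),
      P = ∑ i ∈ Finset.range d, inclPlane (p i) * MvPolynomial.X 1 ^ i := by
  suffices h : ∃ f : (A[X])[X], P = f.eval₂ (inclPlane (A := A) : A[X] →+* _) (MvPolynomial.X 1) by
    obtain ⟨f, rfl⟩ := h
    exact ⟨f.natDegree + 1, f.coeff, eval₂_eq_sum_range _ _⟩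
  induction P using MvPolynomial.induction_on with
  | C a => exact ⟨C (C a), by simp [inclPlane, MvPolynomial.algebraMap_eq]⟩
  | add P P' hP hP' =>
    obtain ⟨f, rfl⟩ := hP
    obtain ⟨f', rfl⟩ := hP'
    exact ⟨f + f', by rw [eval₂_add]⟩
  | mul_X P i hP =>
    obtain ⟨f, rfl⟩ := hP
    fin_cases i
    · exact ⟨f * C X, by simp [eval₂_mul, inclPlane]⟩
    · exact ⟨f * X, by simp [eval₂_mul]⟩

theorem planeDerivation_inclPlane_mul_pow (a : A) (q f : A[X]) (d : ℕ) :
    planeDerivation a q (inclPlane f * MvPolynomial.X 1 ^ d) =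
      MvPolynomial.C a * inclPlane (derivative f) * MvPolynomial.X 1 ^ d +
        (d : MvPolynomial (Fin 2) A) * inclPlane (q * f) * MvPolynomial.X 1 ^ (d - 1) := by
  rw [Derivation.leibniz, Derivation.leibniz_pow, planeDerivation_X_one, planeDerivation_inclPlane,
    smul_eq_mul, smul_eq_mul, smul_eq_mul, nsmul_eq_mul, MvPolynomial.algebraMap_eq, map_mul]
  ring

variable [Algebra ℚ A]

/-- Integration by parts: D(Q^m z^(d+1)) is (d + 1) q Q^m z^d plus a multiple of q Q^(m-1) z^(d+1),
and the latter is in the range by induction on m. -/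
theorem planeDerivation_mul_pow_mem_range (a : A) {q Q : A[X]} (hQ : derivative Q = q) (m d : ℕ) :
    inclPlane (q * Q ^ m) * MvPolynomial.X 1 ^ d ∈
      LinearMap.range (planeDerivation a q).toLinearMap := by
  have hc : ∃ c : A, c * ((d + 1 : ℕ) : A) = 1 := ⟨algebraMap ℚ A ((d + 1 : ℕ) : ℚ)⁻¹, by
    rw [← map_natCast (algebraMap ℚ A), ← map_mul,
      inv_mul_cancel₀ (Nat.cast_ne_zero.mpr d.succ_ne_zero), map_one]⟩
  obtain ⟨c, hc⟩ := hc
  have hc' : MvPolynomial.C c * ((d + 1 : ℕ) : MvPolynomial (Fin 2) A) = 1 := by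
    rw [← map_natCast (MvPolynomial.C (σ := Fin 2) (R := A)), ← map_mul, hc, map_one]
  have key : inclPlane (q * Q ^ m) * MvPolynomial.X 1 ^ d =
      c • planeDerivation a q (inclPlane (Q ^ m) * MvPolynomial.X 1 ^ (d + 1)) -
      (c * a) • (inclPlane (derivative (Q ^ m)) * MvPolynomial.X 1 ^ (d + 1)) := by
    rw [planeDerivation_inclPlane_mul_pow, Nat.add_sub_cancel, MvPolynomial.smul_eq_C_mul,
      MvPolynomial.smul_eq_C_mul, map_mul MvPolynomial.C]
    linear_combination (-inclPlane (q * Q ^ m) * MvPolynomial.X 1 ^ d) * hc'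
  rw [key]
  refine Submodule.sub_mem _ (Submodule.smul_mem _ _ ⟨_, rfl⟩) (Submodule.smul_mem _ _ ?_)
  cases m with
  | zero => simp
  | succ m =>
    have := planeDerivation_mul_pow_mem_range a hQ m (d + 1)
    rw [derivative_pow_succ, hQ]
    have h2 : inclPlane (C ((m : A) + 1) * Q ^ m * q) * MvPolynomial.X 1 ^ (d + 1) =
        ((m : A) + 1) • (inclPlane (q * Q ^ m) * MvPolynomial.X 1 ^ (d + 1)) := by
      rw [← smul_eq_C_mul, smul_mul_assoc, map_smul, smul_mul_assoc, mul_comm q]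
    rw [h2]
    exact Submodule.smul_mem _ _ this

theorem planeDerivation_mul_comp_mem_range (a : A) {q Q : A[X]} (hQ : derivative Q = q) (h : A[X])
    (d : ℕ) : inclPlane (q * h.comp Q) * MvPolynomial.X 1 ^ d ∈
      LinearMap.range (planeDerivation a q).toLinearMap := by
  induction h using Polynomial.induction_on' with
  | add f g hf hg =>
    rw [add_comp, mul_add, map_add, add_mul]
    exact Submodule.add_mem _ hf hg
  | monomial m c =>
    rw [← C_mul_X_pow_eq_monomial, mul_comp, C_comp, X_pow_comp, ← smul_eq_C_mul, mul_smul_comm,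
      map_smul, smul_mul_assoc]
    exact Submodule.smul_mem _ _ (planeDerivation_mul_pow_mem_range a hQ m d)

variable [IsDomain A] [IsDiscreteValuationRing A]
    {Ω : Type*} [Field Ω] [IsAlgClosed Ω] [Algebra A Ω] {Γ₀ : Type*}
    [LinearOrderedCommGroupWithZero Γ₀] {w : Valuation Ω Γ₀}

/-- Under the valuative consequences of properness, `p` is the sum of a polynomial in `y` and of an
element of the image of `x ^ n ∂_y + q ∂_z`. -/
theorem exists_sub_planeDerivation_eq_inclPlane
    (hw : ∀ a : A, w (algebraMap A Ω a) ≤ 1) {x : A} (hxi : Irreducible x)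
    (hx0 : algebraMap A Ω x ≠ 0) (hx : w (algebraMap A Ω x) < 1) {n : ℕ} (hn : 0 < n)
    {q Q : A[X]} (hQ : derivative Q = q)
    (hq : 0 < (q.map (IsLocalRing.residue A)).natDegree) {P : MvPolynomial (Fin 2) A}
    (hV : HasIntegralTime w x n q Q P) (hF : HasNoFixedPoint w q P) :
    ∃ (h : MvPolynomial (Fin 2) A) (p₀ : A[X]), P - planeDerivation (x ^ n) q h = inclPlane p₀ := by
  obtain ⟨d, p, hP⟩ := exists_eq_sum_inclPlane_mul_pow P
  induction d generalizing P p with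
  | zero => exact ⟨0, 0, by simp [hP]⟩
  | succ d ih =>
    rcases Nat.eq_zero_or_pos d with rfl | hd
    · exact ⟨0, p 0, by simp [hP]⟩
    -- Inner induction on m = n - e, where x^e is a known factor of the coefficient of z^d; the
    -- lower coefficients stay unchanged.
    suffices H : ∀ m e, e + m = n → ∀ (p' : A[X]) (P : MvPolynomial (Fin 2) A),
        HasIntegralTime w x n q Q P → HasNoFixedPoint w q P →
        P = (∑ i ∈ Finset.range d, inclPlane (p i) * MvPolynomial.X 1 ^ i) +
          MvPolynomial.C (x ^ e) * inclPlane p' * MvPolynomial.X 1 ^ d →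
        ∃ (h : MvPolynomial (Fin 2) A) (p₀ : A[X]),
          P - planeDerivation (x ^ n) q h = inclPlane p₀ by
      refine H n 0 (zero_add n) (p d) P hV hF ?_
      rw [hP, Finset.sum_range_succ, pow_zero, map_one, one_mul]
    intro m
    induction m with
    | zero =>
      rintro e rfl p' P hV hF hP
      -- For e = n the leading term is removed by D(s z^d), at the cost of d q s z^(d-1), and the
      -- degree in z drops.
      obtain ⟨s, hs⟩ := exists_derivative_eq p'
      obtain ⟨h, p₀, hh⟩ := ih (hV.sub hw (inclPlane s * MvPolynomial.X 1 ^ d))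
        (hF.sub hn hw hx (inclPlane s * MvPolynomial.X 1 ^ d))
        (fun i => if i = d - 1 then p i - (d : A[X]) * (q * s) else p i) (by
          rw [planeDerivation_inclPlane_mul_pow, hs, hP]
          obtain ⟨d, rfl⟩ := Nat.exists_eq_succ_of_ne_zero hd.ne'
          simp only [Nat.succ_eq_add_one, Nat.add_sub_cancel, Finset.sum_range_succ, if_true,
            add_zero]
          have hne : ∑ i ∈ Finset.range d, inclPlane (if i = d then p i - ((d + 1 : ℕ) : A[X]) *
              (q * s) else p i) * MvPolynomial.X 1 ^ i =
              ∑ i ∈ Finset.range d, inclPlane (p i) * MvPolynomial.X 1 ^ i :=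
            Finset.sum_congr rfl fun i hi => by rw [if_neg (Finset.mem_range.mp hi).ne]
          rw [hne, map_sub, map_mul inclPlane (_ : A[X]) (q * s), map_natCast]
          ring)
      exact ⟨inclPlane s * MvPolynomial.X 1 ^ d + h, p₀, by rw [map_add, ← sub_sub, hh]⟩
    | succ m ihm =>
      intro e he p' P hV hF hP
      obtain ⟨h, hh⟩ := exists_leadingCoeff_eq_mul_comp hw hxi hx0 hx hn hQ hq hd
        (show e < n by omega) hP hV hF
      -- Writing p' = q h(Q) + x r, the first part is removed through the image of D and the
      -- coefficient becomes x^(e+1) r.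
      obtain ⟨r, hr⟩ := exists_eq_add_C_mul_of_map_residue_eq hxi hh
      obtain ⟨F, hF'⟩ := planeDerivation_mul_comp_mem_range (x ^ n) hQ h d
      have hF'' : planeDerivation (x ^ n) q (x ^ e • F) = MvPolynomial.C (x ^ e) *
          (inclPlane (q * h.comp Q) * MvPolynomial.X 1 ^ d) := by
        rw [← hF', ← MvPolynomial.smul_eq_C_mul, Derivation.map_smul]
        rfl
      obtain ⟨f, p₀, hf⟩ := ihm (e + 1) (by omega) r _ (hV.sub hw (x ^ e • F))
        (hF.sub hn hw hx (x ^ e • F)) (by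
          have hCx : inclPlane (C x) = (MvPolynomial.C x : MvPolynomial (Fin 2) A) := by
            rw [inclPlane, aeval_C, MvPolynomial.algebraMap_eq]
          rw [hF'', hP, hr, map_add, map_mul inclPlane (C x), hCx, pow_succ, map_mul MvPolynomial.C]
          ring)
      exact ⟨x ^ e • F + f, p₀, by rw [map_add, ← sub_sub, hf]⟩

end Reduction

/-! ### Shears in the last variable -/

section Shear

variable {A : Type*} [CommRing A]

theorem spaceEval_X_zero_X_one_inclYZ (f : Poly3 A) (h : MvPolynomial (Fin 2) A) :
    spaceEval (MvPolynomial.X 0) (MvPolynomial.X 1) f (inclYZ h) = inclYZ h := by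
  rw [spaceEval_inclYZ, inclYZ_eq]

/-- The automorphism `u ↦ u + h(y, z)` of `A[y, z, u]`. -/
noncomputable def shear (h : MvPolynomial (Fin 2) A) : Poly3 A ≃ₐ[A] Poly3 A :=
  AlgEquiv.ofAlgHom
    (spaceEval (MvPolynomial.X 0) (MvPolynomial.X 1) (MvPolynomial.X 2 + inclYZ h))
    (spaceEval (MvPolynomial.X 0) (MvPolynomial.X 1) (MvPolynomial.X 2 - inclYZ h))
    (space_algHom_ext (by simp) (by simp)
      (by simp [spaceEval_X_zero_X_one_inclYZ, -spaceEval_inclYZ]))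
    (space_algHom_ext (by simp) (by simp)
      (by simp [spaceEval_X_zero_X_one_inclYZ, -spaceEval_inclYZ]))

theorem shear_X_zero (h : MvPolynomial (Fin 2) A) :
    shear h (MvPolynomial.X 0) = MvPolynomial.X 0 := spaceEval_X_zero ..

theorem shear_symm_X_zero (h : MvPolynomial (Fin 2) A) :
    (shear h).symm (MvPolynomial.X 0) = MvPolynomial.X 0 := spaceEval_X_zero ..

theorem shear_symm_X_one (h : MvPolynomial (Fin 2) A) :
    (shear h).symm (MvPolynomial.X 1) = MvPolynomial.X 1 := spaceEval_X_one ..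

theorem shear_symm_X_two (h : MvPolynomial (Fin 2) A) :
    (shear h).symm (MvPolynomial.X 2) = MvPolynomial.X 2 - inclYZ h := spaceEval_X_two ..

theorem shear_symm_inclY (h : MvPolynomial (Fin 2) A) (f : Polynomial A) :
    (shear h).symm (inclY f) = inclY f := by
  rw [inclY, ← Polynomial.aeval_algHom_apply (shear h).symm, shear_symm_X_zero]

theorem twinTriangularDerivation_eq (a : A) (q p : Polynomial A) :
    twinTriangularDerivation a q p = triangularDerivation a q (inclPlane p) := by
  rw [twinTriangularDerivation, triangularDerivation, inclYZ_inclPlane]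

/-- A triangular derivation whose last coefficient is a polynomial in `y` up to the image of the
derivation is twin-triangulable. -/
theorem isTwinTriangulable_of_sub_eq_inclPlane {a : A} {q p₀ : Polynomial A}
    {p h : MvPolynomial (Fin 2) A} (hp : p - planeDerivation a q h = inclPlane p₀) :
    IsTwinTriangulable a (triangularDerivation a q p) := by
  refine ⟨shear h, shear_X_zero h, q, p₀, fun f => ?_⟩
  rw [← AlgEquiv.eq_symm_apply, twinTriangularDerivation_eq]
  induction f using MvPolynomial.induction_on with
  | C c =>
    rw [← MvPolynomial.algebraMap_eq, AlgEquiv.commutes, Derivation.map_algebraMap,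
      Derivation.map_algebraMap, map_zero]
  | add f g hf hg => simp only [map_add, hf, hg]
  | mul_X f i hf =>
    rw [map_mul, Derivation.leibniz, Derivation.leibniz, hf, map_add, smul_eq_mul, smul_eq_mul,
      smul_eq_mul, smul_eq_mul, map_mul, map_mul]
    congr 2
    fin_cases i
    · change triangularDerivation a q p ((shear h).symm (MvPolynomial.X 0)) =
        (shear h).symm (triangularDerivation a q (inclPlane p₀) (MvPolynomial.X 0))
      rw [shear_symm_X_zero, triangularDerivation_X_zero, triangularDerivation_X_zero,
        AlgEquiv.commutes]
    · change triangularDerivation a q p ((shear h).symm (MvPolynomial.X 1)) =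
        (shear h).symm (triangularDerivation a q (inclPlane p₀) (MvPolynomial.X 1))
      rw [shear_symm_X_one, triangularDerivation_X_one, triangularDerivation_X_one,
        shear_symm_inclY]
    · change triangularDerivation a q p ((shear h).symm (MvPolynomial.X 2)) =
        (shear h).symm (triangularDerivation a q (inclPlane p₀) (MvPolynomial.X 2))
      rw [shear_symm_X_two, map_sub, triangularDerivation_X_two, triangularDerivation_X_two,
        triangularDerivation_inclYZ, inclYZ_inclPlane, shear_symm_inclY, ← map_sub, hp,
        inclYZ_inclPlane]

end Shear

/-! ### Proper triangular actions are twin-triangulable -/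

theorem mainTheorem5 {k : Type*} [Field k] [CharZero k]
    {A : Type u} [CommRing A] [IsDomain A] [IsDiscreteValuationRing A] [Algebra k A]
    (x : A) (hx : Irreducible x) (n : ℕ) (hn : 0 < n)
    (q : Polynomial A) (hq : 0 < (q.map (IsLocalRing.residue A)).natDegree)
    (p : MvPolynomial (Fin 2) A)
    (hproper : GeneratesProperAction k (triangularDerivation (x ^ n) q p)
      (triangularDerivation_isLocallyNilpotent (x ^ n) q p)) :
    IsTwinTriangulable (x ^ n) (triangularDerivation (x ^ n) q p) := by
  let _ : Algebra ℚ A := ((algebraMap k A).comp (algebraMap ℚ k)).toAlgebra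
  let Ω := AlgebraicClosure (FractionRing A)
  have hinj : Function.Injective (algebraMap A Ω) := by
    rw [IsScalarTower.algebraMap_eq A (FractionRing A) Ω]
    exact (algebraMap (FractionRing A) Ω).injective.comp (IsFractionRing.injective A _)
  -- A valuation ring of the algebraic closure dominating `A`; locality of the inclusion makes the
  -- value of x less than 1.
  obtain ⟨V, hV, hloc⟩ := IsLocalRing.exists_factor_valuationRing (algebraMap A Ω)
  have hw : ∀ a : A, V.valuation (algebraMap A Ω a) ≤ 1 := fun a => V.valuation_le_one ⟨_, hV a⟩
  have hx0 : algebraMap A Ω x ≠ 0 := (map_ne_zero_iff _ hinj).mpr hx.ne_zero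
  have hxV : V.valuation (algebraMap A Ω x) < 1 := by
    refine (V.valuation_lt_one_iff ⟨_, hV x⟩).mp ?_
    rw [IsLocalRing.mem_maximalIdeal, mem_nonunits_iff]
    exact fun hu => hx.not_isUnit (hloc.map_nonunit x hu)
  obtain ⟨Q, hQ⟩ := exists_derivative_eq q
  obtain ⟨h, p₀, hp⟩ := exists_sub_planeDerivation_eq_inclPlane hw hx hx0 hxV hn hQ hq
    (hproper.hasIntegralTime k hx0 hQ hw) (hproper.hasNoFixedPoint k hn hw hxV)
  exact isTwinTriangulable_of_sub_eq_inclPlane hp
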